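/- Strings are finite sequences over an alphabet $\Sigma$; $X\subseteq S$ means that $X$ is a (not necessarily contiguous) subsequence of $S$, $|S|_\sigma$ is the number of occurrences of the letter $\sigma$ in $S$, and positions are numbered from $1$. For $k\ge 1$, $X$ is a *$k$-repeating subsequence* of $S$ if the concatenation $X^k$ satisfies $X^k\subseteq S$; it is a *maximal* one if moreover no $Y\ne X$ with $X\subseteq Y$ is a $k$-repeating subsequence of $S$. Write $S(a,b)$ for the substring of $S$ on the positions $p$ with $a<p<b$ (and similarly $S(a,b]$, $S[a,b)$). Let $\mathrm{next}_S(B,i)$ be the least $j\ge i$ with $B\subseteq S(i,j]$, and $\mathrm{prev}_S(A,i)$ the largest $l\le i$ with $A\subseteq S[l,i)$ (undefined if there is none). A tuple $(p_1,\dots,p_k)$ of positions of $\sigma$ in $S$ is a *$\sigma$-split point* for $(A,B)$ if all $\mathrm{next}_S(B,p_i)$ and $\mathrm{prev}_S(A,p_i)$ are defined and $\mathrm{next}_S(B,p_i)<\mathrm{prev}_S(A,p_{i+1})$ for $1\le i<k$. A *constrained MCS procedure* is a function $\mathrm{MkCS}$ that, given one or more strings $T_1,\dots,T_m$ and a common subsequence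 $C$ of them, returns a maximal common subsequence $\mathrm{MkCS}(T_1,\dots,T_m;C)$ of $T_1,\dots,T_m$ that contains $C$ as a subsequence. *Algorithm Extend-$k$-RepSubseq$(S,X,\sigma)$*, where $X^k\subseteq S$ and $\sigma$ occurs in $X$. Put $r=|X|_\sigma$ and $R=|S|_\sigma-kr$ (the number of occurrences of $\sigma$ in $S$ left unused after placing $k$ copies of $X$), let $I_1<I_2<\dots$ be the positions of $\sigma$ in $S$, and write $X=A\sigma B$ with $\sigma$ not occurring in $A$. For every $(\delta_1,\dots,\delta_{k+1})\in\mathbb Z_{\ge0}^{k+1}$ with $\sum_i\delta_i=R$, in lexicographic order, let $p_t=I_{(t-1)r+1+\delta_1+\dots+\delta_t}$ for $1\le t\le k$. If $(p_1,\dots,p_k)$ is a $\sigma$-split point for the current $(A,B)$, then first replace $B$ by $\mathrm{MkCS}(S(p_1,e_1),\dots,S(p_k,e_k);B)$, where $e_i=\mathrm{prev}_S(A,p_{i+1})$ for $i<k$ and $e_k=|S|+1$; then, with this new $B$, replace $A$ by $\mathrm{MkCS}(S(s_1,p_1),\dots,S(s_k,p_k);A)$, where $s_1=0$ and $s_i=\mathrm{next}_S(B,p_{i-1})$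 for $i>1$. After the last tuple return $A\sigma B$. **Theorem.** 1. (Correctness.) Over every alphabet and for every constrained MCS procedure $\mathrm{MkCS}$, if $k\ge1$, $X^k\subseteq S$ and $\sigma$ occurs in $X$, then Extend-$k$-RepSubseq$(S,X,\sigma)$ returns a maximal $k$-repeating subsequence $Y$ of $S$ with $X\subseteq Y$. 2. (Running time.) The algorithm can be implemented in $O\!\left(\binom{R+k}{k}\,k\,n\log n\right)$ time, $n=|S|$, on a word RAM. Precisely, for the alphabet $\mathbb N$ there are a constrained MCS procedure $\mathrm{MkCS}$, a single word RAM program and a constant $c\in\mathbb N$ such that, for all $k\ge1$, $S$, $X$, $\sigma$ with $X^k\subseteq S$ and $\sigma$ occurring in $X$, and for every word bound $W\ge(n+1)^c$ that exceeds all letters of $S$, the program on input $(k,S,X,\sigma)$ halts with output Extend-$k$-RepSubseq$(S,X,\sigma)$ after at most $c\binom{R+k}{k}\,k\,n\log(n+1)$ steps. Here a word RAM program is a structured program (assignment, array write, sequencing, branching, loops) over finitely many registers and random-access arrays whose words are natural numbers less than $W$; reading a literal, a register or an array entry, each word operation ($+$, truncated $-$, $\times$, integer division, $<$, $=$) and each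 execution of an assignment, write, test or empty statement costs one step, and a run that overflows a word does not count as halting. The letters of $S$ and $X$ are given in two arrays, and all memory not used by the input is initially zero. -/

import Mathlib

/-! ## Repeating subsequences

Strings over an alphabet `α` are lists, `X <+ S` (`List.Sublist`) is the (non-contiguous) subsequence
relation, and positions in a string are counted from `1`. -/

namespace KRep

/-- `X` is a `k`-repeating subsequence of `S`: the `k`-fold concatenation `X ^ k` is a
subsequence of `S`. -/
def IsKRep {α : Type*} (k : ℕ) (S X : List α) : Prop :=
  (List.replicate k X).flatten.Sublist S

/-- `X` is a maximal `k`-repeating subsequence of `S`: no proper supersequence of `X` is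
`k`-repeating in `S`. -/
def IsMaxKRep {α : Type*} (k : ℕ) (S X : List α) : Prop :=
  IsKRep k S X ∧ ∀ Y : List α, X.Sublist Y → Y ≠ X → ¬ IsKRep k S Y

/-- `C` is a maximal common subsequence of the strings in `Ts`. -/
def IsMCS {α : Type*} (Ts : List (List α)) (C : List α) : Prop :=
  (∀ T ∈ Ts, C.Sublist T) ∧
    ∀ D : List α, (∀ T ∈ Ts, D.Sublist T) → C.Sublist D → D = C

/-- `M` solves the constrained maximal common subsequence problem: given at least one string and a
common subsequence `B` of the given strings, it returns a maximal common subsequence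
containing `B`. -/
def IsMCSProcedure {α : Type*} (M : List (List α) → List α → List α) : Prop :=
  ∀ (Ts : List (List α)) (B : List α), Ts ≠ [] → (∀ T ∈ Ts, B.Sublist T) →
    IsMCS Ts (M Ts B) ∧ B.Sublist (M Ts B)

/-- The substring `S(a, b)` of the letters at the positions `p` with `a < p < b`. -/
def between {α : Type*} (S : List α) (a b : ℕ) : List α :=
  (S.take (b - 1)).drop a

open Classical in
/-- `next_S(X, i)`: the smallest `j ≥ i` such that `X` is a subsequence of the substring of the
positions `p` with `i < p ≤ j`; `none` if there is none. -/
noncomputable def nextPt {α : Type*} (S X : List α) (i : ℕ) : Option ℕ :=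
  if X.Sublist (S.drop i) then
    some (sInf {j | i ≤ j ∧ X.Sublist ((S.take j).drop i)})
  else none

open Classical in
/-- `prev_S(X, i)`: the largest `l ≤ i` such that `X` is a subsequence of the substring of the
positions `p` with `l ≤ p < i`; `none` if there is none. -/
noncomputable def prevPt {α : Type*} (S X : List α) (i : ℕ) : Option ℕ :=
  if X.Sublist (S.take (i - 1)) then
    some (sSup {l | 1 ≤ l ∧ l ≤ i ∧ X.Sublist ((S.take (i - 1)).drop (l - 1))})
  else none

/-- The tuple `(p 1, …, p k)` of positions is a `σ`-split point for `A` and `B` in `S`. -/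
structure IsSplitPoint {α : Type*} (k : ℕ) (S : List α) (σ : α) (A B : List α)
    (p : ℕ → ℕ) : Prop where
  letter : ∀ i, 1 ≤ i → i ≤ k → 1 ≤ p i ∧ S[p i - 1]? = some σ
  next_ne_none : ∀ i, 1 ≤ i → i ≤ k → nextPt S B (p i) ≠ none
  prev_ne_none : ∀ i, 1 ≤ i → i ≤ k → prevPt S A (p i) ≠ none
  next_lt_prev : ∀ i, 1 ≤ i → i < k →
    ∀ a ∈ nextPt S B (p i), ∀ b ∈ prevPt S A (p (i + 1)), a < b

/-- The positions (in ascending order) at which `σ` occurs in `S`. -/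
def occurrences {α : Type*} [DecidableEq α] (S : List α) (σ : α) : List ℕ :=
  (List.range' 1 S.length).filter fun i => S[i - 1]? = some σ

/-- `EnumPossibleDivisions(h, d)`: all ways to write `h` as an ordered sum of `d + 1` natural
numbers, in lexicographic order. -/
def possibleDivisions : ℕ → ℕ → List (List ℕ)
  | h, 0 => [[h]]
  | h, d + 1 => (List.range (h + 1)).flatMap fun i =>
      (possibleDivisions (h - i) d).map fun sol => i :: sol

/-- `EnumPotential-σ-Starts(r, k, I)`: for every division `sol` of `|I| - k r` into `k + 1` parts,
the tuple whose `t`-th component (`1 ≤ t ≤ k`) is the entry of `I` with number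
`(t - 1) r + 1 + ∑_{i ≤ t} sol_i`, the entries of `I` being numbered from `1`. -/
def potentialStarts (r k : ℕ) (I : List ℕ) : List (ℕ → ℕ) :=
  (possibleDivisions (I.length - k * r) k).map fun sol t =>
    I.getD ((t - 1) * r + (sol.take t).sum) 0

/-- The strings `S(p_i, e_i)`, `1 ≤ i ≤ k`, where `e_i = prev_S(A, p_{i+1})` for `i < k` and
`e_k = |S| + 1`. -/
noncomputable def rightBlocks {α : Type*} (k : ℕ) (S A : List α) (p : ℕ → ℕ) :
    List (List α) :=
  (List.range' 1 k).map fun i =>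
    between S (p i) (if i = k then S.length + 1 else (prevPt S A (p (i + 1))).getD 0)

/-- The strings `S(s_i, p_i)`, `1 ≤ i ≤ k`, where `s_1 = 0` and `s_i = next_S(B, p_{i-1})`
for `i > 1`. -/
noncomputable def leftBlocks {α : Type*} (k : ℕ) (S B : List α) (p : ℕ → ℕ) :
    List (List α) :=
  (List.range' 1 k).map fun i =>
    between S (if i = 1 then 0 else (nextPt S B (p (i - 1))).getD 0) (p i)

open Classical in
/-- The body of the main loop: the current pair is `(A, B)` and the current tuple is `p`. -/
noncomputable def extendStep {α : Type*} (M : List (List α) → List α → List α) (k : ℕ)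
    (S : List α) (σ : α) (AB : List α × List α) (p : ℕ → ℕ) : List α × List α :=
  if IsSplitPoint k S σ AB.1 AB.2 p then
    let B' := M (rightBlocks k S AB.1 p) AB.2
    let A' := M (leftBlocks k S B' p) AB.1
    (A', B')
  else AB

/-- The algorithm `Extend-k-RepSubseq(S, X, σ)` with `M` as its constrained maximal common
subsequence subroutine. It starts from `X = A σ B`, split at the first occurrence of `σ`, runs
through the potential `σ`-starts and returns `A σ B` for the final `A` and `B`. -/
noncomputable def extendKRepSubseq {α : Type*} [DecidableEq α]
    (M : List (List α) → List α → List α) (k : ℕ) (S X : List α) (σ : α) : List α :=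
  let A := X.takeWhile fun a => a ≠ σ
  let B := (X.dropWhile fun a => a ≠ σ).tail
  let AB := (potentialStarts (X.count σ) k (occurrences S σ)).foldl (extendStep M k S σ) (A, B)
  AB.1 ++ σ :: AB.2

end KRep

/-! ## Word RAM programs

Structured programs for a word RAM: finitely many registers, finitely many random-access arrays,
and unit-cost operations on words, a word being a natural number below a bound `W`. -/

namespace WordRAM

/-- A memory configuration: the contents of the registers and of the arrays. -/
structure State where
  reg : ℕ → ℕ
  arr : ℕ → ℕ → ℕ

def State.setReg (s : State) (x v : ℕ) : State :=
  { s with reg := Function.update s.reg x v }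

def State.setArr (s : State) (a i v : ℕ) : State :=
  { s with arr := Function.update s.arr a (Function.update (s.arr a) i v) }

/-- The binary word operations. -/
inductive BinOp where
  | add | sub | mul | div | lt | eq

/-- Subtraction is truncated at `0`, division rounds down (`x / 0 = 0`), and comparisons
return `1` or `0`. -/
def BinOp.apply : BinOp → ℕ → ℕ → ℕ
  | add, x, y => x + y
  | sub, x, y => x - y
  | mul, x, y => x * y
  | div, x, y => x / y
  | lt, x, y => if x < y then 1 else 0
  | eq, x, y => if x = y then 1 else 0

inductive Expr where
  | lit (n : ℕ)
  | reg (x : ℕ)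
  | read (a : ℕ) (i : Expr)
  | bin (op : BinOp) (e f : Expr)

/-- The value of an expression on a machine with word bound `W`; undefined (`none`) if a literal or
the result of an operation does not fit into a word. -/
def Expr.eval (W : ℕ) (s : State) : Expr → Option ℕ
  | lit n => if n < W then some n else none
  | reg x => some (s.reg x)
  | read a i => (i.eval W s).map (s.arr a)
  | bin op e f =>
      (e.eval W s).bind fun x => (f.eval W s).bind fun y =>
        if op.apply x y < W then some (op.apply x y) else none

/-- The number of steps to evaluate an expression: one for each literal, register access, array
access and operation. -/
def Expr.cost : Expr → ℕ
  | lit _ => 1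
  | reg _ => 1
  | read _ i => i.cost + 1
  | bin _ e f => e.cost + f.cost + 1

inductive Program where
  | skip
  | assign (x : ℕ) (e : Expr)
  | write (a : ℕ) (i e : Expr)
  | seq (p q : Program)
  | cond (e : Expr) (p q : Program)
  | loop (e : Expr) (p : Program)

/-- `Exec W p s s' t`: on a machine with word bound `W`, the program `p` started in `s` halts in
`s'` after exactly `t` steps. `cond` branches on, and `loop` repeats its body as long as,
the value of `e` is nonzero. A program that overflows a word does not halt. -/
inductive Exec (W : ℕ) : Program → State → State → ℕ → Prop where
  | skip (s : State) : Exec W .skip s s 1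
  | assign {x : ℕ} {e : Expr} {s : State} {v : ℕ} (he : e.eval W s = some v) :
      Exec W (.assign x e) s (s.setReg x v) (e.cost + 1)
  | write {a : ℕ} {i e : Expr} {s : State} {j v : ℕ} (hi : i.eval W s = some j)
      (he : e.eval W s = some v) :
      Exec W (.write a i e) s (s.setArr a j v) (i.cost + e.cost + 1)
  | seq {p q : Program} {s s' s'' : State} {t t' : ℕ} (hp : Exec W p s s' t)
      (hq : Exec W q s' s'' t') : Exec W (.seq p q) s s'' (t + t')
  | cond_true {e : Expr} {p q : Program} {s s' : State} {v t : ℕ} (he : e.eval W s = some v)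
      (hv : v ≠ 0) (hp : Exec W p s s' t) : Exec W (.cond e p q) s s' (e.cost + 1 + t)
  | cond_false {e : Expr} {p q : Program} {s s' : State} {t : ℕ} (he : e.eval W s = some 0)
      (hq : Exec W q s s' t) : Exec W (.cond e p q) s s' (e.cost + 1 + t)
  | loop_true {e : Expr} {p : Program} {s s' s'' : State} {v t t' : ℕ}
      (he : e.eval W s = some v) (hv : v ≠ 0) (hp : Exec W p s s' t)
      (hl : Exec W (.loop e p) s' s'' t') : Exec W (.loop e p) s s'' (e.cost + 1 + t + t')
  | loop_false {e : Expr} {p : Program} {s : State} (he : e.eval W s = some 0) :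
      Exec W (.loop e p) s s (e.cost + 1)

/-- The initial configuration: registers `0, 1, 2, 3` hold `k`, `σ`, `|S|`, `|X|`, arrays `0` and
`1` hold the letters of `S` and of `X`, and everything else is `0`. -/
def inputState (k : ℕ) (S X : List ℕ) (σ : ℕ) : State where
  reg := fun x => if x = 0 then k else if x = 1 then σ else if x = 2 then S.length
    else if x = 3 then X.length else 0
  arr := fun a i => if a = 0 then S.getD i 0 else if a = 1 then X.getD i 0 else 0

/-- The string that a configuration holds as output: its length is in register `0`, its letters are
the initial entries of array `0`. -/
def output (s : State) : List ℕ :=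
  (List.range (s.reg 0)).map (s.arr 0)

end WordRAM

namespace KRep

variable {α : Type*}

theorem cons_sublist_iff_getElem? {c : α} {D l : List α} :
    (c :: D).Sublist l ↔ ∃ i, l[i]? = some c ∧ D.Sublist (l.drop (i + 1)) := by
  induction l with
  | nil => simp
  | cons a l ih =>
    rw [List.cons_sublist_cons', ih]
    constructor
    · rintro (⟨i, h⟩ | ⟨rfl, h⟩)
      · exact ⟨i + 1, by simpa using h⟩
      · exact ⟨0, by simpa using h⟩
    · rintro ⟨i, h1, h2⟩
      cases i with
      | zero => right; simp at h1 h2; exact ⟨h1.symm, h2⟩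
      | succ i => left; exact ⟨i, by simpa using h1, by simpa using h2⟩

theorem append_singleton_sublist_iff_getElem? {c : α} {D l : List α} :
    (D ++ [c]).Sublist l ↔ ∃ i, l[i]? = some c ∧ D.Sublist (l.take i) := by
  constructor
  · intro h
    obtain ⟨l₁, l₂, rfl, h1, h2⟩ := List.append_sublist_iff.1 h
    obtain ⟨i, hi, -⟩ := cons_sublist_iff_getElem?.1 h2
    refine ⟨l₁.length + i, ?_, ?_⟩
    · rw [List.getElem?_append_right (by omega)]; simpa using hi
    · rw [List.take_append]
      refine h1.trans ?_
      rw [List.take_of_length_le (by omega)]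
      exact List.sublist_append_left _ _
  · rintro ⟨i, h1, h2⟩
    obtain ⟨hi, rfl⟩ := List.getElem?_eq_some_iff.1 h1
    have : l.take i ++ [l[i]] = l.take (i + 1) := by simp
    exact ((h2.append_right _).trans (by rw [this])).trans (List.take_sublist _ _)

theorem between_mono {S : List α} {a b a' b' : ℕ} (ha : a' ≤ a) (hb : b ≤ b') :
    (between S a b).Sublist (between S a' b') := by
  unfold between
  exact ((List.take_sublist_take_left (by omega)).drop a).trans (List.drop_sublist_drop_left _ ha)

theorem between_eq_append {S : List α} {a m b : ℕ} (ha : a ≤ m) (hb : m < b) :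
    between S a b = between S a (m + 1) ++ between S m b := by
  unfold between
  have h : S.take m = (S.take (b - 1)).take m := by
    rw [List.take_take]; congr 1; omega
  generalize S.take (b - 1) = T at h
  simp only [Nat.add_sub_cancel, h]
  conv_lhs => rw [← List.take_append_drop m T]
  rw [List.drop_append]
  by_cases hm : m ≤ T.length
  · have : a - (List.take m T).length = 0 := by simp; omega
    rw [this]; simp
  · rw [List.drop_eq_nil_of_le (as := T) (i := m) (by omega)]; simp

theorem between_zero_length {S : List α} : between S 0 (S.length + 1) = S := by
  simp [between]

theorem between_length_eq_drop {S : List α} {a : ℕ} : between S a (S.length + 1) = S.drop a := by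
  simp [between]

theorem getElem?_between {S : List α} {a b i : ℕ} :
    (between S a b)[i]? = if a + i + 1 < b then S[a + i]? else none := by
  unfold between
  rw [List.getElem?_drop, List.getElem?_take]
  by_cases h : a + i + 1 < b
  · rw [if_pos h, if_pos (by omega)]
  · rw [if_neg h, if_neg (by omega)]

theorem drop_between {S : List α} {a b i : ℕ} :
    (between S a b).drop i = between S (a + i) b := by
  simp [between, List.drop_drop]

theorem take_between {S : List α} {a b i : ℕ} (h : a + i < b) :
    (between S a b).take i = between S a (a + i + 1) := by
  unfold between
  rw [List.take_drop, List.take_take]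
  congr 2; omega

theorem between_eq_nil {S : List α} {a b : ℕ} (h : b ≤ a + 1) : between S a b = [] := by
  unfold between
  exact List.drop_eq_nil_of_le (by simp; omega)

theorem length_between_le {S : List α} {a b : ℕ} : (between S a b).length ≤ b - 1 - a := by
  simp [between]; omega

/-- The letter `c` stands at position `p` of `S`. -/
def At (S : List α) (p : ℕ) (c : α) : Prop := 1 ≤ p ∧ S[p - 1]? = some c

theorem At.pos {S : List α} {p : ℕ} {c : α} (h : At S p c) : 1 ≤ p := h.1

theorem At.le_length {S : List α} {p : ℕ} {c : α} (h : At S p c) : p ≤ S.length := by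
  have := (List.getElem?_eq_some_iff.1 h.2).1
  have := h.1
  omega

theorem At.unique {S : List α} {p : ℕ} {c d : α} (h : At S p c) (h' : At S p d) : c = d :=
  Option.some.inj (h.2.symm.trans h'.2)

theorem exists_at {S : List α} {p : ℕ} (h : 1 ≤ p) (h' : p ≤ S.length) : ∃ c, At S p c :=
  ⟨S[p - 1], h, List.getElem?_eq_getElem (by omega)⟩

theorem cons_sublist_between {S : List α} {a b : ℕ} {c : α} {D : List α} :
    (c :: D).Sublist (between S a b) ↔
      ∃ p, a < p ∧ p < b ∧ At S p c ∧ D.Sublist (between S p b) := by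
  rw [cons_sublist_iff_getElem?]
  simp only [getElem?_between, drop_between]
  constructor
  · rintro ⟨i, h, h'⟩
    split_ifs at h with hi
    exact ⟨a + i + 1, by omega, hi, ⟨by omega, h⟩, h'⟩
  · rintro ⟨p, h1, h2, h3, h4⟩
    refine ⟨p - 1 - a, ?_, ?_⟩
    · rw [if_pos (by omega), ← h3.2]; congr 1; omega
    · have : a + (p - 1 - a + 1) = p := by omega
      rwa [this]

theorem append_singleton_sublist_between {S : List α} {a b : ℕ} {c : α} {D : List α} :
    (D ++ [c]).Sublist (between S a b) ↔
      ∃ p, a < p ∧ p < b ∧ At S p c ∧ D.Sublist (between S a p) := by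
  rw [append_singleton_sublist_iff_getElem?]
  simp only [getElem?_between]
  constructor
  · rintro ⟨i, h, h'⟩
    split_ifs at h with hi
    refine ⟨a + i + 1, by omega, hi, ⟨by omega, h⟩, ?_⟩
    rwa [take_between (by omega)] at h'
  · rintro ⟨p, h1, h2, h3, h4⟩
    refine ⟨p - 1 - a, ?_, ?_⟩
    · rw [if_pos (by omega), ← h3.2]; congr 1; omega
    · have : a + (p - 1 - a) + 1 = p := by omega
      rwa [take_between (by omega), this]

theorem append_sublist_between {S X Y : List α} {a b : ℕ} (hab : a < b) :
    (X ++ Y).Sublist (between S a b) ↔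
      ∃ m, a ≤ m ∧ m < b ∧ X.Sublist (between S a (m + 1)) ∧ Y.Sublist (between S m b) := by
  constructor
  · intro h
    induction X using List.reverseRecOn generalizing Y with
    | nil => exact ⟨a, le_rfl, hab, by simp, h⟩
    | append_singleton X c ih =>
      rw [List.append_assoc] at h
      obtain ⟨m, h1, h2, h3, h4⟩ := ih h
      obtain ⟨p, h5, h6, h7, h8⟩ := cons_sublist_between.1 h4
      exact ⟨p, by omega, h6, append_singleton_sublist_between.2
        ⟨p, by omega, by omega, h7, h3.trans (between_mono le_rfl (by omega))⟩, h8⟩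
  · rintro ⟨m, h1, h2, h3, h4⟩
    rw [between_eq_append h1 h2]
    exact h3.append h4

theorem nextPt_eq_some_iff {S X : List α} {i j : ℕ} :
    nextPt S X i = some j ↔
      i ≤ j ∧ ∀ e, i ≤ e → (X.Sublist (between S i (e + 1)) ↔ j ≤ e) := by
  have hset : {j | i ≤ j ∧ X.Sublist ((S.take j).drop i)} =
      {j | i ≤ j ∧ X.Sublist (between S i (j + 1))} := by simp [between]
  have hdrop : ∀ e, X.Sublist (between S i e) → X.Sublist (S.drop i) := fun e h =>
    h.trans ((List.take_sublist _ _).drop i)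
  unfold nextPt
  rw [hset]
  constructor
  · intro h
    split_ifs at h with hX
    have hne : {j | i ≤ j ∧ X.Sublist (between S i (j + 1))}.Nonempty := by
      refine ⟨i + S.length, by simp, ?_⟩
      simp only [between]
      rwa [List.take_of_length_le (by omega)]
    have hmem := Nat.sInf_mem hne
    rw [Option.some.inj h] at hmem
    refine ⟨hmem.1, fun e he => ⟨fun h' => ?_, fun h' => ?_⟩⟩
    · rw [← Option.some.inj h]; exact Nat.sInf_le ⟨he, h'⟩
    · exact hmem.2.trans (between_mono le_rfl (by omega))
  · rintro ⟨h1, h2⟩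
    have hj := (h2 j h1).2 le_rfl
    rw [if_pos (hdrop _ hj)]
    congr 1
    refine IsLeast.csInf_eq ⟨⟨h1, hj⟩, ?_⟩
    rintro e ⟨h3, h4⟩
    exact (h2 e h3).1 h4

theorem prevPt_eq_some_iff {S X : List α} {i l : ℕ} (hi : 1 ≤ i) :
    prevPt S X i = some l ↔
      1 ≤ l ∧ l ≤ i ∧ ∀ a, a < i → (X.Sublist (between S a i) ↔ a < l) := by
  have hset : {l | 1 ≤ l ∧ l ≤ i ∧ X.Sublist ((S.take (i - 1)).drop (l - 1))} =
      {l | 1 ≤ l ∧ l ≤ i ∧ X.Sublist (between S (l - 1) i)} := by simp [between]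
  have htake : ∀ a, X.Sublist (between S a i) → X.Sublist (S.take (i - 1)) := fun e h =>
    h.trans (List.drop_sublist _ _)
  have hbdd : BddAbove {l | 1 ≤ l ∧ l ≤ i ∧ X.Sublist (between S (l - 1) i)} :=
    ⟨i, fun l h => h.2.1⟩
  unfold prevPt
  rw [hset]
  constructor
  · intro h
    split_ifs at h with hX
    have hne : {l | 1 ≤ l ∧ l ≤ i ∧ X.Sublist (between S (l - 1) i)}.Nonempty :=
      ⟨1, le_rfl, hi, by simpa [between] using hX⟩
    have hmem := Nat.sSup_mem hne hbdd
    rw [Option.some.inj h] at hmem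
    refine ⟨hmem.1, hmem.2.1, fun a ha => ⟨fun h' => ?_, fun h' => ?_⟩⟩
    · have := le_csSup hbdd (show a + 1 ∈ _ from ⟨by omega, by omega, by simpa using h'⟩)
      rw [Option.some.inj h] at this
      omega
    · exact hmem.2.2.trans (between_mono (by omega) le_rfl)
  · rintro ⟨h1, h2, h3⟩
    have hl := (h3 (l - 1) (by omega)).2 (by omega)
    rw [if_pos (htake _ hl)]
    congr 1
    refine IsGreatest.csSup_eq ⟨⟨h1, h2, hl⟩, ?_⟩
    rintro e ⟨h4, h5, h6⟩
    have := (h3 (e - 1) (by omega)).1 h6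
    omega

theorem exists_nextPt {S X : List α} {i e : ℕ} (h : X.Sublist (between S i e)) :
    ∃ j, nextPt S X i = some j := by
  refine Option.ne_none_iff_exists'.1 ?_
  unfold nextPt
  rw [if_pos (h.trans ((List.take_sublist _ _).drop i))]
  simp

theorem exists_prevPt {S X : List α} {a i : ℕ} (h : X.Sublist (between S a i)) :
    ∃ j, prevPt S X i = some j := by
  refine Option.ne_none_iff_exists'.1 ?_
  unfold prevPt
  rw [if_pos (h.trans (List.drop_sublist _ _))]
  simp

/-- The blocks of a split point described by cuts between consecutive positions. -/
theorem isSplitPoint_iff {k : ℕ} {S : List α} {σ : α} {A B : List α} {p : ℕ → ℕ} :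
    IsSplitPoint k S σ A B p ↔
      (∀ i, 1 ≤ i → i ≤ k → At S (p i) σ ∧ A.Sublist (between S 0 (p i)) ∧
        B.Sublist (between S (p i) (S.length + 1))) ∧
      ∀ i, 1 ≤ i → i < k → ∃ c, p i ≤ c ∧ c < p (i + 1) ∧
        B.Sublist (between S (p i) (c + 1)) ∧ A.Sublist (between S c (p (i + 1))) := by
  constructor
  · rintro ⟨h1, h2, h3, h4⟩
    constructor
    · intro i hi hk
      refine ⟨h1 i hi hk, ?_, ?_⟩
      · obtain ⟨l, hl⟩ := Option.ne_none_iff_exists'.1 (h3 i hi hk)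
        rw [prevPt_eq_some_iff (h1 i hi hk).1] at hl
        exact (hl.2.2 0 (h1 i hi hk).1).2 hl.1
      · have := h2 i hi hk
        rw [between_length_eq_drop]
        unfold nextPt at this
        by_contra hn
        exact this (if_neg hn)
    · intro i hi hk
      obtain ⟨j, hj⟩ := Option.ne_none_iff_exists'.1 (h2 i hi hk.le)
      obtain ⟨l, hl⟩ := Option.ne_none_iff_exists'.1 (h3 (i + 1) (by omega) hk)
      have hlt := h4 i hi hk j hj l hl
      rw [prevPt_eq_some_iff (h1 (i + 1) (by omega) hk).1] at hl
      rw [nextPt_eq_some_iff] at hj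
      exact ⟨j, hj.1, by omega, (hj.2 j hj.1).2 le_rfl, (hl.2.2 j (by omega)).2 hlt⟩
  · rintro ⟨h1, h2⟩
    refine ⟨fun i hi hk => (h1 i hi hk).1, fun i hi hk => ?_, fun i hi hk => ?_,
      fun i hi hk a ha b hb => ?_⟩
    · obtain ⟨j, hj⟩ := exists_nextPt (h1 i hi hk).2.2
      simp [hj]
    · obtain ⟨j, hj⟩ := exists_prevPt (h1 i hi hk).2.1
      simp [hj]
    · obtain ⟨c, h3, h4, h5, h6⟩ := h2 i hi hk
      have ha' := (nextPt_eq_some_iff.1 ha).2 c h3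
      have hb' := ((prevPt_eq_some_iff (h1 (i + 1) (by omega) hk).1.1).1 hb).2.2 c h4
      have := ha'.1 h5
      have := hb'.1 h6
      omega

theorem IsSplitPoint.anti {k : ℕ} {S : List α} {σ : α} {A B A' B' : List α} {p : ℕ → ℕ}
    (h : IsSplitPoint k S σ A B p) (hA : A'.Sublist A) (hB : B'.Sublist B) :
    IsSplitPoint k S σ A' B' p := by
  rw [isSplitPoint_iff] at h ⊢
  refine ⟨fun i hi hk => ?_, fun i hi hk => ?_⟩
  · obtain ⟨h1, h2, h3⟩ := h.1 i hi hk
    exact ⟨h1, hA.trans h2, hB.trans h3⟩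
  · obtain ⟨c, h1, h2, h3, h4⟩ := h.2 i hi hk
    exact ⟨c, h1, h2, hB.trans h3, hA.trans h4⟩

theorem IsSplitPoint.congr {k : ℕ} {S : List α} {σ : α} {A B : List α} {p q : ℕ → ℕ}
    (h : IsSplitPoint k S σ A B p) (hpq : ∀ i, 1 ≤ i → i ≤ k → p i = q i) :
    IsSplitPoint k S σ A B q := by
  rw [isSplitPoint_iff] at h ⊢
  refine ⟨fun i hi hk => ?_, fun i hi hk => ?_⟩
  · rw [← hpq i hi hk]; exact h.1 i hi hk
  · rw [← hpq i hi hk.le, ← hpq (i + 1) (by omega) hk]; exact h.2 i hi hk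

/-- The right end of the `i`-th right block. -/
noncomputable def rightEnd (k : ℕ) (S A : List α) (p : ℕ → ℕ) (i : ℕ) : ℕ :=
  if i = k then S.length + 1 else (prevPt S A (p (i + 1))).getD 0

/-- The left end of the `i`-th left block. -/
noncomputable def leftEnd (S B : List α) (p : ℕ → ℕ) (i : ℕ) : ℕ :=
  if i = 1 then 0 else (nextPt S B (p (i - 1))).getD 0

theorem mem_rightBlocks {k : ℕ} {S A : List α} {p : ℕ → ℕ} {T : List α} :
    T ∈ rightBlocks k S A p ↔
      ∃ i, 1 ≤ i ∧ i ≤ k ∧ between S (p i) (rightEnd k S A p i) = T := by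
  simp only [rightBlocks, List.mem_map, List.mem_range'_1, rightEnd]
  constructor
  · rintro ⟨i, h, rfl⟩; exact ⟨i, h.1, by omega, rfl⟩
  · rintro ⟨i, h, h', rfl⟩; exact ⟨i, ⟨h, by omega⟩, rfl⟩

theorem mem_leftBlocks {k : ℕ} {S B : List α} {p : ℕ → ℕ} {T : List α} :
    T ∈ leftBlocks k S B p ↔ ∃ i, 1 ≤ i ∧ i ≤ k ∧ between S (leftEnd S B p i) (p i) = T := by
  simp only [leftBlocks, List.mem_map, List.mem_range'_1, leftEnd]
  constructor
  · rintro ⟨i, h, rfl⟩; exact ⟨i, h.1, by omega, rfl⟩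
  · rintro ⟨i, h, h', rfl⟩; exact ⟨i, ⟨h, by omega⟩, rfl⟩

theorem IsSplitPoint.sublist_rightBlocks {k : ℕ} {S : List α} {σ : α} {A B A' : List α}
    {p : ℕ → ℕ} (h : IsSplitPoint k S σ A B p) (hA : A'.Sublist A) :
    ∀ T ∈ rightBlocks k S A' p, B.Sublist T := by
  rw [isSplitPoint_iff] at h
  intro T hT
  obtain ⟨i, hi, hk, rfl⟩ := mem_rightBlocks.1 hT
  unfold rightEnd
  split_ifs with hik
  · exact (h.1 i hi hk).2.2
  · obtain ⟨c, h1, h2, h3, h4⟩ := h.2 i hi (by omega)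
    obtain ⟨l, hl⟩ := exists_prevPt (hA.trans h4)
    rw [hl]
    have := (((prevPt_eq_some_iff (by omega)).1 hl).2.2 c h2).1 (hA.trans h4)
    exact h3.trans (between_mono le_rfl (by simpa using this))

theorem IsSplitPoint.sublist_leftBlocks {k : ℕ} {S : List α} {σ : α} {A B B' : List α}
    {p : ℕ → ℕ} (h : IsSplitPoint k S σ A B p) (hB : B'.Sublist B) :
    ∀ T ∈ leftBlocks k S B' p, A.Sublist T := by
  rw [isSplitPoint_iff] at h
  intro T hT
  obtain ⟨i, hi, hk, rfl⟩ := mem_leftBlocks.1 hT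
  unfold leftEnd
  split_ifs with hik
  · exact (h.1 i hi hk).2.1
  · obtain ⟨c, h1, h2, h3, h4⟩ := h.2 (i - 1) (by omega) (by omega)
    obtain ⟨l, hl⟩ := exists_nextPt (hB.trans h3)
    rw [hl]
    have := ((nextPt_eq_some_iff.1 hl).2 c h1).1 (hB.trans h3)
    have e : i - 1 + 1 = i := by omega
    rw [e] at h4
    exact h4.trans (between_mono (by simpa using this) le_rfl)

theorem IsSplitPoint.of_rightBlocks {k : ℕ} {S : List α} {σ : α} {A B B' : List α}
    {p : ℕ → ℕ} (h : IsSplitPoint k S σ A B p)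
    (hB : ∀ T ∈ rightBlocks k S A p, B'.Sublist T) : IsSplitPoint k S σ A B' p := by
  have hs := h
  rw [isSplitPoint_iff] at h ⊢
  have hB' : ∀ i, 1 ≤ i → i ≤ k → B'.Sublist (between S (p i) (rightEnd k S A p i)) :=
    fun i hi hk => hB _ (mem_rightBlocks.2 ⟨i, hi, hk, rfl⟩)
  refine ⟨fun i hi hk => ⟨(h.1 i hi hk).1, (h.1 i hi hk).2.1, ?_⟩, fun i hi hk => ?_⟩
  · refine (hB' i hi hk).trans ?_
    rw [between_length_eq_drop]
    exact (List.take_sublist _ _).drop _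
  · obtain ⟨c, h1, h2, h3, h4⟩ := h.2 i hi hk
    have h5 := hB' i hi hk.le
    obtain ⟨l, hl⟩ := exists_prevPt h4
    simp only [rightEnd, hk.ne, if_false, hl, Option.getD_some] at h5
    have hl' := (prevPt_eq_some_iff (by omega)).1 hl
    have := (hl'.2.2 c h2).1 h4
    refine ⟨l - 1, by omega, by omega, ?_, (hl'.2.2 (l - 1) (by omega)).2 (by omega)⟩
    have e : l - 1 + 1 = l := by omega
    rwa [e]

theorem IsSplitPoint.of_leftBlocks {k : ℕ} {S : List α} {σ : α} {A B A' : List α}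
    {p : ℕ → ℕ} (h : IsSplitPoint k S σ A B p)
    (hA : ∀ T ∈ leftBlocks k S B p, A'.Sublist T) : IsSplitPoint k S σ A' B p := by
  rw [isSplitPoint_iff] at h ⊢
  have hA' : ∀ i, 1 ≤ i → i ≤ k → A'.Sublist (between S (leftEnd S B p i) (p i)) :=
    fun i hi hk => hA _ (mem_leftBlocks.2 ⟨i, hi, hk, rfl⟩)
  refine ⟨fun i hi hk => ⟨(h.1 i hi hk).1, ?_, (h.1 i hi hk).2.2⟩, fun i hi hk => ?_⟩
  · exact (hA' i hi hk).trans (between_mono (by omega) le_rfl)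
  · obtain ⟨c, h1, h2, h3, h4⟩ := h.2 i hi hk
    have h5 := hA' (i + 1) (by omega) hk
    obtain ⟨l, hl⟩ := exists_nextPt h3
    have hi0 : i ≠ 0 := by omega
    simp only [leftEnd, Nat.add_eq_right, hi0, if_false, Nat.add_sub_cancel, hl,
      Option.getD_some] at h5
    have hl' := nextPt_eq_some_iff.1 hl
    have := (hl'.2 c h1).1 h3
    exact ⟨l, hl'.1, by omega, (hl'.2 l hl'.1).2 le_rfl, h5⟩

theorem exists_cuts {S Z : List α} {k a b : ℕ} (hab : a < b)
    (h : (List.replicate k Z).flatten.Sublist (between S a b)) :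
    ∃ c : ℕ → ℕ, c 0 = a ∧ ∀ i < k, c i ≤ c (i + 1) ∧ c (i + 1) < b ∧
      Z.Sublist (between S (c i) (c (i + 1) + 1)) := by
  induction k generalizing a with
  | zero => exact ⟨fun _ => a, rfl, by simp⟩
  | succ k ih =>
    rw [List.replicate_succ, List.flatten_cons, append_sublist_between hab] at h
    obtain ⟨m, h1, h2, h3, h4⟩ := h
    obtain ⟨c, hc0, hc⟩ := ih h2 h4
    refine ⟨fun i => if i = 0 then a else c (i - 1), rfl, ?_⟩
    rintro (_ | i) hi
    · simpa [hc0] using ⟨h1, h2, h3⟩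
    · simpa using hc i (by omega)

theorem sublist_of_cuts {S Z : List α} {k b : ℕ} {c : ℕ → ℕ}
    (h : ∀ i < k, c i ≤ c (i + 1) ∧ c (i + 1) < b ∧
      Z.Sublist (between S (c i) (c (i + 1) + 1))) :
    (List.replicate k Z).flatten.Sublist (between S (c 0) b) := by
  induction k generalizing c with
  | zero => simp
  | succ k ih =>
    rw [List.replicate_succ, List.flatten_cons]
    obtain ⟨h1, h2, h3⟩ := h 0 (by omega)
    rw [append_sublist_between (by omega)]
    exact ⟨c 1, h1, h2, h3, ih (c := fun i => c (i + 1)) fun i hi => h (i + 1) (by omega)⟩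

theorem isKRep_iff_exists_isSplitPoint {k : ℕ} {S : List α} {σ : α}
    {A B : List α} :
    IsKRep k S (A ++ σ :: B) ↔ ∃ p, IsSplitPoint k S σ A B p := by
  unfold IsKRep
  constructor
  · intro h
    rw [← between_zero_length (S := S)] at h
    obtain ⟨c, -, hc⟩ := exists_cuts (by omega) h
    have hp : ∀ i, ∃ q, i < k → c i < q ∧ q ≤ c (i + 1) ∧ At S q σ ∧
        A.Sublist (between S (c i) q) ∧ B.Sublist (between S q (c (i + 1) + 1)) := by
      intro i
      by_cases hi : i < k
      · obtain ⟨h1, h2, h3⟩ := hc i hi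
        rw [append_sublist_between (by omega)] at h3
        obtain ⟨m, h4, h5, h6, h7⟩ := h3
        obtain ⟨q, h8, h9, h10, h11⟩ := cons_sublist_between.1 h7
        exact ⟨q, fun _ => ⟨by omega, by omega, h10,
          h6.trans (between_mono le_rfl (by omega)), h11⟩⟩
      · exact ⟨0, fun h => absurd h hi⟩
    choose q hq using hp
    refine ⟨fun i => q (i - 1), isSplitPoint_iff.2 ⟨fun i hi hik => ?_, fun i hi hik => ?_⟩⟩
    · obtain ⟨h1, h2, h3, h4, h5⟩ := hq (i - 1) (by omega)
      have := hc (i - 1) (by omega)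
      exact ⟨h3, h4.trans (between_mono (by omega) le_rfl),
        h5.trans (between_mono le_rfl (by omega))⟩
    · have e : i - 1 + 1 = i := by omega
      obtain ⟨h1, h2, h3, h4, h5⟩ := hq (i - 1) (by omega)
      obtain ⟨h1', h2', h3', h4', h5'⟩ := hq i hik
      rw [e] at h2 h5
      exact ⟨c i, h2, by simpa using h1', h5, by simpa using h4'⟩
  · rintro ⟨p, hp⟩
    rw [isSplitPoint_iff] at hp
    obtain ⟨h1, h2⟩ := hp
    have hc : ∀ i, ∃ c, 1 ≤ i → i < k → p i ≤ c ∧ c < p (i + 1) ∧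
        B.Sublist (between S (p i) (c + 1)) ∧ A.Sublist (between S c (p (i + 1))) := by
      intro i
      by_cases h : 1 ≤ i ∧ i < k
      · obtain ⟨c, hc⟩ := h2 i h.1 h.2
        exact ⟨c, fun _ _ => hc⟩
      · exact ⟨0, fun h3 h4 => absurd ⟨h3, h4⟩ h⟩
    choose c hc using hc
    have hA : ∀ i < k, (if i = 0 then 0 else c i) < p (i + 1) ∧
        A.Sublist (between S (if i = 0 then 0 else c i) (p (i + 1))) := by
      intro i hi
      obtain ⟨h3, h4, -⟩ := h1 (i + 1) (by omega) hi
      split_ifs with h0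
      · exact ⟨h3.1, h4⟩
      · obtain ⟨-, h6, -, h7⟩ := hc i (by omega) hi
        exact ⟨h6, h7⟩
    have hB : ∀ i < k, p (i + 1) ≤ (if i + 1 < k then c (i + 1) else S.length) ∧
        (if i + 1 < k then c (i + 1) else S.length) ≤ S.length ∧
        B.Sublist (between S (p (i + 1)) ((if i + 1 < k then c (i + 1) else S.length) + 1)) := by
      intro i hi
      obtain ⟨h3, -, h4⟩ := h1 (i + 1) (by omega) hi
      split_ifs with h0
      · obtain ⟨h5, h6, h7, -⟩ := hc (i + 1) (by omega) h0
        have := (h1 (i + 1 + 1) (by omega) (by omega)).1.le_length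
        exact ⟨h5, by omega, h7⟩
      · exact ⟨h3.le_length, le_rfl, h4⟩
    have := sublist_of_cuts (S := S) (Z := A ++ σ :: B) (k := k) (b := S.length + 1)
      (c := fun i => if i = 0 then 0 else if i < k then c i else S.length) ?_
    · simpa [between_zero_length] using this
    · intro i hi
      obtain ⟨h3, h4⟩ := hA i hi
      obtain ⟨h5, h6, h7⟩ := hB i hi
      obtain ⟨h8, -, -⟩ := h1 (i + 1) (by omega) hi
      simp only [hi, if_true, Nat.succ_ne_zero, if_false]
      generalize (if i = 0 then 0 else c i) = x at *
      generalize (if i + 1 < k then c (i + 1) else S.length) = y at *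
      refine ⟨by omega, by omega, (append_sublist_between (by omega)).2
        ⟨p (i + 1) - 1, by omega, by omega, ?_, cons_sublist_between.2
        ⟨p (i + 1), by omega, by omega, h8, h7⟩⟩⟩
      rwa [Nat.sub_add_cancel h8.1]

end KRep

namespace KRep

variable {α : Type*}

section Occurrences
variable [DecidableEq α]

theorem mem_occurrences {S : List α} {σ : α} {p : ℕ} : p ∈ occurrences S σ ↔ At S p σ := by
  simp only [occurrences, List.mem_filter, List.mem_range'_1, decide_eq_true_eq]
  constructor
  · rintro ⟨⟨h1, -⟩, h2⟩; exact ⟨h1, h2⟩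
  · intro h; exact ⟨⟨h.1, by have := h.le_length; omega⟩, h.2⟩

theorem occurrences_append_singleton {S : List α} {σ a : α} :
    occurrences (S ++ [a]) σ = occurrences S σ ++ if a = σ then [S.length + 1] else [] := by
  unfold occurrences
  rw [List.length_append, List.length_singleton, List.range'_concat, List.filter_append]
  congr 1
  · refine List.filter_congr fun i hi => ?_
    rw [List.mem_range'_1] at hi
    rw [List.getElem?_append_left (by omega)]
  · simp [List.filter_singleton, Nat.add_comm 1]

theorem length_occurrences {S : List α} {σ : α} : (occurrences S σ).length = S.count σ := by
  induction S using List.reverseRecOn with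
  | nil => simp [occurrences]
  | append_singleton S a ih =>
    rw [occurrences_append_singleton, List.length_append, ih, List.count_append,
      List.count_singleton]
    by_cases h : a = σ <;> simp [h]

theorem getElem?_occurrences {S : List α} {σ : α} {p : ℕ} (h : At S p σ) :
    (occurrences S σ)[(S.take (p - 1)).count σ]? = some p := by
  induction S using List.reverseRecOn with
  | nil => have := h.le_length; have := h.1; simp at *; omega
  | append_singleton S a ih =>
    rw [occurrences_append_singleton]
    have h1 := h.1
    have h2 := h.le_length
    rw [List.length_append, List.length_singleton] at h2
    rcases Nat.lt_or_ge S.length p with h3 | h3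
    · obtain rfl : p = S.length + 1 := by omega
      have ha : a = σ := by simpa using h.2
      rw [if_pos ha, Nat.add_sub_cancel, List.take_left, ← length_occurrences,
        List.getElem?_append_right le_rfl]
      simp
    · have h4 : At S p σ := ⟨h1, by
        have := h.2; rwa [List.getElem?_append_left (by omega)] at this⟩
      rw [List.take_append_of_le_length (by omega)]
      have h5 := ih h4
      rw [List.getElem?_append_left (List.getElem?_eq_some_iff.1 h5).1, h5]

theorem count_take_add_count_le {S Z : List α} {a b : ℕ} {σ : α} (hab : a < b)
    (h : Z.Sublist (between S a b)) :
    (S.take a).count σ + Z.count σ ≤ (S.take (b - 1)).count σ := by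
  have h1 : S.take (b - 1) = S.take a ++ between S a b := by
    unfold between
    have : S.take a = (S.take (b - 1)).take a := by rw [List.take_take]; congr 1; omega
    rw [this, List.take_append_drop]
  rw [h1, List.count_append]
  exact Nat.add_le_add_left (h.count_le σ) _

theorem At.count_take {S : List α} {p : ℕ} {σ : α} (h : At S p σ) :
    (S.take p).count σ = (S.take (p - 1)).count σ + 1 := by
  obtain ⟨h1, h2⟩ := h
  obtain ⟨q, rfl⟩ : ∃ q, p = q + 1 := ⟨p - 1, by omega⟩
  rw [List.take_add_one, List.count_append]
  simp at h2
  simp [h2]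

end Occurrences

/-- A tuple of weakly increasing numbers at most `h` is the tuple of partial sums of a division. -/
theorem exists_mem_possibleDivisions {h d : ℕ} {s : ℕ → ℕ}
    (hs : ∀ t, 1 ≤ t → t < d → s t ≤ s (t + 1)) (hd : ∀ t, 1 ≤ t → t ≤ d → s t ≤ h) :
    ∃ sol ∈ possibleDivisions h d, ∀ t, 1 ≤ t → t ≤ d → (sol.take t).sum = s t := by
  induction d generalizing h s with
  | zero => exact ⟨[h], by simp [possibleDivisions], fun t h1 h2 => by omega⟩
  | succ d ih =>
    have hmono : ∀ t, 1 ≤ t → t ≤ d + 1 → s 1 ≤ s t := by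
      intro t h1
      induction t, h1 using Nat.le_induction with
      | base => simp
      | succ t h1 iht =>
        intro h2
        exact (iht (by omega)).trans (hs t h1 (by omega))
    obtain ⟨sol, hsol, hsum⟩ := ih (h := h - s 1) (s := fun t => s (t + 1) - s 1)
      (fun t h1 h2 => Nat.sub_le_sub_right (hs (t + 1) (by omega) (by omega)) _)
      (fun t h1 h2 => Nat.sub_le_sub_right (hd (t + 1) (by omega) (by omega)) _)
    refine ⟨s 1 :: sol, ?_, ?_⟩
    · rw [possibleDivisions, List.mem_flatMap]
      exact ⟨s 1, List.mem_range.2 (by have := hd 1 le_rfl (by omega); omega),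
        List.mem_map_of_mem hsol⟩
    · rintro (_ | t) h1 h2
      · omega
      · rw [List.take_succ_cons, List.sum_cons]
        rcases Nat.eq_zero_or_pos t with rfl | ht
        · simp
        · rw [hsum t ht (by omega)]
          have := hmono (t + 1) (by omega) h2
          omega

theorem IsSplitPoint.exists_mem_potentialStarts [DecidableEq α] {k : ℕ} {S : List α} {σ : α}
    {A B : List α} {p : ℕ → ℕ} (h : IsSplitPoint k S σ A B p) {r : ℕ}
    (hr : r ≤ A.count σ + B.count σ + 1) (hr' : r ≤ B.count σ + 1) :
    ∃ q ∈ potentialStarts r k (occurrences S σ), ∀ i, 1 ≤ i → i ≤ k → q i = p i := by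
  rw [isSplitPoint_iff] at h
  obtain ⟨h1, h2⟩ := h
  have hlast : ∀ t, 1 ≤ t → t ≤ k → (S.take (p t - 1)).count σ + r ≤ S.count σ := by
    intro t ht htk
    obtain ⟨h3, h4, h5⟩ := h1 t ht htk
    have := count_take_add_count_le (σ := σ) (by have := h3.le_length; omega) h5
    rw [h3.count_take, Nat.add_sub_cancel, List.take_length] at this
    omega
  have hstep : ∀ t, 1 ≤ t → t < k →
      (S.take (p t - 1)).count σ + r ≤ (S.take (p (t + 1) - 1)).count σ := by
    intro t ht htk
    obtain ⟨h3, -, -⟩ := h1 t ht htk.le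
    obtain ⟨c, h6, h7, h8, h9⟩ := h2 t ht htk
    have e1 := count_take_add_count_le (σ := σ) (by omega) h8
    have e2 := count_take_add_count_le (σ := σ) (by omega) h9
    rw [Nat.add_sub_cancel, h3.count_take] at e1
    omega
  have hlow : ∀ t, 1 ≤ t → t ≤ k → (t - 1) * r ≤ (S.take (p t - 1)).count σ := by
    intro t ht
    induction t, ht using Nat.le_induction with
    | base => simp
    | succ t ht ih =>
      intro htk
      have h3 := ih (by omega)
      have h4 := hstep t ht htk
      have e : (t + 1 - 1) * r = (t - 1) * r + r := by
        obtain ⟨u, rfl⟩ : ∃ u, t = u + 1 := ⟨t - 1, by omega⟩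
        simp [Nat.add_mul]
      omega
  have hhigh : ∀ j t, 1 ≤ t → t + j = k →
      (S.take (p t - 1)).count σ + (j + 1) * r ≤ S.count σ := by
    intro j
    induction j with
    | zero => intro t ht htk; simpa using hlast t ht (by omega)
    | succ j ih =>
      intro t ht htk
      have h3 := ih (t + 1) (by omega) (by omega)
      have h4 := hstep t ht (by omega)
      have e : (j + 1 + 1) * r = (j + 1) * r + r := by ring
      omega
  have hs : ∀ t, 1 ≤ t → t < k → (S.take (p t - 1)).count σ - (t - 1) * r ≤
      (S.take (p (t + 1) - 1)).count σ - (t + 1 - 1) * r := by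
    intro t ht htk
    have h4 := hstep t ht htk
    have e : (t + 1 - 1) * r = (t - 1) * r + r := by
      obtain ⟨u, rfl⟩ : ∃ u, t = u + 1 := ⟨t - 1, by omega⟩
      simp [Nat.add_mul]
    omega
  have hd : ∀ t, 1 ≤ t → t ≤ k → (S.take (p t - 1)).count σ - (t - 1) * r ≤
      (occurrences S σ).length - k * r := by
    intro t ht htk
    have h3 := hhigh (k - t) t ht (by omega)
    have e : k * r = (k - t + 1) * r + (t - 1) * r := by
      rw [← Nat.add_mul]; congr 1; omega
    simp only [length_occurrences]
    omega
  obtain ⟨sol, hsol, hsum⟩ := exists_mem_possibleDivisions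
    (s := fun t => (S.take (p t - 1)).count σ - (t - 1) * r) hs hd
  refine ⟨_, List.mem_map_of_mem hsol, fun i hi hik => ?_⟩
  rw [hsum i hi hik]
  have h3 := hlow i hi hik
  simp only [Nat.add_sub_cancel' h3, List.getD_eq_getElem?_getD,
    getElem?_occurrences (h1 i hi hik).1, Option.getD_some]

section Fold

variable {M : List (List α) → List α → List α} {k : ℕ} {S : List α} {σ : α}

theorem extendStep_of_not {AB : List α × List α} {p : ℕ → ℕ}
    (h : ¬ IsSplitPoint k S σ AB.1 AB.2 p) : extendStep M k S σ AB p = AB := if_neg h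

theorem extendStep_of_isSplitPoint {AB : List α × List α} {p : ℕ → ℕ}
    (h : IsSplitPoint k S σ AB.1 AB.2 p) :
    extendStep M k S σ AB p =
      (M (leftBlocks k S (M (rightBlocks k S AB.1 p) AB.2) p) AB.1,
        M (rightBlocks k S AB.1 p) AB.2) := if_pos h

theorem rightBlocks_ne_nil (hk : 0 < k) {A : List α} {p : ℕ → ℕ} : rightBlocks k S A p ≠ [] := by
  simp [rightBlocks]; omega

theorem leftBlocks_ne_nil (hk : 0 < k) {B : List α} {p : ℕ → ℕ} : leftBlocks k S B p ≠ [] := by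
  simp [leftBlocks]; omega

variable (hM : IsMCSProcedure M) (hk : 0 < k)
include hM hk

theorem extendStep_spec (AB : List α × List α) (p : ℕ → ℕ) :
    AB.1.Sublist (extendStep M k S σ AB p).1 ∧ AB.2.Sublist (extendStep M k S σ AB p).2 ∧
    (IsKRep k S (AB.1 ++ σ :: AB.2) →
      IsKRep k S ((extendStep M k S σ AB p).1 ++ σ :: (extendStep M k S σ AB p).2)) ∧
    ∀ A' B' : List α, IsSplitPoint k S σ A' B' p →
      (extendStep M k S σ AB p).1.Sublist A' → (extendStep M k S σ AB p).2.Sublist B' →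
      A' = (extendStep M k S σ AB p).1 ∧ B' = (extendStep M k S σ AB p).2 := by
  by_cases h : IsSplitPoint k S σ AB.1 AB.2 p
  · rw [extendStep_of_isSplitPoint h]
    obtain ⟨hB, hBsub⟩ := hM _ AB.2 (rightBlocks_ne_nil hk)
      (h.sublist_rightBlocks (List.Sublist.refl _))
    set B₁ := M (rightBlocks k S AB.1 p) AB.2 with hB₁
    have h₁ := h.of_rightBlocks hB.1
    obtain ⟨hA, hAsub⟩ := hM _ AB.1 (leftBlocks_ne_nil hk)
      (h₁.sublist_leftBlocks (List.Sublist.refl _))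
    set A₁ := M (leftBlocks k S B₁ p) AB.1 with hA₁
    refine ⟨hAsub, hBsub, fun _ => isKRep_iff_exists_isSplitPoint.2
      ⟨p, h₁.of_leftBlocks hA.1⟩, fun A' B' h' hA' hB' => ?_⟩
    exact ⟨hA.2 A' (h'.sublist_leftBlocks hB') hA',
      hB.2 B' (h'.sublist_rightBlocks (hAsub.trans hA')) hB'⟩
  · rw [extendStep_of_not h]
    exact ⟨List.Sublist.refl _, List.Sublist.refl _, id, fun A' B' h' hA' hB' =>
      absurd (h'.anti hA' hB') h⟩

theorem foldl_extendStep_spec (l : List (ℕ → ℕ)) (AB : List α × List α) :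
    AB.1.Sublist (l.foldl (extendStep M k S σ) AB).1 ∧
    AB.2.Sublist (l.foldl (extendStep M k S σ) AB).2 ∧
    (IsKRep k S (AB.1 ++ σ :: AB.2) → IsKRep k S
      ((l.foldl (extendStep M k S σ) AB).1 ++ σ :: (l.foldl (extendStep M k S σ) AB).2)) ∧
    ∀ p ∈ l, ∀ A' B' : List α, IsSplitPoint k S σ A' B' p →
      (l.foldl (extendStep M k S σ) AB).1.Sublist A' →
      (l.foldl (extendStep M k S σ) AB).2.Sublist B' →
      A' = (l.foldl (extendStep M k S σ) AB).1 ∧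
      B' = (l.foldl (extendStep M k S σ) AB).2 := by
  induction l generalizing AB with
  | nil => exact ⟨List.Sublist.refl _, List.Sublist.refl _, id, by simp⟩
  | cons q l ih =>
    rw [List.foldl_cons]
    obtain ⟨h1, h2, h3, h4⟩ := extendStep_spec (S := S) (σ := σ) hM hk AB q
    obtain ⟨h5, h6, h7, h8⟩ := ih (extendStep M k S σ AB q)
    refine ⟨h1.trans h5, h2.trans h6, h7 ∘ h3, fun p hp A' B' h hA hB => ?_⟩
    rcases List.mem_cons.1 hp with rfl | hp
    · obtain ⟨rfl, rfl⟩ := h4 A' B' h (h5.trans hA) (h6.trans hB)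
      exact ⟨h5.antisymm hA, h6.antisymm hB⟩
    · exact h8 p hp A' B' h hA hB

omit hM hk in
theorem split_at_first [DecidableEq α] {X : List α} (h : σ ∈ X) :
    (X.takeWhile fun a => a ≠ σ) ++ σ :: (X.dropWhile fun a => a ≠ σ).tail = X ∧
      σ ∉ X.takeWhile fun a => a ≠ σ := by
  constructor
  · conv_rhs => rw [← List.takeWhile_append_dropWhile (p := fun a => decide (a ≠ σ)) (l := X)]
    congr 1
    have hne : X.dropWhile (fun a => decide (a ≠ σ)) ≠ [] := by
      rw [Ne, List.dropWhile_eq_nil_iff]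
      intro h'
      simpa using h' σ h
    have hhead := List.head_dropWhile_not (fun a => decide (a ≠ σ)) hne
    simp only [ne_eq, decide_not, Bool.not_eq_eq_eq_not, Bool.not_false,
      decide_eq_true_eq] at hhead
    conv_rhs => rw [← List.cons_head_tail hne]
    congr 1
    simpa using hhead.symm
  · intro h'
    simpa using List.mem_takeWhile_imp h'

theorem extendKRepSubseq_isMaxKRep [DecidableEq α] {X : List α} (hX : IsKRep k S X)
    (hσ : σ ∈ X) :
    IsMaxKRep k S (extendKRepSubseq M k S X σ) ∧ X.Sublist (extendKRepSubseq M k S X σ) := by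
  obtain ⟨hsplit, hnot⟩ := split_at_first hσ
  unfold extendKRepSubseq
  set A := X.takeWhile fun a => decide (a ≠ σ)
  set B := (X.dropWhile fun a => decide (a ≠ σ)).tail
  obtain ⟨h1, h2, h3, h4⟩ := foldl_extendStep_spec (S := S) (σ := σ) hM hk
    (potentialStarts (X.count σ) k (occurrences S σ)) (A, B)
  simp only at h1 h2 h3 h4
  set AB := (potentialStarts (X.count σ) k (occurrences S σ)).foldl (extendStep M k S σ) (A, B)
  have hsub : X.Sublist (AB.1 ++ σ :: AB.2) := by
    rw [← hsplit]
    exact h1.append (h2.cons_cons σ)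
  have hc : X.count σ = B.count σ + 1 := by
    rw [← hsplit, List.count_append, List.count_eq_zero_of_not_mem hnot, List.count_cons_self]
    omega
  refine ⟨⟨h3 (by rwa [hsplit]), fun Y hY hne hrep => hne ?_⟩, hsub⟩
  obtain ⟨A', Y₂, rfl, hA', hY₂⟩ := List.append_sublist_iff.1 hY
  obtain ⟨C, D, rfl, hC, hD⟩ := List.cons_sublist_iff.1 hY₂
  obtain ⟨C, C', rfl⟩ := List.append_of_mem hC
  have e : A' ++ (C ++ σ :: C' ++ D) = (A' ++ C) ++ σ :: (C' ++ D) := by simp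
  rw [e] at hrep ⊢
  obtain ⟨p, hp⟩ := isKRep_iff_exists_isSplitPoint.1 hrep
  have hA'' : AB.1.Sublist (A' ++ C) := hA'.trans (List.sublist_append_left _ _)
  have hB'' : AB.2.Sublist (C' ++ D) := hD.trans (List.sublist_append_right _ _)
  have hcount := (h2.trans hB'').count_le σ
  obtain ⟨q, hq, hqp⟩ := hp.exists_mem_potentialStarts (r := X.count σ) (by omega) (by omega)
  obtain ⟨e1, e2⟩ := h4 q hq _ _ (hp.congr fun i hi hik => (hqp i hi hik).symm) hA'' hB''
  rw [e1, e2]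

end Fold

end KRep

namespace KRep

variable {α : Type*}

/-! ### A deterministic procedure for constrained maximal common subsequences -/

open Classical in
/-- The first letter, among those standing before the first letter of `D` in one of the strings
`Us`, that can be prepended to `D`. -/
noncomputable def candidate (Us : List (List α)) (D : List α) : Option α :=
  (Us.flatMap fun U => U.takeWhile fun a => some a ≠ D.head?).find?
    fun y => ∀ U ∈ Us, (y :: D).Sublist U

open Classical in
/-- The part of `U` after the first occurrence of `w`. -/
noncomputable def dropThrough (w : α) (U : List α) : List α :=
  (U.dropWhile fun a => a ≠ w).tail

/-- Runs of the extension procedure: `D` is the part of the constraint that is still to be matched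
in the remaining strings `Us`. -/
inductive MCSRun : List (List α) → List α → List α → Prop
  | push {Us : List (List α)} {D Z : List α} {y : α} (h : candidate Us D = some y)
      (hr : MCSRun Us (y :: D) Z) : MCSRun Us D Z
  | pop {Us : List (List α)} {w : α} {D Z : List α} (h : candidate Us (w :: D) = none)
      (hr : MCSRun (Us.map (dropThrough w)) D Z) : MCSRun Us (w :: D) (w :: Z)
  | done {Us : List (List α)} (h : candidate Us [] = none) : MCSRun Us [] []

theorem MCSRun.unique {Us : List (List α)} {D Z Z' : List α} (h : MCSRun Us D Z)
    (h' : MCSRun Us D Z') : Z = Z' := by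
  induction h generalizing Z' with
  | push h hr ih =>
    cases h' with
    | push h' hr' => rw [h, Option.some.injEq] at h'; subst h'; exact ih hr'
    | pop h' hr' => simp [h] at h'
    | done h' => simp [h] at h'
  | pop h hr ih =>
    cases h' with
    | push h' hr' => simp [h] at h'
    | pop h' hr' => rw [ih hr']
  | done h =>
    cases h' with
    | push h' hr' => simp [h] at h'
    | done h' => rfl

theorem MCSRun.of_push {Us : List (List α)} {D Z : List α} {y : α} (h : MCSRun Us D Z)
    (hc : candidate Us D = some y) : MCSRun Us (y :: D) Z := by
  cases h with
  | push h hr => rw [hc, Option.some.injEq] at h; subst h; exact hr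
  | pop h hr => simp [h] at hc
  | done h => simp [h] at hc

theorem MCSRun.of_pop {Us : List (List α)} {D Z : List α} {w : α} (h : MCSRun Us (w :: D) Z)
    (hc : candidate Us (w :: D) = none) :
    ∃ Z', Z = w :: Z' ∧ MCSRun (Us.map (dropThrough w)) D Z' := by
  cases h with
  | push h hr => simp [h] at hc
  | pop h hr => exact ⟨_, rfl, hr⟩

theorem MCSRun.of_done {Us : List (List α)} {Z : List α} (h : MCSRun Us [] Z)
    (hc : candidate Us [] = none) : Z = [] := by
  cases h with
  | push h hr => simp [h] at hc
  | done h => rfl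

theorem sublist_of_candidate_eq_some {Us : List (List α)} {D : List α} {y : α}
    (h : candidate Us D = some y) : ∀ U ∈ Us, (y :: D).Sublist U := by
  simpa using List.find?_some h

open Classical in
theorem exists_eq_append_dropThrough {w : α} {U : List α} (h : w ∈ U) :
    ∃ V, U = V ++ w :: dropThrough w U ∧ w ∉ V ∧
      ∀ D : List α, V = U.takeWhile fun a => decide (some a ≠ (w :: D).head?) := by
  obtain ⟨h1, h2⟩ := split_at_first h
  refine ⟨_, ?_, h2, fun D => by simp⟩
  unfold dropThrough
  conv_lhs => rw [← h1]

theorem cons_sublist_append_cons {w : α} {V U D : List α} (hw : w ∉ V) :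
    (w :: D).Sublist (V ++ w :: U) ↔ D.Sublist U := by
  induction V with
  | nil => simp
  | cons a V ih =>
    simp only [List.mem_cons, not_or] at hw
    rw [List.cons_append, List.cons_sublist_cons', ih hw.2]
    constructor
    · rintro (h | ⟨h, -⟩)
      · exact h
      · exact absurd h hw.1
    · exact Or.inl

theorem cons_sublist_iff_dropThrough {w : α} {U D : List α} (h : w ∈ U) :
    (w :: D).Sublist U ↔ D.Sublist (dropThrough w U) := by
  obtain ⟨V, h1, h2, -⟩ := exists_eq_append_dropThrough h
  conv_lhs => rw [h1]
  exact cons_sublist_append_cons h2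

theorem length_dropThrough_lt {w : α} {U : List α} (h : w ∈ U) :
    (dropThrough w U).length < U.length := by
  obtain ⟨V, h1, -, -⟩ := exists_eq_append_dropThrough h
  conv_rhs => rw [h1]
  simp; omega

theorem MCSRun.exists {Us : List (List α)} {D : List α} (hne : Us ≠ [])
    (h : ∀ U ∈ Us, D.Sublist U) : ∃ Z, MCSRun Us D Z := by
  obtain ⟨N, hN⟩ : ∃ N, 2 * (Us.head hne).length - D.length ≤ N := ⟨_, le_rfl⟩
  induction N using Nat.strong_induction_on generalizing Us D with
  | _ N ih =>
    have hlen := (h _ (List.head_mem hne)).length_le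
    rcases hc : candidate Us D with _ | y
    · rcases D with _ | ⟨w, D⟩
      · exact ⟨[], .done hc⟩
      · have hw : ∀ U ∈ Us, w ∈ U := fun U hU => (h U hU).subset (by simp)
        have hlt := length_dropThrough_lt (hw _ (List.head_mem hne))
        obtain ⟨Z, hZ⟩ := ih (N - 1) (by simp at hlen; simp at hN; omega)
          (Us := Us.map (dropThrough w)) (D := D) (by simpa using hne)
          (by
            intro U hU
            obtain ⟨V, hV, rfl⟩ := List.mem_map.1 hU
            exact (cons_sublist_iff_dropThrough (hw V hV)).1 (h V hV))
          (by rw [List.head_map]; simp at hlen hN; omega)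
        exact ⟨_, .pop hc hZ⟩
    · have h' := sublist_of_candidate_eq_some hc
      have hlen' := (h' _ (List.head_mem hne)).length_le
      simp only [List.length_cons] at hlen'
      obtain ⟨Z, hZ⟩ := ih (N - 1) (by omega) (D := y :: D) hne h' (by simp; omega)
      exact ⟨_, .push hc hZ⟩

open Classical in
theorem candidate_none_takeWhile {Us : List (List α)} {w y : α} {D D' U : List α}
    (hc : candidate Us (w :: D) = none) (hU : U ∈ Us) (hD : D.Sublist D')
    (hy : ∀ U ∈ Us, (y :: w :: D').Sublist U) :
    y ∉ U.takeWhile fun a => decide (some a ≠ (w :: D).head?) := by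
  intro hmem
  refine absurd hc (Option.ne_none_iff_isSome.2 ?_)
  unfold candidate
  rw [List.find?_isSome]
  refine ⟨y, List.mem_flatMap.2 ⟨U, hU, hmem⟩, ?_⟩
  simpa using fun U hU => ((hD.cons_cons w).cons_cons y).trans (hy U hU)

theorem MCSRun.spec {Us : List (List α)} {D Z : List α} (h : MCSRun Us D Z) (hne : Us ≠ [])
    (hD : ∀ U ∈ Us, D.Sublist U) :
    D.Sublist Z ∧ (∀ U ∈ Us, Z.Sublist U) ∧
      ∀ P Q y, Z = P ++ Q → ¬ ∀ U ∈ Us, (P ++ y :: Q).Sublist U := by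
  induction h with
  | push h hr ih =>
    obtain ⟨h1, h2, h3⟩ := ih hne (sublist_of_candidate_eq_some h)
    exact ⟨(List.sublist_cons_self _ _).trans h1, h2, h3⟩
  | @pop Us w D Z h hr ih =>
    have hw : ∀ U ∈ Us, w ∈ U := fun U hU => (hD U hU).subset (by simp)
    obtain ⟨h1, h2, h3⟩ := ih (by simpa using hne) (by
      intro U hU
      obtain ⟨V, hV, rfl⟩ := List.mem_map.1 hU
      exact (cons_sublist_iff_dropThrough (hw V hV)).1 (hD V hV))
    simp only [List.forall_mem_map] at h2 h3
    refine ⟨h1.cons_cons w, fun U hU =>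
      (cons_sublist_iff_dropThrough (hw U hU)).2 (h2 U hU), fun P Q y hPQ hall => ?_⟩
    rcases P with _ | ⟨a, P⟩
    · rw [List.nil_append] at hPQ
      subst hPQ
      refine h3 [] Z y rfl fun U hU => ?_
      obtain ⟨V, e1, e2, e3⟩ := exists_eq_append_dropThrough (hw U hU)
      have hyV : y ∉ V := by
        rw [e3 D]; exact candidate_none_takeWhile h hU h1 hall
      have hs := hall U hU
      rw [List.nil_append, e1] at hs
      rw [List.nil_append]
      by_cases hyw : y = w
      · subst hyw
        exact (cons_sublist_append_cons hyV).1 hs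
      · have hs' : ∀ V : List α, y ∉ V → (y :: w :: Z).Sublist (V ++ w :: dropThrough w U) →
            (y :: w :: Z).Sublist (dropThrough w U) := by
          intro V
          induction V with
          | nil =>
            intro _ h'
            rw [List.nil_append, List.cons_sublist_cons'] at h'
            exact h'.resolve_right fun h => hyw h.1
          | cons b V ihV =>
            intro hb h'
            simp only [List.mem_cons, not_or] at hb
            rw [List.cons_append, List.cons_sublist_cons'] at h'
            exact ihV hb.2 (h'.resolve_right fun h => hb.1 h.1)
        exact (((List.sublist_cons_self w Z)).cons_cons y).trans (hs' V hyV hs)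
    · rw [List.cons_append, List.cons.injEq] at hPQ
      obtain ⟨rfl, rfl⟩ := hPQ
      exact h3 P Q y rfl fun U hU =>
        (cons_sublist_iff_dropThrough (hw U hU)).1 (hall U hU)
  | @done Us h =>
    refine ⟨List.Sublist.refl _, hD, fun P Q y hPQ hall => ?_⟩
    obtain ⟨rfl, rfl⟩ := List.append_eq_nil_iff.1 hPQ.symm
    refine absurd h (Option.ne_none_iff_isSome.2 ?_)
    unfold candidate
    rw [List.find?_isSome]
    have hall' : ∀ U ∈ Us, [y].Sublist U := by simpa using hall
    refine ⟨y, List.mem_flatMap.2 ⟨Us.head hne, List.head_mem hne, ?_⟩, by simpa using hall⟩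
    have : y ∈ Us.head hne := (hall' _ (List.head_mem hne)).subset (by simp)
    rwa [List.takeWhile_eq_self_iff.2 (by simp)]

theorem exists_insert_of_sublist {Z D : List α} (h : Z.Sublist D) (hne : D ≠ Z) :
    ∃ P Q y, Z = P ++ Q ∧ (P ++ y :: Q).Sublist D := by
  induction h with
  | slnil => simp at hne
  | @cons Z D a h ih => exact ⟨[], Z, a, rfl, by simpa using h⟩
  | @cons_cons Z D a h ih =>
    obtain ⟨P, Q, y, rfl, h'⟩ := ih (by simpa using hne)
    exact ⟨a :: P, Q, y, rfl, by simpa using h'⟩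

/-- The constrained maximal common subsequence procedure carried out by `MCSRun`. -/
noncomputable def mcs (Ts : List (List α)) (C : List α) : List α :=
  open Classical in if h : ∃ Z, MCSRun Ts C Z then h.choose else []

theorem MCSRun.mcs_eq {Ts : List (List α)} {C Z : List α} (h : MCSRun Ts C Z) : mcs Ts C = Z := by
  unfold mcs
  rw [dif_pos ⟨Z, h⟩]
  exact (Exists.choose_spec (⟨Z, h⟩ : ∃ Z, MCSRun Ts C Z)).unique h

theorem mcsRun_mcs {Ts : List (List α)} {C : List α} (hne : Ts ≠ [])
    (h : ∀ T ∈ Ts, C.Sublist T) : MCSRun Ts C (mcs Ts C) := by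
  obtain ⟨Z, hZ⟩ := MCSRun.exists hne h
  rwa [hZ.mcs_eq]

theorem isMCSProcedure_mcs : IsMCSProcedure (mcs (α := α)) := by
  intro Ts C hne h
  obtain ⟨h1, h2, h3⟩ := (mcsRun_mcs hne h).spec hne h
  refine ⟨⟨h2, fun D hD hs => ?_⟩, h1⟩
  by_contra hne'
  obtain ⟨P, Q, y, e, hy⟩ := exists_insert_of_sublist hs hne'
  exact h3 P Q y e fun U hU => hy.trans (hD U hU)

/-! ### Positions of occurrences -/

/-- The last position before `R` at which `c` stands in `S`, or `0`. -/
noncomputable def prevOcc (S : List α) (c : α) (R : ℕ) : ℕ :=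
  open Classical in Nat.findGreatest (fun p => At S p c) (R - 1)

theorem lt_prevOcc_iff {S : List α} {c : α} {R a : ℕ} :
    a < prevOcc S c R ↔ ∃ p, a < p ∧ p < R ∧ At S p c := by
  classical
  unfold prevOcc
  constructor
  · intro h
    refine ⟨_, h, ?_, Nat.findGreatest_of_ne_zero (P := fun p => At S p c) rfl (by omega)⟩
    have := Nat.findGreatest_le (P := fun p => At S p c) (R - 1)
    omega
  · rintro ⟨p, h1, h2, h3⟩
    exact h1.trans_le (Nat.le_findGreatest (by omega) h3)

theorem prevOcc_eq_zero {S : List α} {c : α} {R : ℕ} (h : ∀ p, p < R → ¬ At S p c) :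
    prevOcc S c R = 0 := by
  by_contra hn
  obtain ⟨p, -, h2, h3⟩ := lt_prevOcc_iff.1 (Nat.pos_of_ne_zero hn)
  exact h p h2 h3

theorem at_prevOcc {S : List α} {c : α} {R : ℕ} (h : 0 < prevOcc S c R) :
    At S (prevOcc S c R) c := by
  classical
  exact Nat.findGreatest_of_ne_zero (P := fun p => At S p c) rfl h.ne'

theorem prevOcc_eq {S : List α} {c : α} {R p : ℕ} (h1 : p < R) (h2 : At S p c)
    (h3 : ∀ q, p < q → q < R → ¬ At S q c) : prevOcc S c R = p := by
  apply le_antisymm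
  · by_contra hlt
    obtain ⟨q, h4, h5, h6⟩ := lt_prevOcc_iff.1 (not_le.1 hlt)
    exact h3 q h4 h5 h6
  · have : p - 1 < prevOcc S c R := lt_prevOcc_iff.2 ⟨p, by have := h2.1; omega, h1, h2⟩
    omega

theorem prevOcc_le {S : List α} {c : α} {R : ℕ} : prevOcc S c R ≤ R - 1 := by
  classical exact Nat.findGreatest_le _

/-- The position at which the rightmost occurrence of `D` as a subsequence before position `E`
starts, or `0`. -/
noncomputable def rightmost (S D : List α) (E : ℕ) : ℕ := D.foldr (fun c R => prevOcc S c R) E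

@[simp] theorem rightmost_nil {S : List α} {E : ℕ} : rightmost S [] E = E := rfl

@[simp] theorem rightmost_cons {S D : List α} {c : α} {E : ℕ} :
    rightmost S (c :: D) E = prevOcc S c (rightmost S D E) := rfl

theorem rightmost_add_length_le {S D : List α} {a E : ℕ} (h : a < rightmost S D E) :
    a + D.length < E := by
  induction D generalizing a with
  | nil => simpa using h
  | cons c D ih =>
    obtain ⟨p, h1, h2, -⟩ := lt_prevOcc_iff.1 h
    have := ih h2
    simp; omega

theorem rightmost_le {S D : List α} {E : ℕ} : rightmost S D E ≤ E := by
  by_contra h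
  have := rightmost_add_length_le (not_le.1 h)
  omega

theorem sublist_between_iff {S D : List α} {a E : ℕ} (h : a < E) :
    D.Sublist (between S a E) ↔ a < rightmost S D E := by
  induction D generalizing a with
  | nil => simpa using h
  | cons c D ih =>
    rw [cons_sublist_between, rightmost_cons, lt_prevOcc_iff]
    constructor
    · rintro ⟨p, h1, h2, h3, h4⟩; exact ⟨p, h1, (ih h2).1 h4, h3⟩
    · rintro ⟨p, h1, h2, h3⟩
      have : p < E := h2.trans_le rightmost_le
      exact ⟨p, h1, this, h3, (ih this).2 h2⟩

theorem prevPt_eq_rightmost {S A : List α} {i : ℕ} (h : 0 < rightmost S A i) :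
    prevPt S A i = some (rightmost S A i) := by
  have hi : 1 ≤ i := h.trans_le rightmost_le
  rw [prevPt_eq_some_iff hi]
  exact ⟨h, rightmost_le, fun a ha => sublist_between_iff ha⟩

/-- The right end of the `i`-th right block, computed with `rightmost`. -/
noncomputable def blockEnd (k : ℕ) (S A : List α) (p : ℕ → ℕ) (i : ℕ) : ℕ :=
  if i = k then S.length + 1 else rightmost S A (p (i + 1))

theorem isSplitPoint_iff_rightmost {k : ℕ} {S : List α} {σ : α} {A B : List α} {p : ℕ → ℕ}
    (hp : ∀ i, 1 ≤ i → i ≤ k → At S (p i) σ) :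
    IsSplitPoint k S σ A B p ↔ (∀ i, 1 ≤ i → i ≤ k → 0 < rightmost S A (p i)) ∧
      ∀ i, 1 ≤ i → i ≤ k → p i < rightmost S B (blockEnd k S A p i) := by
  rw [isSplitPoint_iff]
  constructor
  · rintro ⟨h1, h2⟩
    refine ⟨fun i hi hk => (sublist_between_iff (h1 i hi hk).1.1).1 (h1 i hi hk).2.1,
      fun i hi hk => ?_⟩
    unfold blockEnd
    split_ifs with hik
    · exact (sublist_between_iff (by have := (hp i hi hk).le_length; omega)).1 (h1 i hi hk).2.2
    · obtain ⟨c, h3, h4, h5, h6⟩ := h2 i hi (by omega)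
      have h7 := (sublist_between_iff h4).1 h6
      exact (sublist_between_iff (by omega)).1 (h5.trans (between_mono le_rfl h7))
  · rintro ⟨h1, h2⟩
    refine ⟨fun i hi hk => ⟨hp i hi hk, (sublist_between_iff (hp i hi hk).1).2 (h1 i hi hk), ?_⟩,
      fun i hi hk => ?_⟩
    · have h3 := h2 i hi hk
      have h4 := h3.trans_le rightmost_le
      refine ((sublist_between_iff h4).2 h3).trans ?_
      rw [between_length_eq_drop]
      exact (List.take_sublist _ _).drop _
    · have h3 := h2 i hi hk.le
      have h4 := h3.trans_le rightmost_le
      have h5 := (sublist_between_iff h4).2 h3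
      rw [blockEnd, if_neg hk.ne] at h4 h5
      have h6 : rightmost S A (p (i + 1)) ≤ p (i + 1) := rightmost_le
      refine ⟨rightmost S A (p (i + 1)) - 1, by omega, by omega, ?_,
        (sublist_between_iff (by omega)).2 (by omega)⟩
      rwa [Nat.sub_add_cancel (by omega)]

theorem nextPt_nil {S : List α} {a : ℕ} : nextPt S [] a = some a := by
  rw [nextPt_eq_some_iff]
  exact ⟨le_rfl, fun e he => by simpa using he⟩

theorem nextPt_append_singleton {S Z : List α} {a l q : ℕ} {w : α}
    (h : nextPt S Z a = some l) (hlq : l < q) (hq : At S q w)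
    (hnone : ∀ p, l < p → p < q → ¬ At S p w) : nextPt S (Z ++ [w]) a = some q := by
  rw [nextPt_eq_some_iff] at h ⊢
  refine ⟨by omega, fun e he => ?_⟩
  rw [append_singleton_sublist_between]
  constructor
  · rintro ⟨p, h1, h2, h3, h4⟩
    have e1 : p = p - 1 + 1 := by omega
    rw [e1, h.2 (p - 1) (by omega)] at h4
    by_contra hlt
    exact hnone p (by omega) (by omega) h3
  · intro h'
    refine ⟨q, by omega, by omega, hq, ?_⟩
    have e1 : q = q - 1 + 1 := by omega
    rw [e1, h.2 (q - 1) (by omega)]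
    omega

/-! ### The procedure on blocks of a string -/

/-- The substrings `S(L i, E i)`, `1 ≤ i ≤ k`. -/
def blocks (k : ℕ) (S : List α) (L E : ℕ → ℕ) : List (List α) :=
  (List.range' 1 k).map fun i => between S (L i) (E i)

theorem mem_blocks {k : ℕ} {S : List α} {L E : ℕ → ℕ} {T : List α} :
    T ∈ blocks k S L E ↔ ∃ i, 1 ≤ i ∧ i ≤ k ∧ between S (L i) (E i) = T := by
  simp only [blocks, List.mem_map, List.mem_range'_1]
  constructor
  · rintro ⟨i, h, rfl⟩; exact ⟨i, h.1, by omega, rfl⟩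
  · rintro ⟨i, h, h', rfl⟩; exact ⟨i, ⟨h, by omega⟩, rfl⟩

theorem blocks_congr {k : ℕ} {S : List α} {L E L' E' : ℕ → ℕ}
    (h : ∀ i, 1 ≤ i → i ≤ k → L i = L' i ∧ E i = E' i) : blocks k S L E = blocks k S L' E' := by
  refine List.map_congr_left fun i hi => ?_
  rw [List.mem_range'_1] at hi
  obtain ⟨h1, h2⟩ := h i hi.1 (by omega)
  rw [h1, h2]

/-- `s i` is how far block `i` has been scanned: no letter read so far is the first letter of `D`
or can be prepended to `D`, and `D` still fits. -/
structure Scanned (k : ℕ) (S : List α) (L E : ℕ → ℕ) (D : List α) (s : ℕ → ℕ) : Prop where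
  le : ∀ i, 1 ≤ i → i ≤ k → L i ≤ s i
  lt : ∀ i, 1 ≤ i → i ≤ k → s i < rightmost S D (E i)
  ne : ∀ i, 1 ≤ i → i ≤ k → ∀ p c, L i < p → p ≤ s i → At S p c → D.head? ≠ some c
  not : ∀ i, 1 ≤ i → i ≤ k → ∀ p c, L i < p → p ≤ s i → At S p c →
    ∃ j, 1 ≤ j ∧ j ≤ k ∧ prevOcc S c (rightmost S D (E j)) ≤ L j

/-- Block `i` is scanned up to the first letter of `D`, or completely if `D` is empty. -/
def AtLimit (S : List α) (E : ℕ → ℕ) (D : List α) (s : ℕ → ℕ) (i : ℕ) : Prop :=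
  E i ≤ s i + 1 ∨ ∃ c, D.head? = some c ∧ At S (s i + 1) c

theorem between_eq_cons {S : List α} {a b : ℕ} {c : α} (h : a + 1 < b) (hc : At S (a + 1) c) :
    between S a b = c :: between S (a + 1) b := by
  refine List.ext_getElem? fun i => ?_
  rw [getElem?_between]
  rcases i with _ | i
  · rw [if_pos (by omega)]; simpa using hc.2
  · rw [List.getElem?_cons_succ, getElem?_between]
    have : a + (i + 1) = a + 1 + i := by omega
    rw [this]

section Scan

variable {k : ℕ} {S : List α} {L E : ℕ → ℕ} {D : List α} {s : ℕ → ℕ}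

theorem Scanned.lt_end (h : Scanned k S L E D s) {i : ℕ} (hi : 1 ≤ i) (hk : i ≤ k) :
    s i + D.length < E i := rightmost_add_length_le (h.lt i hi hk)

theorem Scanned.avail_iff (h : Scanned k S L E D s) {y : α} :
    (∀ U ∈ blocks k S L E, (y :: D).Sublist U) ↔
      ∀ i, 1 ≤ i → i ≤ k → L i < prevOcc S y (rightmost S D (E i)) := by
  have hlt : ∀ i, 1 ≤ i → i ≤ k → L i < E i := fun i hi hk => by
    have := h.le i hi hk
    have := h.lt_end hi hk
    omega
  constructor
  · intro h' i hi hk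
    exact (sublist_between_iff (hlt i hi hk)).1 (h' _ (mem_blocks.2 ⟨i, hi, hk, rfl⟩))
  · intro h' U hU
    obtain ⟨i, hi, hk, rfl⟩ := mem_blocks.1 hU
    exact (sublist_between_iff (hlt i hi hk)).2 (h' i hi hk)

open Classical in
theorem Scanned.takeWhile_eq (h : Scanned k S L E D s) {i : ℕ} (hi : 1 ≤ i) (hk : i ≤ k) :
    (between S (L i) (E i)).takeWhile (fun a => decide (some a ≠ D.head?)) =
      between S (L i) (s i + 1) ++
        (between S (s i) (E i)).takeWhile (fun a => decide (some a ≠ D.head?)) := by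
  rw [between_eq_append (h.le i hi hk) (by have := h.lt_end hi hk; omega),
    List.takeWhile_append_of_pos]
  intro c hc
  obtain ⟨p, h1, h2, h3, -⟩ := cons_sublist_between.1 (List.singleton_sublist.2 hc)
  simpa using (h.ne i hi hk p c h1 (by omega) h3).symm

open Classical in
theorem Scanned.takeWhile_eq_of_atLimit (h : Scanned k S L E D s) {i : ℕ} (hi : 1 ≤ i)
    (hk : i ≤ k) (hl : AtLimit S E D s i) :
    (between S (L i) (E i)).takeWhile (fun a => decide (some a ≠ D.head?)) =
      between S (L i) (s i + 1) := by
  rw [h.takeWhile_eq hi hk]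
  suffices (between S (s i) (E i)).takeWhile (fun a => decide (some a ≠ D.head?)) = [] by
    rw [this, List.append_nil]
  by_cases hE : E i ≤ s i + 1
  · rw [between_eq_nil hE]; rfl
  · obtain ⟨c, h1, h2⟩ := hl.resolve_left hE
    rw [between_eq_cons (by omega) h2]
    simp [h1]

theorem Scanned.not_avail (h : Scanned k S L E D s) {i : ℕ} (hi : 1 ≤ i) (hk : i ≤ k) {c : α}
    (hc : c ∈ between S (L i) (s i + 1)) : ¬ ∀ U ∈ blocks k S L E, (c :: D).Sublist U := by
  rw [h.avail_iff]
  obtain ⟨p, h1, h2, h3, -⟩ := cons_sublist_between.1 (List.singleton_sublist.2 hc)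
  obtain ⟨j, h4, h5, h6⟩ := h.not i hi hk p c h1 (by omega) h3
  intro h'
  have := h' j h4 h5
  omega

theorem Scanned.candidate_eq_none (h : Scanned k S L E D s)
    (hl : ∀ i, 1 ≤ i → i ≤ k → AtLimit S E D s i) : candidate (blocks k S L E) D = none := by
  unfold candidate
  rw [List.find?_eq_none]
  intro c hc
  obtain ⟨U, hU, hc⟩ := List.mem_flatMap.1 hc
  obtain ⟨i, hi, hk, rfl⟩ := mem_blocks.1 hU
  rw [h.takeWhile_eq_of_atLimit hi hk (hl i hi hk)] at hc
  simpa using h.not_avail hi hk hc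

theorem Scanned.candidate_eq_some (h : Scanned k S L E D s) {i : ℕ} (hi : 1 ≤ i) (hk : i ≤ k)
    (hl : ∀ j, 1 ≤ j → j < i → AtLimit S E D s j) (hE : s i + 1 < E i) {y : α}
    (hy : At S (s i + 1) y) (hyD : D.head? ≠ some y)
    (hav : ∀ j, 1 ≤ j → j ≤ k → L j < prevOcc S y (rightmost S D (E j))) :
    candidate (blocks k S L E) D = some y := by
  classical
  have e : List.range' 1 k = List.range' 1 (i - 1) ++ i :: List.range' (i + 1) (k - i) := by
    have h1 : k = (i - 1) + (k - i + 1) := by omega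
    have h2 : 1 + 1 * (i - 1) = i := by omega
    conv_lhs => rw [h1, ← List.range'_append]
    rw [h2, List.range'_succ]
  unfold candidate
  rw [List.find?_flatMap, List.findSome?_eq_some_iff]
  refine ⟨(List.range' 1 (i - 1)).map fun i => between S (L i) (E i), between S (L i) (E i),
    (List.range' (i + 1) (k - i)).map fun i => between S (L i) (E i), ?_, ?_, ?_⟩
  · rw [blocks, e, List.map_append, List.map_cons]
  · rw [List.find?_eq_some_iff_append]
    refine ⟨by simpa using (h.avail_iff.2 hav), between S (L i) (s i + 1), ?_⟩
    rw [h.takeWhile_eq hi hk, between_eq_cons hE hy,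
      List.takeWhile_cons_of_pos (by simpa using hyD.symm)]
    refine ⟨_, rfl, fun c hc => ?_⟩
    simpa using h.not_avail hi hk hc
  · intro U hU
    obtain ⟨j, hj, rfl⟩ := List.mem_map.1 hU
    rw [List.mem_range'_1] at hj
    rw [List.find?_eq_none]
    intro c hc
    rw [h.takeWhile_eq_of_atLimit hj.1 (by omega) (hl j hj.1 (by omega))] at hc
    simpa using h.not_avail hj.1 (by omega) hc

theorem Scanned.init (h : ∀ i, 1 ≤ i → i ≤ k → L i < rightmost S D (E i)) :
    Scanned k S L E D L :=
  ⟨fun _ _ _ => le_rfl, h, fun _ _ _ _ _ h1 h2 => by omega, fun _ _ _ _ _ h1 h2 => by omega⟩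

theorem Scanned.push (h : Scanned k S L E D s) {y : α}
    (hav : ∀ j, 1 ≤ j → j ≤ k → L j < prevOcc S y (rightmost S D (E j))) :
    Scanned k S L E (y :: D) s := by
  have hne : ∀ i, 1 ≤ i → i ≤ k → ∀ p, L i < p → p ≤ s i → ¬ At S p y := by
    intro i hi hk p h1 h2 h3
    obtain ⟨j, h4, h5, h6⟩ := h.not i hi hk p y h1 h2 h3
    have := hav j h4 h5
    omega
  refine ⟨h.le, fun i hi hk => ?_, fun i hi hk p c h1 h2 h3 => ?_, fun i hi hk p c h1 h2 h3 => ?_⟩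
  · rw [rightmost_cons]
    by_contra hlt
    exact hne i hi hk _ (hav i hi hk) (by omega) (at_prevOcc (by have := hav i hi hk; omega))
  · rintro ⟨⟩
    exact hne i hi hk p h1 h2 h3
  · obtain ⟨j, h4, h5, h6⟩ := h.not i hi hk p c h1 h2 h3
    refine ⟨j, h4, h5, ?_⟩
    by_contra hlt
    obtain ⟨q, h7, h8, h9⟩ := lt_prevOcc_iff.1 (not_le.1 hlt)
    have : L j < prevOcc S c (rightmost S D (E j)) :=
      lt_prevOcc_iff.2 ⟨q, h7, by
        rw [rightmost_cons] at h8
        have := prevOcc_le (S := S) (c := y) (R := rightmost S D (E j))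
        omega, h9⟩
    omega

theorem Scanned.advance (h : Scanned k S L E D s) {i : ℕ} (hi : 1 ≤ i) (hk : i ≤ k)
    (hE : s i + 1 < E i) {y : α} (hy : At S (s i + 1) y) (hyD : D.head? ≠ some y)
    (hav : ∃ j, 1 ≤ j ∧ j ≤ k ∧ prevOcc S y (rightmost S D (E j)) ≤ L j) :
    Scanned k S L E D (Function.update s i (s i + 1)) := by
  refine ⟨fun j hj hjk => ?_, fun j hj hjk => ?_, fun j hj hjk p c h1 h2 h3 => ?_,
    fun j hj hjk p c h1 h2 h3 => ?_⟩
  · rcases eq_or_ne j i with rfl | hne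
    · have := h.le j hj hjk
      simp; omega
    · simpa [hne] using h.le j hj hjk
  · rcases eq_or_ne j i with rfl | hne
    · have h4 := h.lt j hj hjk
      rw [Function.update_self]
      rcases D with _ | ⟨c, D⟩
      · simpa using hE
      · rw [rightmost_cons] at h4 ⊢
        refine lt_of_le_of_ne h4 fun he => hyD ?_
        have := at_prevOcc (show 0 < prevOcc S c (rightmost S D (E j)) by omega)
        rw [← he] at this
        simpa using this.unique hy
    · simpa [hne] using h.lt j hj hjk
  · rcases eq_or_ne j i with rfl | hne
    · rw [Function.update_self] at h2
      rcases Nat.lt_or_ge (s j) p with h4 | h4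
      · obtain rfl : p = s j + 1 := by omega
        rw [h3.unique hy]; exact hyD
      · exact h.ne j hj hjk p c h1 h4 h3
    · rw [Function.update_of_ne hne] at h2
      exact h.ne j hj hjk p c h1 h2 h3
  · rcases eq_or_ne j i with rfl | hne
    · rw [Function.update_self] at h2
      rcases Nat.lt_or_ge (s j) p with h4 | h4
      · obtain rfl : p = s j + 1 := by omega
        rw [h3.unique hy]; exact hav
      · exact h.not j hj hjk p c h1 h4 h3
    · rw [Function.update_of_ne hne] at h2
      exact h.not j hj hjk p c h1 h2 h3

theorem Scanned.at_of_atLimit {w : α} (h : Scanned k S L E (w :: D) s) {i : ℕ} (hi : 1 ≤ i)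
    (hk : i ≤ k) (hl : AtLimit S E (w :: D) s i) : At S (s i + 1) w := by
  rcases hl with hl | ⟨c, hc, hl⟩
  · have := h.lt_end hi hk
    simp at this
    omega
  · obtain rfl : w = c := by simpa using hc
    exact hl

theorem Scanned.pop {w : α} (h : Scanned k S L E (w :: D) s) :
    Scanned k S (fun i => s i + 1) E D (fun i => s i + 1) := by
  refine Scanned.init fun i hi hk => ?_
  have h1 := h.lt i hi hk
  rw [rightmost_cons, lt_prevOcc_iff] at h1
  obtain ⟨p, h2, h3, -⟩ := h1
  omega

theorem Scanned.map_dropThrough {w : α} (h : Scanned k S L E (w :: D) s)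
    (hl : ∀ i, 1 ≤ i → i ≤ k → AtLimit S E (w :: D) s i) :
    (blocks k S L E).map (dropThrough w) = blocks k S (fun i => s i + 1) E := by
  classical
  unfold blocks
  rw [List.map_map]
  refine List.map_congr_left fun i hi => ?_
  rw [List.mem_range'_1] at hi
  have hk : i ≤ k := by omega
  have hat := h.at_of_atLimit hi.1 hk (hl i hi.1 hk)
  have hlt := h.lt_end hi.1 hk
  simp only [List.length_cons] at hlt
  unfold dropThrough
  rw [Function.comp_apply, between_eq_append (h.le i hi.1 hk) (by omega),
    between_eq_cons (by omega) hat,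
    List.dropWhile_append_of_pos, List.dropWhile_cons_of_neg (by simp), List.tail_cons]
  intro c hc
  obtain ⟨p, h1, h2, h3, -⟩ := cons_sublist_between.1 (List.singleton_sublist.2 hc)
  have := h.ne i hi.1 hk p c h1 (by omega) h3
  exact decide_eq_true fun e => this (by rw [e]; rfl)

theorem Scanned.nextPt_step {w : α} (h : Scanned k S L E (w :: D) s) {i : ℕ} (hi : 1 ≤ i)
    (hk : i ≤ k) (hl : AtLimit S E (w :: D) s i) {Z : List α} {a : ℕ}
    (hn : nextPt S Z a = some (L i)) : nextPt S (Z ++ [w]) a = some (s i + 1) := by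
  refine nextPt_append_singleton hn (by have := h.le i hi hk; omega)
    (h.at_of_atLimit hi hk hl) fun p h1 h2 h3 => ?_
  exact h.ne i hi hk p w h1 (by omega) h3 rfl

end Scan

end KRep

namespace WordRAM

infixl:65 " +ₑ " => Expr.bin BinOp.add
infixl:65 " -ₑ " => Expr.bin BinOp.sub
infixl:70 " *ₑ " => Expr.bin BinOp.mul
infixl:70 " /ₑ " => Expr.bin BinOp.div
infix:50 " <ₑ " => Expr.bin BinOp.lt
infix:50 " =ₑ " => Expr.bin BinOp.eq
infixr:40 " ;; " => Program.seq

/-- The value of an expression, ignoring overflow. -/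
def Expr.val (s : State) : Expr → ℕ
  | lit n => n
  | reg x => s.reg x
  | read a i => s.arr a (i.val s)
  | bin op e f => op.apply (e.val s) (f.val s)

/-- No overflow occurs in the evaluation of an expression. -/
def Expr.Fits (W : ℕ) (s : State) : Expr → Prop
  | lit n => n < W
  | reg _ => True
  | read _ i => i.Fits W s
  | bin op e f => e.Fits W s ∧ f.Fits W s ∧ op.apply (e.val s) (f.val s) < W

theorem Expr.eval_eq_some_iff {W : ℕ} {s : State} {e : Expr} {v : ℕ} :
    e.eval W s = some v ↔ e.Fits W s ∧ e.val s = v := by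
  induction e generalizing v with
  | lit n => simp [eval, Fits, val]
  | reg x => simp [eval, Fits, val]
  | read a i ih => simp [eval, Fits, val, ih]
  | bin op e f ihe ihf =>
    simp only [eval, Option.bind_eq_some_iff, ihe, ihf, Fits, val]
    constructor
    · rintro ⟨x, ⟨h1, rfl⟩, y, ⟨h2, rfl⟩, h3⟩
      split_ifs at h3 with h4
      exact ⟨⟨h1, h2, h4⟩, Option.some.inj h3⟩
    · rintro ⟨⟨h1, h2, h3⟩, rfl⟩
      exact ⟨_, ⟨h1, rfl⟩, _, ⟨h2, rfl⟩, by rw [if_pos h3]⟩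

@[simp] theorem BinOp.apply_add {x y : ℕ} : BinOp.add.apply x y = x + y := rfl
@[simp] theorem BinOp.apply_sub {x y : ℕ} : BinOp.sub.apply x y = x - y := rfl
@[simp] theorem BinOp.apply_mul {x y : ℕ} : BinOp.mul.apply x y = x * y := rfl
@[simp] theorem BinOp.apply_div {x y : ℕ} : BinOp.div.apply x y = x / y := rfl
@[simp] theorem BinOp.apply_lt {x y : ℕ} : BinOp.lt.apply x y = if x < y then 1 else 0 := rfl
@[simp] theorem BinOp.apply_eq {x y : ℕ} : BinOp.eq.apply x y = if x = y then 1 else 0 := rfl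

attribute [simp] Expr.val Expr.Fits Expr.cost

@[simp] theorem State.setReg_reg {s : State} {x v y : ℕ} :
    (s.setReg x v).reg y = if y = x then v else s.reg y := by
  simp [State.setReg, Function.update_apply]

@[simp] theorem State.setReg_arr {s : State} {x v : ℕ} : (s.setReg x v).arr = s.arr := rfl

@[simp] theorem State.setArr_reg {s : State} {a i v : ℕ} : (s.setArr a i v).reg = s.reg := rfl

@[simp] theorem State.setArr_arr {s : State} {a i v b : ℕ} :
    (s.setArr a i v).arr b = if b = a then Function.update (s.arr a) i v else s.arr b := by
  by_cases h : b = a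
  · subst h; simp [State.setArr]
  · simp [State.setArr, h]

/-- Total correctness with a clock: started in `s` at time `t`, the program halts in a state and
at a time satisfying `Q`. -/
def wp (W : ℕ) (p : Program) (Q : State → ℕ → Prop) (s : State) (t : ℕ) : Prop :=
  ∃ s' u, Exec W p s s' u ∧ Q s' (t + u)

variable {W : ℕ} {p q : Program} {Q Q' : State → ℕ → Prop} {s : State} {t : ℕ} {e f : Expr}

theorem wp.mono (h : wp W p Q s t) (hQ : ∀ s' t', Q s' t' → Q' s' t') : wp W p Q' s t := by
  obtain ⟨s', u, h1, h2⟩ := h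
  exact ⟨s', u, h1, hQ _ _ h2⟩

@[simp] theorem wp_skip : wp W .skip Q s t ↔ Q s (t + 1) := by
  constructor
  · rintro ⟨s', u, ⟨⟩, h⟩; exact h
  · intro h; exact ⟨_, _, .skip s, h⟩

@[simp] theorem wp_assign {x : ℕ} : wp W (.assign x e) Q s t ↔
    e.Fits W s ∧ Q (s.setReg x (e.val s)) (t + (e.cost + 1)) := by
  constructor
  · rintro ⟨s', u, h1, h⟩
    cases h1 with
    | assign he =>
      obtain ⟨h1, rfl⟩ := Expr.eval_eq_some_iff.1 he
      exact ⟨h1, h⟩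
  · rintro ⟨h1, h2⟩; exact ⟨_, _, .assign (Expr.eval_eq_some_iff.2 ⟨h1, rfl⟩), h2⟩

@[simp] theorem wp_write {a : ℕ} : wp W (.write a e f) Q s t ↔
    e.Fits W s ∧ f.Fits W s ∧
      Q (s.setArr a (e.val s) (f.val s)) (t + (e.cost + f.cost + 1)) := by
  constructor
  · rintro ⟨s', u, h1, h⟩
    cases h1 with
    | write hi he =>
      obtain ⟨h1, rfl⟩ := Expr.eval_eq_some_iff.1 he
      obtain ⟨h2, rfl⟩ := Expr.eval_eq_some_iff.1 hi
      exact ⟨h2, h1, h⟩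
  · rintro ⟨h1, h2, h3⟩
    exact ⟨_, _, .write (Expr.eval_eq_some_iff.2 ⟨h1, rfl⟩)
      (Expr.eval_eq_some_iff.2 ⟨h2, rfl⟩), h3⟩

@[simp] theorem wp_seq : wp W (p ;; q) Q s t ↔ wp W p (fun s' t' => wp W q Q s' t') s t := by
  constructor
  · rintro ⟨s', u, h1, h⟩
    cases h1 with
    | seq hp hq => exact ⟨_, _, hp, _, _, hq, by rwa [Nat.add_assoc]⟩
  · rintro ⟨s', u, h1, s'', u', h2, h⟩
    exact ⟨_, _, .seq h1 h2, by rwa [← Nat.add_assoc]⟩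

@[simp] theorem wp_cond : wp W (.cond e p q) Q s t ↔
    e.Fits W s ∧ (e.val s ≠ 0 → wp W p Q s (t + (e.cost + 1))) ∧
      (e.val s = 0 → wp W q Q s (t + (e.cost + 1))) := by
  constructor
  · rintro ⟨s', u, h1, h⟩
    cases h1 with
    | cond_true he hv hp =>
      obtain ⟨h1, rfl⟩ := Expr.eval_eq_some_iff.1 he
      exact ⟨h1, fun _ => ⟨_, _, hp, by rwa [Nat.add_assoc]⟩, fun h0 => absurd h0 hv⟩
    | cond_false he hq =>
      obtain ⟨h1, h2⟩ := Expr.eval_eq_some_iff.1 he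
      exact ⟨h1, fun h0 => absurd h2 h0, fun _ => ⟨_, _, hq, by rwa [Nat.add_assoc]⟩⟩
  · rintro ⟨h1, h2, h3⟩
    by_cases h0 : e.val s = 0
    · obtain ⟨s', u, h4, h5⟩ := h3 h0
      exact ⟨_, _, .cond_false (Expr.eval_eq_some_iff.2 ⟨h1, h0⟩) h4, by rwa [← Nat.add_assoc]⟩
    · obtain ⟨s', u, h4, h5⟩ := h2 h0
      exact ⟨_, _, .cond_true (Expr.eval_eq_some_iff.2 ⟨h1, rfl⟩) h0 h4,
        by rwa [← Nat.add_assoc]⟩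

/-- The loop rule, with an invariant that carries a decreasing measure. -/
theorem wp_loop (Inv : ℕ → State → ℕ → Prop)
    (h : ∀ m s t, Inv m s t → e.Fits W s ∧
      (e.val s ≠ 0 → wp W p (fun s' t' => ∃ m' < m, Inv m' s' t') s (t + (e.cost + 1))) ∧
      (e.val s = 0 → Q s (t + (e.cost + 1)))) {m : ℕ} (h0 : Inv m s t) :
    wp W (.loop e p) Q s t := by
  induction m using Nat.strong_induction_on generalizing s t with
  | _ m ih =>
    obtain ⟨h1, h2, h3⟩ := h m s t h0
    by_cases hv : e.val s = 0
    · exact ⟨_, _, .loop_false (Expr.eval_eq_some_iff.2 ⟨h1, hv⟩), h3 hv⟩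
    · obtain ⟨s', u, h4, m', hm, h5⟩ := h2 hv
      obtain ⟨s'', u', h6, h7⟩ := ih m' hm h5
      refine ⟨_, _, .loop_true (Expr.eval_eq_some_iff.2 ⟨h1, rfl⟩) hv h4 h6, ?_⟩
      simpa [Nat.add_assoc] using h7

/-- The rule for a loop whose number `N` of iterations is known. -/
theorem wp_for (N c : ℕ) (Inv : ℕ → State → Prop)
    (hbody : ∀ j s t, j < N → Inv j s → e.Fits W s ∧ e.val s ≠ 0 ∧
      wp W p (fun s' t' => Inv (j + 1) s' ∧ t' ≤ t + c) s t)
    (hend : ∀ s, Inv N s → e.Fits W s ∧ e.val s = 0) (h0 : Inv 0 s)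
    (hQ : ∀ s' t', Inv N s' → t' ≤ t + (N * (c + e.cost + 1) + e.cost + 1) → Q s' t') :
    wp W (.loop e p) Q s t := by
  refine wp_loop (fun m s' t' => ∃ j, j + m = N ∧ Inv j s' ∧ t' ≤ t + j * (c + e.cost + 1)) ?_
    (m := N) ⟨0, by omega, h0, by omega⟩
  rintro m s' t' ⟨j, hj, hI, ht⟩
  rcases m with _ | m
  · obtain rfl : j = N := by omega
    obtain ⟨h1, h2⟩ := hend s' hI
    exact ⟨h1, fun h => absurd h2 h, fun _ => hQ _ _ hI (by omega)⟩
  · obtain ⟨h1, h2, h3⟩ := hbody j s' (t' + (e.cost + 1)) (by omega) hI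
    refine ⟨h1, fun _ => h3.mono fun s'' t'' h => ⟨m, by omega, j + 1, by omega, h.1, ?_⟩,
      fun h => absurd h h2⟩
    have := h.2
    rw [Nat.add_mul, Nat.one_mul]
    omega

end WordRAM

namespace KRep

/-- The `j`-th occurrence of `y` in `S` for `j ≥ 1`, and `0` for `j = 0`. -/
def occFn {α : Type*} [DecidableEq α] (S : List α) (y : α) (j : ℕ) : ℕ :=
  (0 :: occurrences S y).getD j 0

section
variable {α : Type*} [DecidableEq α] {S : List α} {y : α}

@[simp] theorem occFn_zero : occFn S y 0 = 0 := rfl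

theorem occFn_succ {j : ℕ} (h : j < S.count y) :
    occFn S y (j + 1) = (occurrences S y)[j]'(by rwa [length_occurrences]) := by
  rw [← length_occurrences] at h
  simp [occFn, h]

theorem at_occFn {j : ℕ} (h : 1 ≤ j) (h' : j ≤ S.count y) : At S (occFn S y j) y := by
  obtain ⟨i, rfl⟩ : ∃ i, j = i + 1 := ⟨j - 1, by omega⟩
  rw [occFn_succ (by omega), ← mem_occurrences]
  exact List.getElem_mem _

theorem exists_occFn {q : ℕ} (h : At S q y) : ∃ j, 1 ≤ j ∧ j ≤ S.count y ∧ occFn S y j = q := by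
  obtain ⟨i, hi, rfl⟩ := List.getElem_of_mem (mem_occurrences.2 h)
  rw [length_occurrences] at hi
  exact ⟨i + 1, by omega, by omega, occFn_succ hi⟩

theorem occFn_lt {i j : ℕ} (hij : i < j) (hj : j ≤ S.count y) : occFn S y i < occFn S y j := by
  obtain ⟨j, rfl⟩ : ∃ i, j = i + 1 := ⟨j - 1, by omega⟩
  rcases i with _ | i
  · exact (at_occFn (by omega) hj).1
  · rw [occFn_succ (by omega), occFn_succ (by omega)]
    have hs : (occurrences S y).Pairwise (· < ·) := (List.pairwise_lt_range' (s := 1)).filter _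
    exact List.pairwise_iff_getElem.1 hs i j _ _ (by omega)

theorem prevOcc_eq_occFn {j R : ℕ} (hj : j ≤ S.count y) (h : j = 0 ∨ occFn S y j < R)
    (h' : ∀ i, j < i → i ≤ S.count y → R ≤ occFn S y i) : prevOcc S y R = occFn S y j := by
  have hnone : ∀ q, occFn S y j < q → q < R → ¬ At S q y := by
    intro q h1 h2 h3
    obtain ⟨i, h4, h5, rfl⟩ := exists_occFn h3
    rcases Nat.lt_or_ge j i with h6 | h6
    · have := h' i h6 h5; omega
    · rcases h6.eq_or_lt with rfl | h6
      · omega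
      · have := occFn_lt h6 hj; omega
  rcases Nat.eq_zero_or_pos j with rfl | h0
  · rw [occFn_zero]
    exact prevOcc_eq_zero fun p h1 h2 => hnone p (by have := h2.1; simpa) h1 h2
  · exact prevOcc_eq (h.resolve_left (by omega)) (at_occFn h0 hj) hnone

end
end KRep

namespace WordRAM
open KRep

/-- Arrays `0`, `2`, `3`, `4` and register `2` hold the string `S` and the lists of the positions of
its letters. -/
structure Tables (S : List ℕ) (s : State) : Prop where
  len : s.reg 2 = S.length
  letter : ∀ p c, At S p c → s.arr 0 (p - 1) = c
  first : ∀ y, s.arr 2 y ≤ S.length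
  count : ∀ y, s.arr 3 y = S.count y
  occ : ∀ y j, j ≤ S.count y → s.arr 4 (s.arr 2 y * (S.length + 1) + j) = occFn S y j

theorem Tables.congr {S : List ℕ} {s s' : State} (h : Tables S s) (hr : s'.reg 2 = s.reg 2)
    (h0 : s'.arr 0 = s.arr 0) (h2 : s'.arr 2 = s.arr 2) (h3 : s'.arr 3 = s.arr 3)
    (h4 : s'.arr 4 = s.arr 4) : Tables S s' := by
  obtain ⟨a, b, c, d, e⟩ := h
  constructor
  · rwa [hr]
  · rwa [h0]
  · rwa [h2]
  · rwa [h3]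
  · rwa [h2, h4]

/-- Register `62` becomes the last position before the number in register `61` of the letter in
register `41`. -/
def prevOccProg : Program :=
  .assign 66 (.read 2 (.reg 41) *ₑ (.reg 2 +ₑ .lit 1)) ;;
  .assign 63 (.lit 0) ;;
  .assign 64 (.read 3 (.reg 41)) ;;
  .loop (.reg 63 <ₑ .reg 64)
    (.assign 65 ((.reg 63 +ₑ .reg 64 +ₑ .lit 1) /ₑ .lit 2) ;;
      .cond (.read 4 (.reg 66 +ₑ .reg 65) <ₑ .reg 61)
        (.assign 63 (.reg 65)) (.assign 64 (.reg 65 -ₑ .lit 1))) ;;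
  .assign 62 (.read 4 (.reg 66 +ₑ .reg 63))

theorem mul_add_lt {n W a b c : ℕ} (hW : (n + 3) * (n + 3) ≤ W) (ha : a ≤ n + 1)
    (hb : b ≤ n + 1) (hc : c ≤ n + 1) : a * b + c < W := by
  have : a * b ≤ (n + 1) * (n + 1) := Nat.mul_le_mul ha hb
  nlinarith

theorem linear_lt {n W : ℕ} (hW : (n + 3) * (n + 3) ≤ W) : 6 * n + 9 ≤ W := by nlinarith

theorem wp_prevOccProg {W : ℕ} {S : List ℕ} {s : State} {t y R : ℕ} (hT : Tables S s)
    (hW : (S.length + 3) * (S.length + 3) ≤ W) (hy : s.reg 41 = y) (hR : s.reg 61 = R) :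
    wp W prevOccProg (fun s' t' => s'.arr = s.arr ∧ (∀ x < 62, s'.reg x = s.reg x) ∧
      s'.reg 62 = prevOcc S y R ∧ t' ≤ t + 60 * (Nat.log 2 S.length + 1)) s t := by
  obtain ⟨hlen, hletter, hfirst, hcount, hocc⟩ := hT
  have hlin := linear_lt hW
  have hf := hfirst y
  have hcn : S.count y ≤ S.length := List.count_le_length
  have hidx : ∀ j, j ≤ S.count y → s.arr 2 y * (S.length + 1) + j < W := fun j hj =>
    mul_add_lt hW (by omega) (by omega) (by omega)
  have hl := Nat.lt_pow_succ_log_self (b := 2) (by norm_num) S.length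
  generalize Nat.log 2 S.length = l at *
  unfold prevOccProg
  simp only [wp_seq, wp_assign]
  simp [hy, hlen, hcount]
  refine ⟨⟨by omega, by simpa using hidx 0 (by omega)⟩, by omega, ?_⟩
  refine wp_loop (fun m s' t' => s'.arr = s.arr ∧ (∀ x < 62, s'.reg x = s.reg x) ∧
    s'.reg 66 = s.arr 2 y * (S.length + 1) ∧ s'.reg 63 ≤ s'.reg 64 ∧ s'.reg 64 ≤ S.count y ∧
    (s'.reg 63 = 0 ∨ occFn S y (s'.reg 63) < R) ∧
    (∀ i, s'.reg 64 < i → i ≤ S.count y → R ≤ occFn S y i) ∧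
    s'.reg 64 - s'.reg 63 < 2 ^ m ∧ m ≤ l + 1 ∧ t' + m * 24 ≤ t + 24 * (l + 1) + 20) ?_
    (m := l + 1) ?_
  · rintro m s' t' ⟨h1, h2, h3, h4, h5, h6, h7, h8, hm, h9⟩
    refine ⟨by simp; split_ifs <;> omega, fun hv => ?_, fun hv => ?_⟩
    · have hlt : s'.reg 63 < s'.reg 64 := by
        by_contra h; simp [h] at hv
      obtain ⟨m, rfl⟩ : ∃ j, m = j + 1 := ⟨m - 1, by
        rcases m with _ | m
        · simp at h8; omega
        · omega⟩
      have hmid : s'.reg 63 < (s'.reg 63 + s'.reg 64 + 1) / 2 := by omega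
      have hmid' : (s'.reg 63 + s'.reg 64 + 1) / 2 ≤ s'.reg 64 := by omega
      have hp : 2 ^ (m + 1) = 2 * 2 ^ m := by ring
      generalize hM : (s'.reg 63 + s'.reg 64 + 1) / 2 = M at *
      have hI := hidx M (by omega)
      have hread := hocc y M (by omega)
      simp only [wp_seq, wp_assign, wp_cond]
      simp [h1, h2, h3, hM, hR, hread]
      refine ⟨⟨⟨by omega, by omega⟩, by omega, by omega⟩, ⟨by omega, by split_ifs <;> omega⟩,
        fun hlt' => ?_, fun hge => ⟨⟨by omega, by omega⟩, ?_⟩⟩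
      · refine ⟨m, by omega, ?_, by omega, by omega, Or.inr hlt', h7, by omega, by omega, by omega⟩
        intro x hx
        rw [if_neg (by omega), if_neg (by omega), h2 x hx]
      · refine ⟨m, by omega, ?_, by omega, by omega, h6, ?_, by omega, by omega, by omega⟩
        · intro x hx
          rw [if_neg (by omega), if_neg (by omega), h2 x hx]
        · intro i hi hi'
          rcases Nat.lt_or_ge M i with h | h
          · exact hge.trans (occFn_lt h hi').le
          · obtain rfl : i = M := by omega
            exact hge
    · have heq : s'.reg 63 = s'.reg 64 := by
        by_contra h
        have : s'.reg 63 < s'.reg 64 := by omega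
        simp [this] at hv
      have hI := hidx (s'.reg 63) (by omega)
      have hread := hocc y (s'.reg 63) (by omega)
      simp [h1, h3, hread]
      refine ⟨hI, ?_, ?_, by omega⟩
      · intro x hx
        rw [if_neg (by omega), h2 x hx]
      · rw [prevOcc_eq_occFn (by omega) h6 (by rwa [heq])]
  · simp
    refine ⟨?_, ?_, by omega, by omega⟩
    · intro x hx
      rw [if_neg (by omega), if_neg (by omega), if_neg (by omega)]
    · intro i hi hi'; omega

end WordRAM

namespace WordRAM
open KRep

/-- The stack of the letters of `D`, the last letter at the bottom, together with the positions at
which the rightmost embeddings of the suffixes of `D` before `E i` start. -/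
structure Stack (k : ℕ) (S : List ℕ) (E : ℕ → ℕ) (D : List ℕ) (s : State) : Prop where
  depth : s.reg 40 = D.length
  letter : ∀ c D', (c :: D') <:+ D → s.arr 12 (D'.length + 1) = c
  bound : ∀ D', D' <:+ D → ∀ i, 1 ≤ i → i ≤ k →
    s.arr 13 (D'.length * (k + 1) + i) = rightmost S D' (E i)

theorem Stack.congr {k : ℕ} {S : List ℕ} {E E' : ℕ → ℕ} {D : List ℕ} {s s' : State}
    (h : Stack k S E D s) (hr : s'.reg 40 = s.reg 40) (h12 : s'.arr 12 = s.arr 12)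
    (h13 : s'.arr 13 = s.arr 13) (hE : ∀ i, 1 ≤ i → i ≤ k → E i = E' i) :
    Stack k S E' D s' := by
  obtain ⟨a, b, c⟩ := h
  constructor
  · rwa [hr]
  · rwa [h12]
  · intro D' hD i hi hk
    rw [h13, c D' hD i hi hk, hE i hi hk]

theorem Stack.pop {k : ℕ} {S : List ℕ} {E : ℕ → ℕ} {D : List ℕ} {y : ℕ} {s s' : State}
    (h : Stack k S E (y :: D) s) (hr : s'.reg 40 = D.length) (h12 : s'.arr 12 = s.arr 12)
    (h13 : s'.arr 13 = s.arr 13) : Stack k S E D s' := by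
  obtain ⟨a, b, c⟩ := h
  refine ⟨hr, fun c' D' hD => ?_, fun D' hD => ?_⟩
  · rw [h12]; exact b c' D' (hD.trans (List.suffix_cons _ _))
  · rw [h13]; exact c D' (hD.trans (List.suffix_cons _ _))

/-- Row `40` of the table in array `13` is extended to the letter in register `41`; register `42`
stays nonzero if the new entries exceed those in array `9`. -/
def pushProg : Program :=
  .assign 50 (.lit 1) ;;
  .loop (.reg 50 <ₑ .reg 0 +ₑ .lit 1)
    (.assign 61 (.read 13 (.reg 40 *ₑ (.reg 0 +ₑ .lit 1) +ₑ .reg 50)) ;;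
      prevOccProg ;;
      .write 13 ((.reg 40 +ₑ .lit 1) *ₑ (.reg 0 +ₑ .lit 1) +ₑ .reg 50) (.reg 62) ;;
      .assign 42 (.reg 42 *ₑ (.read 9 (.reg 50) <ₑ .reg 62)) ;;
      .assign 50 (.reg 50 +ₑ .lit 1)) ;;
  .write 12 (.reg 40 +ₑ .lit 1) (.reg 41)

theorem wp_pushProg {W k : ℕ} {S D : List ℕ} {E : ℕ → ℕ} {s : State} {t y : ℕ}
    (hT : Tables S s) (hW : (S.length + 3) * (S.length + 3) ≤ W) (hk : s.reg 0 = k)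
    (hkn : k ≤ S.length) (hD : D.length ≤ S.length) (hS : Stack k S E D s)
    (hy : s.reg 41 = y) (hb : s.reg 42 ≤ 1) :
    wp W pushProg (fun s' t' => (∀ a, a ≠ 12 → a ≠ 13 → s'.arr a = s.arr a) ∧
      (∀ x < 50, x ≠ 42 → s'.reg x = s.reg x) ∧
      Stack k S E D s' ∧ Stack k S E (y :: D) (s'.setReg 40 (D.length + 1)) ∧
      s'.reg 42 ≤ 1 ∧ (s'.reg 42 ≠ 0 ↔ s.reg 42 ≠ 0 ∧
        ∀ i, 1 ≤ i → i ≤ k → s.arr 9 i < prevOcc S y (rightmost S D (E i))) ∧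
      t' ≤ t + (k + 1) * (100 * (Nat.log 2 S.length + 1))) s t := by
  have hlin := linear_lt hW
  have hd := hS.depth
  generalize hl : Nat.log 2 S.length = l
  unfold pushProg
  simp only [wp_seq, wp_assign]
  simp only [Expr.Fits, Expr.val, Expr.cost]
  refine ⟨by omega, ?_⟩
  refine wp_for k (60 * (l + 1) + 34) (fun j s' =>
    (∀ a, a ≠ 12 → a ≠ 13 → s'.arr a = s.arr a) ∧ s'.arr 12 = s.arr 12 ∧
    (∀ x < 50, x ≠ 42 → s'.reg x = s.reg x) ∧
    (∀ i, i ≤ (D.length + 1) * (k + 1) → s'.arr 13 i = s.arr 13 i) ∧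
    (∀ i, 1 ≤ i → i ≤ j → s'.arr 13 ((D.length + 1) * (k + 1) + i) =
      prevOcc S y (rightmost S D (E i))) ∧
    s'.reg 50 = j + 1 ∧ s'.reg 42 ≤ 1 ∧ (s'.reg 42 ≠ 0 ↔ s.reg 42 ≠ 0 ∧
        ∀ i, 1 ≤ i → i ≤ j → s.arr 9 i < prevOcc S y (rightmost S D (E i)))) ?_ ?_ ?_ ?_
  · rintro j s' t hj ⟨h1, h2, h3, h4, h5, h6, h7, h8⟩
    have hT' : Tables S s' := hT.congr (h3 2 (by omega) (by omega)) (h1 0 (by omega) (by omega))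
      (h1 2 (by omega) (by omega)) (h1 3 (by omega) (by omega)) (h1 4 (by omega) (by omega))
    have e0 := h3 0 (by omega) (by omega)
    have e40 := h3 40 (by omega) (by omega)
    have e41 := h3 41 (by omega) (by omega)
    have e2 := h3 2 (by omega) (by omega)
    have e9 := h1 9 (by omega) (by omega)
    have hm1 := mul_add_lt (a := D.length) (b := k + 1) (c := j + 1) hW (by omega) (by omega)
      (by omega)
    have hm2 := mul_add_lt (a := D.length + 1) (b := k + 1) (c := j + 1) hW (by omega) (by omega)
      (by omega)
    have hrow : s'.arr 13 (D.length * (k + 1) + (j + 1)) = rightmost S D (E (j + 1)) := by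
      rw [h4 _ (by rw [Nat.add_mul]; omega)]
      exact hS.bound D List.suffix_rfl (j + 1) (by omega) (by omega)
    simp only [wp_seq, wp_assign]
    simp [e0, e40, h6, hk, hd, hrow]
    refine ⟨⟨by omega, by split_ifs <;> omega⟩, hj, ⟨by omega, by omega⟩, ?_⟩
    refine wp.mono (wp_prevOccProg (S := S) (y := y) (R := rightmost S D (E (j + 1)))
      ?_ hW ?_ ?_) ?_
    · exact hT'.congr (by simp) rfl rfl rfl rfl
    · simp [e41, hy]
    · simp
    rintro s'' t'' ⟨g1, g2, g3, g4⟩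
    rw [hl] at g4
    have f : ∀ x < 61, s''.reg x = s'.reg x := fun x hx => by
      rw [g2 x (by omega)]; simp; omega
    simp [f 0, f 40, f 42, f 50, e0, e40, h6, hk, hd, g1, g3, e9]
    refine ⟨⟨⟨by omega, by omega, by omega⟩, by omega⟩,
      ⟨by split_ifs <;> omega, by split_ifs <;> omega⟩,
      ⟨by omega, by omega⟩, ⟨?_, h2, ?_, ?_, ?_, ?_, ?_⟩, by omega⟩
    · intro a ha1 ha2
      rw [if_neg ha2, h1 a ha1 ha2]
    · intro x hx hx'
      rw [if_neg (by omega), if_neg (by omega), f x (by omega), h3 x hx hx']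
    · intro i hi
      rw [Function.update_of_ne (by omega), h4 i hi]
    · intro i hi hi'
      rcases Nat.lt_or_ge j i with h | h
      · obtain rfl : i = j + 1 := by omega
        simp
      · rw [Function.update_of_ne (by omega), h5 i hi h]
    · split_ifs <;> omega
    · rw [← Ne.eq_def, ← Ne.eq_def, h8]
      constructor
      · rintro ⟨h9, h10, h11⟩
        refine ⟨h10, fun i hi hi' => ?_⟩
        rcases Nat.lt_or_ge j i with h | h
        · obtain rfl : i = j + 1 := by omega
          exact h9
        · exact h11 i hi h
      · rintro ⟨h9, h10⟩
        exact ⟨h10 _ (by omega) (by omega), h9, fun i hi hi' => h10 i hi (by omega)⟩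
  · rintro s' ⟨h1, h2, h3, h4, h5, h6, h7, h8⟩
    have e0 := h3 0 (by omega) (by omega)
    simp [e0, hk, h6]
    omega
  · simp
    refine ⟨fun x hx hx' => by omega, fun i hi hi' => by omega, hb, fun h i hi hi' => by omega⟩
  · rintro s' t' ⟨h1, h2, h3, h4, h5, h6, h7, h8⟩ ht
    have e40 := h3 40 (by omega) (by omega)
    have e41 := h3 41 (by omega) (by omega)
    simp [e40, hd, e41, hy, h2]
    simp only [Expr.cost] at ht
    have hnd : ∀ D', D' <:+ D → D' ≠ D → D'.length + 1 ≤ D.length := fun D' h hne => by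
      have h9 := h.length_le
      rcases h9.eq_or_lt with h9 | h9
      · exact absurd (h.eq_of_length h9) hne
      · exact h9
    have hlet : ∀ c D', (c :: D') <:+ D → Function.update (s.arr 12) (D.length + 1) y
        (D'.length + 1) = c := fun c D' h => by
      have := h.length_le
      rw [List.length_cons] at this
      rw [Function.update_of_ne (by omega), hS.letter c D' h]
    have hbd : ∀ D', D' <:+ D → ∀ i, 1 ≤ i → i ≤ k →
        s'.arr 13 (D'.length * (k + 1) + i) = rightmost S D' (E i) := fun D' h i hi hk' => by
      have h9 : D'.length * (k + 1) ≤ D.length * (k + 1) := Nat.mul_le_mul_right _ h.length_le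
      rw [h4 _ (by rw [Nat.add_mul]; omega), hS.bound D' h i hi hk']
    refine ⟨⟨by omega, by omega⟩, ?_, fun x hx hx' => h3 x hx hx', ?_, ?_, h7, ?_, ?_⟩
    · intro a ha1 ha2
      rw [if_neg ha1, h1 a ha1 ha2]
    · exact ⟨by simpa using e40.trans hd, by simpa [h2] using hlet, by simpa using hbd⟩
    · refine ⟨by simp, fun c D' h => ?_, fun D' h i hi hk' => ?_⟩
      · rcases List.suffix_cons_iff.1 h with h | h
        · obtain ⟨rfl, rfl⟩ := List.cons.inj h
          simp
        · simpa [h2] using hlet c D' h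
      · rcases List.suffix_cons_iff.1 h with rfl | h
        · simpa using h5 i hi hk'
        · simpa using hbd D' h i hi hk'
    · simpa using h8
    · nlinarith

/-- The first entries of an array are the letters of `C`. -/
def Holds (f : ℕ → ℕ) (C : List ℕ) : Prop := ∀ j (h : j < C.length), f j = C[j]

/-- The stack is filled with the string in array `a`, whose length is in register `l`; register `42`
is nonzero at the end if the string fits into all blocks. -/
def initProg (a l : ℕ) : Program :=
  .assign 40 (.lit 0) ;; .assign 42 (.lit 1) ;; .assign 30 (.lit 1) ;;
  .loop (.reg 30 <ₑ .reg 0 +ₑ .lit 1)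
    (.write 13 (.reg 30) (.read 10 (.reg 30)) ;;
      .assign 42 (.reg 42 *ₑ (.read 9 (.reg 30) <ₑ .read 10 (.reg 30))) ;;
      .assign 30 (.reg 30 +ₑ .lit 1)) ;;
  .assign 30 (.reg l) ;;
  .loop (.lit 0 <ₑ .reg 30)
    (.assign 30 (.reg 30 -ₑ .lit 1) ;;
      .assign 41 (.read a (.reg 30)) ;;
      pushProg ;;
      .assign 40 (.reg 40 +ₑ .lit 1))

theorem wp_initProg {W k a l : ℕ} {S C : List ℕ} {s : State} {t : ℕ}
    (hT : Tables S s) (hW : (S.length + 3) * (S.length + 3) ≤ W) (hk : s.reg 0 = k)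
    (hkn : k ≤ S.length) (hC : C.length ≤ S.length) (ha : a ≠ 12) (ha' : a ≠ 13) (hl : l < 30)
    (hCl : s.reg l = C.length) (hCa : Holds (s.arr a) C) :
    wp W (initProg a l) (fun s' t' => (∀ a, a ≠ 12 → a ≠ 13 → s'.arr a = s.arr a) ∧
      (∀ x < 30, s'.reg x = s.reg x) ∧ Stack k S (s.arr 10) C s' ∧
      (s'.reg 42 ≠ 0 ↔ ∀ i, 1 ≤ i → i ≤ k → s.arr 9 i < rightmost S C (s.arr 10 i)) ∧
      t' ≤ t + (C.length + 1) * ((k + 1) * (150 * (Nat.log 2 S.length + 1)))) s t := by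
  have hlin := linear_lt hW
  generalize hlog : Nat.log 2 S.length = l'
  unfold initProg
  simp only [wp_seq, wp_assign]
  simp only [Expr.Fits, Expr.val, Expr.cost]
  refine ⟨by omega, by omega, by omega, ?_⟩
  refine wp_for k 19 (fun j s' =>
    (∀ a, a ≠ 12 → a ≠ 13 → s'.arr a = s.arr a) ∧
    (∀ x < 30, s'.reg x = s.reg x) ∧ s'.reg 40 = 0 ∧
    (∀ i, 1 ≤ i → i ≤ j → s'.arr 13 i = s.arr 10 i) ∧
    s'.reg 30 = j + 1 ∧ s'.reg 42 ≤ 1 ∧ (s'.reg 42 ≠ 0 ↔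
        ∀ i, 1 ≤ i → i ≤ j → s.arr 9 i < s.arr 10 i)) ?_ ?_ ?_ ?_
  · rintro j s' t hj ⟨h1, h2, h3, h4, h5, h6, h7⟩
    have e0 := h2 0 (by omega)
    have e9 := h1 9 (by omega) (by omega)
    have e10 := h1 10 (by omega) (by omega)
    simp [e0, hk, h5, e9, e10, h3]
    refine ⟨⟨by omega, by split_ifs <;> omega⟩, hj,
      ⟨by split_ifs <;> omega, by split_ifs <;> omega⟩, ⟨by omega, by omega⟩, ?_, ?_, ?_, ?_, ?_⟩
    · intro a ha1 ha2
      rw [if_neg ha2, h1 a ha1 ha2]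
    · intro x hx
      rw [if_neg (by omega), if_neg (by omega), h2 x hx]
    · intro i hi hi'
      rcases Nat.lt_or_ge j i with h | h
      · obtain rfl : i = j + 1 := by omega
        simp
      · rw [Function.update_of_ne (by omega), h4 i hi h]
    · split_ifs <;> omega
    · rw [← Ne.eq_def, h7]
      constructor
      · rintro ⟨h9, h11⟩ i hi hi'
        rcases Nat.lt_or_ge j i with h | h
        · obtain rfl : i = j + 1 := by omega
          exact h9
        · exact h11 i hi h
      · intro h10
        exact ⟨h10 _ (by omega) (by omega), fun i hi hi' => h10 i hi (by omega)⟩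
  · rintro s' ⟨h1, h2, h3, h4, h5, h6, h7⟩
    have e0 := h2 0 (by omega)
    simp [e0, hk, h5]
    omega
  · simp
    refine ⟨fun x hx => by rw [if_neg (by omega), if_neg (by omega), if_neg (by omega)],
      fun i hi hi' => by omega, fun i hi hi' => by omega⟩
  rintro s₁ t₁ ⟨h1, h2, h3, h4, h5, h6, h7⟩ ht
  simp only [Expr.cost] at ht
  simp only [h2 l hl, hCl]
  refine ⟨trivial, ?_⟩
  refine wp_for C.length ((k + 1) * (100 * (l' + 1)) + 12) (fun j s' =>
    (∀ a, a ≠ 12 → a ≠ 13 → s'.arr a = s.arr a) ∧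
    (∀ x < 30, s'.reg x = s.reg x) ∧ s'.reg 30 = C.length - j ∧
    Stack k S (s.arr 10) (C.drop (C.length - j)) s' ∧ s'.reg 42 ≤ 1 ∧ (s'.reg 42 ≠ 0 ↔
        ∀ i, 1 ≤ i → i ≤ k → s.arr 9 i < rightmost S (C.drop (C.length - j)) (s.arr 10 i)))
    ?_ ?_ ?_ ?_
  · rintro j s' t hj ⟨h1, h2, h3, h4, h5, h6⟩
    obtain ⟨m, hm⟩ : ∃ m, C.length - j = m + 1 := ⟨C.length - j - 1, by omega⟩
    have hm' : C.length - (j + 1) = m := by omega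
    have hmC : m < C.length := by omega
    have hdrop : C.drop m = C[m] :: C.drop (m + 1) := List.drop_eq_getElem_cons hmC
    rw [hm] at h3 h4 h6
    rw [hm', hdrop]
    have e2 := h2 2 (by omega)
    have e0 := h2 0 (by omega)
    simp only [wp_seq, wp_assign]
    simp [h3, h1 a ha ha', hCa m hmC]
    refine ⟨by omega, by omega, ?_⟩
    refine wp.mono (wp_pushProg (S := S) (y := C[m]) (k := k) (E := s.arr 10)
      (D := C.drop (m + 1)) ?_ hW ?_ hkn ?_ ?_ ?_ ?_) ?_
    · exact hT.congr (by simp [e2]) (by simp [h1]) (by simp [h1]) (by simp [h1]) (by simp [h1])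
    · simp [e0, hk]
    · simp; omega
    · exact h4.congr (by simp) rfl rfl fun _ _ _ => rfl
    · simp
    · simpa using h5
    rintro s'' t'' ⟨g1, g2, g3, g4, g5, g6, g7⟩
    rw [hlog] at g7
    have e40 := g3.depth
    simp at e40
    have e30 := g2 30 (by omega) (by omega)
    simp at e30
    simp [e40]
    refine ⟨⟨by omega, by omega⟩, ⟨?_, ?_, ?_, ?_, g5, ?_⟩, by omega⟩
    · intro a ha1 ha2
      rw [g1 a ha1 ha2]; simp [h1 a ha1 ha2]
    · intro x hx
      rw [if_neg (by omega), g2 x (by omega) (by omega)]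
      simp
      rw [if_neg (by omega), if_neg (by omega), h2 x hx]
    · omega
    · simpa using g4
    · have g6' := g6
      simp only [State.setReg_arr, State.setReg_reg] at g6'
      simp only [Nat.reduceEqDiff, if_false, ne_eq] at g6'
      rw [g6', ← Ne.eq_def, h6, h1 9 (by omega) (by omega), hdrop]
      simp only [rightmost_cons]
      refine ⟨fun h => h.2, fun h => ⟨fun i hi hi' => ?_, h⟩⟩
      obtain ⟨p, q1, q2, -⟩ := lt_prevOcc_iff.1 (h i hi hi')
      omega
  · rintro s' ⟨h1, h2, h3, h4, h5, h6⟩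
    simp [h3]; omega
  · refine ⟨by simpa using h1, ?_, by simp, ?_, by simpa using h6, ?_⟩
    · intro x hx
      simp
      rw [if_neg (by omega), h2 x hx]
    · refine ⟨by simp [h3], ?_, ?_⟩
      · intro c D' h
        simp at h
      · intro D' h i hi hi'
        simp at h
        subst h
        simpa using h4 i hi hi'
    · simpa using h7
  · rintro s' t' ⟨h1, h2, h3, h4, h5, h6⟩ ht'
    simp only [Expr.cost] at ht'
    rw [Nat.sub_self, List.drop_zero] at h4 h6
    refine ⟨h1, h2, h4, h6, ?_⟩
    have e1 : (k + 1) * (100 * (l' + 1)) = 100 * ((k + 1) * (l' + 1)) := by ring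
    have e2 : (k + 1) * (150 * (l' + 1)) = 150 * ((k + 1) * (l' + 1)) := by ring
    have e3 : k + 1 ≤ (k + 1) * (l' + 1) := Nat.le_mul_of_pos_right _ (by omega)
    rw [e1] at ht'
    rw [e2]
    generalize (k + 1) * (l' + 1) = P at *
    have e4 : C.length ≤ C.length * P := Nat.le_mul_of_pos_right _ (by omega)
    rw [Nat.mul_add, Nat.mul_add, Nat.mul_add] at ht'
    have e5 : C.length * (100 * P) = 100 * (C.length * P) := by ring
    have e6 : (C.length + 1) * (150 * P) = 150 * (C.length * P) + 150 * P := by ring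
    omega

end WordRAM

namespace WordRAM
open KRep

/-- The next unread letter of block number `20` is read and, if possible, prepended to the string on
the stack. -/
def scanProg : Program :=
  .assign 22 (.read 11 (.reg 20) +ₑ .lit 1) ;;
  .cond ((.reg 22 <ₑ .read 10 (.reg 20)) *ₑ (.lit 1 -ₑ (.lit 0 <ₑ .reg 40) *ₑ
      (.read 0 (.reg 22 -ₑ .lit 1) =ₑ .read 12 (.reg 40))))
    (.assign 41 (.read 0 (.reg 22 -ₑ .lit 1)) ;;
      .assign 42 (.lit 1) ;;
      pushProg ;;
      .cond (.reg 42) (.assign 40 (.reg 40 +ₑ .lit 1) ;; .assign 20 (.lit 1))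
        (.write 11 (.reg 20) (.reg 22)))
    (.assign 20 (.reg 20 +ₑ .lit 1))

/-- The top letter of the stack is moved to the output, and all blocks are cut after it. -/
def popProg (a l : ℕ) : Program :=
  .write a (.reg l) (.read 12 (.reg 40)) ;;
  .assign l (.reg l +ₑ .lit 1) ;;
  .assign 40 (.reg 40 -ₑ .lit 1) ;;
  .assign 20 (.lit 1) ;;
  .loop (.reg 20 <ₑ .reg 0 +ₑ .lit 1)
    (.write 11 (.reg 20) (.read 11 (.reg 20) +ₑ .lit 1) ;;
      .write 9 (.reg 20) (.read 11 (.reg 20)) ;;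
      .assign 20 (.reg 20 +ₑ .lit 1)) ;;
  .assign 20 (.lit 1)

/-- The string on the stack is extended to a maximal common subsequence of the blocks, which is
written to array `a`, and its length to register `l`. -/
def mcsProg (a l : ℕ) : Program :=
  .assign l (.lit 0) ;;
  .assign 22 (.lit 1) ;;
  .loop (.reg 22 <ₑ .reg 0 +ₑ .lit 1)
    (.write 11 (.reg 22) (.read 9 (.reg 22)) ;; .assign 22 (.reg 22 +ₑ .lit 1)) ;;
  .assign 20 (.lit 1) ;;
  .assign 21 (.lit 1) ;;
  .loop (.reg 21)
    (.cond (.reg 20 <ₑ .reg 0 +ₑ .lit 1) scanProg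
      (.cond (.lit 0 <ₑ .reg 40) (popProg a l) (.assign 21 (.lit 0))))

/-- The invariant of the main loop: `O` has been output, `D` is on the stack, and `Zt` is the string
to be computed. -/
structure MCSInv (k : ℕ) (S : List ℕ) (E L₀ : ℕ → ℕ) (Zt : List ℕ) (a l : ℕ) (s₀ : State)
    (D O : List ℕ) (s : State) : Prop where
  arr : ∀ b, b ≠ a → b ≠ 9 → b ≠ 11 → b ≠ 12 → b ≠ 13 → s.arr b = s₀.arr b
  reg : ∀ x < 20, x ≠ l → s.reg x = s₀.reg x
  stack : Stack k S E D s
  scanned : Scanned k S (s.arr 9) E D (s.arr 11)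
  run : ∃ Z, MCSRun (blocks k S (s.arr 9) E) D Z ∧ O ++ Z = Zt
  len : s.reg l = O.length
  holds : Holds (s.arr a) O
  next : ∀ i, 1 ≤ i → i ≤ k → nextPt S O (L₀ i) = some (s.arr 9 i)

section
variable {W k a l : ℕ} {S : List ℕ} {E L₀ : ℕ → ℕ} {Zt D O : List ℕ} {s₀ s : State}

theorem wp_scanProg {i t : ℕ} (hT : Tables S s₀) (hW : (S.length + 3) * (S.length + 3) ≤ W)
    (hk : s₀.reg 0 = k) (hkn : k ≤ S.length) (hE : s₀.arr 10 = E)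
    (hEn : ∀ i, 1 ≤ i → i ≤ k → E i ≤ S.length + 1) (ha : 4 < a) (ha' : a < 9)
    (hl : 3 < l) (hl' : l < 20) (hI : MCSInv k S E L₀ Zt a l s₀ D O s) (hi : s.reg 20 = i)
    (hi1 : 1 ≤ i) (hik : i ≤ k) (hlim : ∀ j, 1 ≤ j → j < i → AtLimit S E D (s.arr 11) j) :
    wp W scanProg (fun s' t' => s'.reg 21 = s.reg 21 ∧
      t' ≤ t + (k + 1) * (200 * (Nat.log 2 S.length + 1)) ∧
      ((∃ y, MCSInv k S E L₀ Zt a l s₀ (y :: D) O s' ∧ s'.reg 20 = 1 ∧ s'.arr 11 = s.arr 11) ∨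
        (MCSInv k S E L₀ Zt a l s₀ D O s' ∧ s'.reg 20 = i ∧ s.arr 11 i + 1 < E i ∧
          s'.arr 11 = Function.update (s.arr 11) i (s.arr 11 i + 1)) ∨
        (MCSInv k S E L₀ Zt a l s₀ D O s' ∧ s'.reg 20 = i + 1 ∧ s'.arr 11 = s.arr 11 ∧
          AtLimit S E D (s.arr 11) i))) s t := by
  have hlin := linear_lt hW
  obtain ⟨harr, hreg, hst, hsc, ⟨Z, hrun, hOZ⟩, hlen, hholds, hnext⟩ := hI
  have e2 := hreg 2 (by omega) (by omega)
  have e0 := hreg 0 (by omega) (by omega)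
  have hT' : Tables S s := hT.congr e2
    (harr 0 (by omega) (by omega) (by omega) (by omega) (by omega))
    (harr 2 (by omega) (by omega) (by omega) (by omega) (by omega))
    (harr 3 (by omega) (by omega) (by omega) (by omega) (by omega))
    (harr 4 (by omega) (by omega) (by omega) (by omega) (by omega))
  have e10 : s.arr 10 = E := by
    rw [← hE]; exact harr 10 (by omega) (by omega) (by omega) (by omega) (by omega)
  have hend := hsc.lt_end hi1 hik
  have hEi := hEn i hi1 hik
  have hPL : 1 ≤ (k + 1) * (Nat.log 2 S.length + 1) := Nat.mul_pos (by omega) (by omega)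
  have ePL : (k + 1) * (200 * (Nat.log 2 S.length + 1)) =
    200 * ((k + 1) * (Nat.log 2 S.length + 1)) := by ring
  have ePL' : (k + 1) * (100 * (Nat.log 2 S.length + 1)) =
    100 * ((k + 1) * (Nat.log 2 S.length + 1)) := by ring
  rw [ePL]
  generalize hP : (k + 1) * (Nat.log 2 S.length + 1) = P at *
  unfold scanProg
  simp only [wp_seq, wp_assign, wp_cond]
  simp only [Expr.Fits, Expr.val, Expr.cost, State.setReg_reg, State.setReg_arr, hi, e10, hst.depth,
    BinOp.apply_add, BinOp.apply_sub, BinOp.apply_lt, BinOp.apply_eq, BinOp.apply_mul]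
  simp only [Nat.reduceEqDiff, if_true, if_false, Nat.add_sub_cancel]
  generalize hx : s.arr 11 i = x at *
  refine ⟨⟨trivial, by omega, by omega⟩, ⟨⟨trivial, trivial, by split_ifs <;> omega⟩, ⟨by omega,
    ⟨⟨by omega, trivial, by split_ifs <;> omega⟩, ⟨⟨trivial, by omega, by omega⟩, trivial,
      by split_ifs <;> omega⟩, ?_⟩, ?_⟩, ?_⟩, fun hne => ?_, fun heq => ?_⟩
  · split_ifs <;> omega
  · generalize (if 0 < D.length then 1 else 0) *
      (if s.arr 0 x = s.arr 12 D.length then 1 else 0) = u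
    omega
  · generalize (if 0 < D.length then 1 else 0) *
      (if s.arr 0 x = s.arr 12 D.length then 1 else 0) = u
    split_ifs <;> omega
  · have hxE : x + 1 < E i := by
      by_contra h; simp [h] at hne
    have hnt : ¬ (0 < D.length ∧ s.arr 0 x = s.arr 12 D.length) := by
      rintro ⟨h1, h2⟩; simp [h1, h2] at hne
    obtain ⟨y, hy⟩ := exists_at (S := S) (p := x + 1) (by omega) (by omega)
    have hy0 : s.arr 0 x = y := hT'.letter _ _ hy
    have hyD : D.head? ≠ some y := by
      rcases D with _ | ⟨c, D⟩
      · simp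
      · have hc := hst.letter c D List.suffix_rfl
        intro h
        obtain rfl : c = y := by simpa using h
        exact hnt ⟨by simp, by rw [hy0, List.length_cons, hc]⟩
    refine ⟨⟨trivial, by omega, by omega⟩, by omega, ?_⟩
    refine wp.mono (wp_pushProg (S := S) (y := y) (k := k) (E := E) (D := D) ?_ hW ?_ hkn ?_ ?_
      ?_ ?_) ?_
    · exact hT'.congr (by simp) rfl rfl rfl rfl
    · simp [e0, hk]
    · omega
    · exact hst.congr (by simp) rfl rfl fun _ _ _ => rfl
    · simpa using hy0
    · simp
    rintro s' t' ⟨g1, g2, g3, g4, g5, g6, g7⟩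
    simp only [State.setReg_reg, State.setReg_arr] at g1 g2 g6
    have f20 := g2 20 (by omega) (by omega)
    have f21 := g2 21 (by omega) (by omega)
    have f22 := g2 22 (by omega) (by omega)
    simp [hi] at f20 f21 f22
    rw [ePL'] at g7
    have hav : s'.reg 42 ≠ 0 ↔
        ∀ i, 1 ≤ i → i ≤ k → s.arr 9 i < prevOcc S y (rightmost S D (E i)) := by
      rw [g6]; simp
    have harr' : ∀ b, b ≠ a → b ≠ 9 → b ≠ 11 → b ≠ 12 → b ≠ 13 → s'.arr b = s₀.arr b :=
      fun b h1 h2 h3 h4 h5 => (g1 b h4 h5).trans (harr b h1 h2 h3 h4 h5)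
    have hreg' : ∀ x < 20, s'.reg x = s.reg x := fun x hx => by
      rw [g2 x (by omega) (by omega), if_neg (by omega), if_neg (by omega), if_neg (by omega)]
    have f9 := g1 9 (by omega) (by omega)
    have f11 := g1 11 (by omega) (by omega)
    have fa := g1 a (by omega) (by omega)
    simp only [wp_write, Expr.Fits, Expr.val, Expr.cost, g3.depth]
    refine ⟨trivial, fun h42 => ⟨⟨trivial, by omega, by omega⟩, by omega, f21, by omega,
      Or.inl ⟨y, ?_, trivial, f11⟩⟩, fun h42 => ⟨trivial, trivial, f21, by omega,
      Or.inr (Or.inl ?_)⟩⟩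
    · have h1 := hav.1 h42
      refine ⟨harr', ?_, ?_, ?_, ?_, ?_, ?_, ?_⟩
      · intro z hz hzl
        simp only [State.setReg_reg]
        rw [if_neg (by omega), if_neg (by omega), hreg' z hz, hreg z hz hzl]
      · exact g4.congr (by simp) rfl rfl fun _ _ _ => rfl
      · simp only [State.setReg_arr, f9, f11]
        exact hsc.push h1
      · simp only [State.setReg_arr, f9]
        exact ⟨Z, MCSRun.of_push hrun (hsc.candidate_eq_some hi1 hik hlim (by omega)
          (by rwa [hx]) hyD h1), hOZ⟩
      · simp only [State.setReg_reg]
        rw [if_neg (by omega), if_neg (by omega), hreg' l hl', hlen]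
      · simpa only [State.setReg_arr, fa] using hholds
      · simpa only [State.setReg_arr, f9] using hnext
    · have h1 : ∃ j, 1 ≤ j ∧ j ≤ k ∧ prevOcc S y (rightmost S D (E j)) ≤ s.arr 9 j := by
        by_contra hn
        refine hav.2 (fun j hj hjk => ?_) h42
        by_contra hlt
        exact hn ⟨j, hj, hjk, not_lt.1 hlt⟩
      refine ⟨⟨?_, ?_, ?_, ?_, ?_, ?_, ?_, ?_⟩, f20, hxE, ?_⟩
      · intro b h1 h2 h3 h4 h5
        simp only [State.setArr_arr]
        rw [if_neg h3, harr' b h1 h2 h3 h4 h5]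
      · intro z hz hzl
        simp only [State.setArr_reg]
        rw [hreg' z hz, hreg z hz hzl]
      · exact g3.congr rfl (by simp) (by simp) fun _ _ _ => rfl
      · simp only [State.setArr_arr, Nat.reduceEqDiff, if_true, if_false, f9, f11, f20, f22]
        have h2 := hsc.advance hi1 hik (by omega) (by rwa [hx]) hyD h1
        rwa [hx] at h2
      · simp only [State.setArr_arr, Nat.reduceEqDiff, if_false, f9]
        exact ⟨Z, hrun, hOZ⟩
      · simp only [State.setArr_reg]
        rw [hreg' l hl', hlen]
      · simp only [State.setArr_arr]
        rw [if_neg (by omega), fa]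
        exact hholds
      · simp only [State.setArr_arr, Nat.reduceEqDiff, if_false, f9]
        exact hnext
      · simp only [State.setArr_arr, if_true, f11, f20, f22]
  · refine ⟨⟨trivial, by omega, by omega⟩, trivial, by omega, Or.inr (Or.inr ⟨?_, trivial,
      trivial, ?_⟩)⟩
    · refine ⟨harr, ?_, ?_, hsc, ⟨Z, hrun, hOZ⟩, ?_, hholds, hnext⟩
      · intro z hz hzl
        simp only [State.setReg_reg]
        rw [if_neg (by omega), if_neg (by omega), hreg z hz hzl]
      · exact hst.congr (by simp) rfl rfl fun _ _ _ => rfl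
      · simp only [State.setReg_reg]
        rw [if_neg (by omega), if_neg (by omega), hlen]
    · by_cases hxE : x + 1 < E i
      · right
        have hnt : 0 < D.length ∧ s.arr 0 x = s.arr 12 D.length := by
          by_contra h
          rw [if_pos hxE, Nat.one_mul] at heq
          by_cases h1 : 0 < D.length
          · by_cases h2 : s.arr 0 x = s.arr 12 D.length
            · exact h ⟨h1, h2⟩
            · simp [h2] at heq
          · simp [h1] at heq
        obtain ⟨y, hy⟩ := exists_at (S := S) (p := x + 1) (by omega) (by omega)
        have hy0 : s.arr 0 x = y := hT'.letter _ _ hy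
        rcases D with _ | ⟨c, D⟩
        · simp at hnt
        · have hc := hst.letter c D List.suffix_rfl
          refine ⟨c, rfl, ?_⟩
          rw [hx, ← hc, ← List.length_cons, ← hnt.2, hy0]
          exact hy
      · left; omega

theorem wp_popProg {t w : ℕ} (hW : (S.length + 3) * (S.length + 3) ≤ W)
    (hk : s₀.reg 0 = k) (hk0 : 0 < k) (hkn : k ≤ S.length)
    (hEn : ∀ i, 1 ≤ i → i ≤ k → E i ≤ S.length + 1) (ha : 4 < a) (ha' : a < 9)
    (hl : 3 < l) (hl' : l < 20) (hZt : Zt.length ≤ S.length)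
    (hI : MCSInv k S E L₀ Zt a l s₀ (w :: D) O s)
    (hlim : ∀ j, 1 ≤ j → j ≤ k → AtLimit S E (w :: D) (s.arr 11) j) :
    wp W (popProg a l) (fun s' t' => s'.reg 21 = s.reg 21 ∧ t' ≤ t + (k + 1) * 60 ∧
      MCSInv k S E L₀ Zt a l s₀ D (O ++ [w]) s' ∧ s'.reg 20 = 1 ∧
      ∀ i, 1 ≤ i → i ≤ k → s'.arr 11 i = s.arr 11 i + 1) s t := by
  have hlin := linear_lt hW
  obtain ⟨harr, hreg, hst, hsc, ⟨Z, hrun, hOZ⟩, hlen, hholds, hnext⟩ := hI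
  obtain ⟨Z, rfl, hrun'⟩ := MCSRun.of_pop hrun (hsc.candidate_eq_none hlim)
  have e0 := hreg 0 (by omega) (by omega)
  have hOn : O.length + 1 ≤ S.length := by
    rw [← hOZ, List.length_append, List.length_cons] at hZt
    omega
  have hDn : D.length + 1 ≤ S.length := by
    have h1 := hsc.lt_end le_rfl hk0
    have h2 := hEn 1 le_rfl hk0
    rw [List.length_cons] at h1
    omega
  have hd := hst.depth
  have hw := hst.letter w D List.suffix_rfl
  rw [List.length_cons] at hd
  have n9 : 9 ≠ a := by omega
  have n11 : 11 ≠ a := by omega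
  have n12 : 12 ≠ a := by omega
  have n13 : 13 ≠ a := by omega
  have n20 : 20 ≠ l := by omega
  have n21 : 21 ≠ l := by omega
  have n40 : 40 ≠ l := by omega
  have nl0 : 0 ≠ l := by omega
  unfold popProg
  simp only [wp_seq, wp_assign, wp_write]
  simp only [Expr.Fits, Expr.val, Expr.cost, State.setReg_reg, State.setReg_arr, State.setArr_reg,
    BinOp.apply_add, BinOp.apply_sub, if_neg n40, hlen, hd, hw, Nat.add_sub_cancel, if_true]
  refine ⟨trivial, trivial, ⟨trivial, by omega, by omega⟩, ⟨trivial, by omega, by omega⟩,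
    by omega, ?_⟩
  refine wp_for k 20 (fun j s' =>
    (∀ b, b ≠ a → b ≠ 9 → b ≠ 11 → s'.arr b = s.arr b) ∧
    s'.arr a = Function.update (s.arr a) O.length w ∧
    (∀ x < 50, x ≠ l → x ≠ 20 → x ≠ 40 → s'.reg x = s.reg x) ∧
    s'.reg l = O.length + 1 ∧ s'.reg 40 = D.length ∧
    (∀ i, 1 ≤ i → i ≤ j → s'.arr 11 i = s.arr 11 i + 1 ∧ s'.arr 9 i = s.arr 11 i + 1) ∧
    (∀ i, j < i → s'.arr 11 i = s.arr 11 i) ∧ s'.reg 20 = j + 1) ?_ ?_ ?_ ?_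
  · rintro j s' t hj ⟨h1, h2, h3, h4, h5, h6, h7, h8⟩
    have f0 := h3 0 (by omega) nl0 (by omega) (by omega)
    have hx := hsc.lt_end (i := j + 1) (by omega) (by omega)
    have hEj := hEn (j + 1) (by omega) (by omega)
    have h7' := h7 (j + 1) (by omega)
    simp [f0, e0, hk, h8, h7']
    refine ⟨⟨by omega, by split_ifs <;> omega⟩, hj, ⟨by omega, by omega⟩, ⟨by omega, by omega⟩,
      ?_, ?_, ?_, ?_, h5, ?_, ?_⟩
    · intro b hb hb9 hb11
      rw [if_neg hb9, if_neg hb11, h1 b hb hb9 hb11]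
    · rw [if_neg n9.symm, if_neg n11.symm, h2]
    · intro x hx hxl hx20 hx40
      rw [if_neg hx20, h3 x hx hxl hx20 hx40]
    · rw [if_neg n20.symm, h4]
    · intro i hi hi'
      rcases Nat.lt_or_ge j i with h | h
      · obtain rfl : i = j + 1 := by omega
        simp
      · rw [Function.update_of_ne (by omega), Function.update_of_ne (by omega)]
        exact h6 i hi h
    · intro i hi
      rw [Function.update_of_ne (by omega), h7 i (by omega)]
  · rintro s' ⟨h1, h2, h3, h4, h5, h6, h7, h8⟩
    have f0 := h3 0 (by omega) nl0 (by omega) (by omega)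
    simp [f0, e0, hk, h8]
    omega
  · refine ⟨?_, by simp, ?_, by simp [n20.symm, n40.symm], by simp, fun i hi hi' => by omega,
      by simp [n11], by simp⟩
    · intro b hb hb9 hb11
      simp [hb]
    · intro x hx hxl hx20 hx40
      simp [hx20, hxl, hx40]
  · rintro s' t' ⟨h1, h2, h3, h4, h5, h6, h7, h8⟩ ht
    simp only [Expr.cost] at ht
    refine ⟨by omega, ?_, by omega, ⟨?_, ?_, ?_, ?_, ?_, ?_, ?_, ?_⟩, by simp, fun i hi hik => ?_⟩
    · simpa using h3 21 (by omega) n21 (by omega) (by omega)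
    · intro b hb hb9 hb11 hb12 hb13
      rw [State.setReg_arr, h1 b hb hb9 hb11, harr b hb hb9 hb11 hb12 hb13]
    · intro x hx hxl
      rw [State.setReg_reg, if_neg (by omega), h3 x (by omega) hxl (by omega) (by omega),
        hreg x hx hxl]
    · exact hst.pop (by simpa using h5) (h1 12 n12 (by omega) (by omega))
        (h1 13 n13 (by omega) (by omega))
    · have h9 := hsc.pop
      refine ⟨fun i hi hik => ?_, fun i hi hik => ?_, fun i hi hik p c q1 q2 => ?_,
        fun i hi hik p c q1 q2 => ?_⟩
      all_goals simp only [State.setReg_arr, h6 i hi hik] at *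
      · exact le_rfl
      · exact h9.lt i hi hik
      · omega
      · omega
    · refine ⟨Z, ?_, by simpa using hOZ⟩
      rw [hsc.map_dropThrough hlim] at hrun'
      rwa [blocks_congr (L' := fun i => s.arr 11 i + 1) (E' := E) fun i hi hik =>
        ⟨by rw [State.setReg_arr, (h6 i hi hik).2], rfl⟩]
    · rw [State.setReg_reg, if_neg n20.symm, h4, List.length_append, List.length_singleton]
    · intro j hj
      rw [List.length_append, List.length_singleton] at hj
      rw [State.setReg_arr, h2]
      rcases Nat.lt_or_ge j O.length with h | h
      · rw [Function.update_of_ne (by omega), List.getElem_append_left h, hholds j h]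
      · obtain rfl : j = O.length := by omega
        simp
    · intro i hi hik
      rw [State.setReg_arr, (h6 i hi hik).2]
      exact hsc.nextPt_step hi hik (hlim i hi hik) (hnext i hi hik)
    · exact (h6 i hi hik).1

/-- The number of letters in the blocks that have not been scanned. -/
def unscanned (k : ℕ) (E s : ℕ → ℕ) : ℕ := ∑ i ∈ Finset.Icc 1 k, (E i - s i)

theorem unscanned_update {s : ℕ → ℕ} {i : ℕ} (hi : 1 ≤ i) (hik : i ≤ k) (h : s i + 1 < E i) :
    unscanned k E (Function.update s i (s i + 1)) + 1 = unscanned k E s := by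
  unfold unscanned
  have hmem : i ∈ Finset.Icc 1 k := Finset.mem_Icc.2 ⟨hi, hik⟩
  rw [← Finset.add_sum_erase _ _ hmem, ← Finset.add_sum_erase _ _ hmem, Function.update_self]
  have : ∑ j ∈ (Finset.Icc 1 k).erase i, (E j - Function.update s i (s i + 1) j) =
      ∑ j ∈ (Finset.Icc 1 k).erase i, (E j - s j) :=
    Finset.sum_congr rfl fun j hj => by rw [Function.update_of_ne (Finset.ne_of_mem_erase hj)]
  omega

theorem unscanned_succ {s s' : ℕ → ℕ} (h : ∀ i, 1 ≤ i → i ≤ k → s' i = s i + 1 ∧ s i < E i) :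
    unscanned k E s' + k = unscanned k E s := by
  unfold unscanned
  have : ∑ i ∈ Finset.Icc 1 k, (E i - s i) = ∑ i ∈ Finset.Icc 1 k, ((E i - s' i) + 1) :=
    Finset.sum_congr rfl fun i hi => by
      rw [Finset.mem_Icc] at hi
      have := h i hi.1 hi.2
      omega
  rw [this, Finset.sum_add_distrib]
  simp

theorem mul_length_le_unscanned {L s : ℕ → ℕ} (h : Scanned k S L E D s) :
    k * D.length ≤ unscanned k E s := by
  have : ∑ _i ∈ Finset.Icc 1 k, D.length ≤ unscanned k E s :=
    Finset.sum_le_sum fun i hi => by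
      rw [Finset.mem_Icc] at hi
      have := h.lt_end hi.1 hi.2
      omega
  simpa using this

theorem wp_mcsProg {t : ℕ} {C : List ℕ} (hT : Tables S s)
    (hW : (S.length + 3) * (S.length + 3) ≤ W) (hk : s.reg 0 = k) (hk0 : 0 < k)
    (hkn : k ≤ S.length) (hEn : ∀ i, 1 ≤ i → i ≤ k → s.arr 10 i ≤ S.length + 1)
    (ha : 4 < a) (ha' : a < 9) (hl : 3 < l) (hl' : l < 20) (hst : Stack k S (s.arr 10) C s)
    (hfit : ∀ i, 1 ≤ i → i ≤ k → s.arr 9 i < rightmost S C (s.arr 10 i))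
    (hsum : unscanned k (s.arr 10) (s.arr 9) ≤ S.length + 1)
    (hZt : mcs (blocks k S (s.arr 9) (s.arr 10)) C = Zt) :
    wp W (mcsProg a l) (fun s' t' =>
      (∀ b, b ≠ a → b ≠ 9 → b ≠ 11 → b ≠ 12 → b ≠ 13 → s'.arr b = s.arr b) ∧
      (∀ x < 20, x ≠ l → s'.reg x = s.reg x) ∧ s'.reg l = Zt.length ∧ Holds (s'.arr a) Zt ∧
      (∀ i, 1 ≤ i → i ≤ k → nextPt S Zt (s.arr 9 i) = some (s'.arr 9 i)) ∧
      t' ≤ t + S.length * ((k + 1) * (4000 * (Nat.log 2 S.length + 1)))) s t := by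
  have hlin := linear_lt hW
  have hsc₀ := Scanned.init hfit
  have hne : blocks k S (s.arr 9) (s.arr 10) ≠ [] := by simp [blocks]; omega
  have hC : ∀ U ∈ blocks k S (s.arr 9) (s.arr 10), C.Sublist U := by
    intro U hU
    obtain ⟨i, hi, hik, rfl⟩ := mem_blocks.1 hU
    exact (sublist_between_iff ((hfit i hi hik).trans_le rightmost_le)).2 (hfit i hi hik)
  have hrun := mcsRun_mcs hne hC
  rw [hZt] at hrun
  have hZlen : Zt.length ≤ S.length := by
    have h1 := (hrun.spec hne hC).2.1 _ (mem_blocks.2 ⟨1, le_rfl, hk0, rfl⟩)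
    have h2 := h1.length_le.trans length_between_le
    have := hEn 1 le_rfl hk0
    omega
  generalize hE : s.arr 10 = E at *
  have hPL : k + 1 ≤ (k + 1) * (Nat.log 2 S.length + 1) := Nat.le_mul_of_pos_right _ (by omega)
  have ePL : (k + 1) * (200 * (Nat.log 2 S.length + 1)) =
    200 * ((k + 1) * (Nat.log 2 S.length + 1)) := by ring
  have ePL' : (k + 1) * (4000 * (Nat.log 2 S.length + 1)) =
    4000 * ((k + 1) * (Nat.log 2 S.length + 1)) := by ring
  rw [ePL']
  have n0 : 0 ≠ l := by omega
  unfold mcsProg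
  simp only [wp_seq, wp_assign]
  simp only [Expr.Fits, Expr.val, Expr.cost]
  refine ⟨by omega, by omega, ?_⟩
  refine wp_for k 10 (fun j s' => (∀ b, b ≠ 11 → s'.arr b = s.arr b) ∧
    (∀ x < 50, x ≠ l → x ≠ 22 → s'.reg x = s.reg x) ∧ s'.reg l = 0 ∧ s'.reg 22 = j + 1 ∧
    ∀ i, 1 ≤ i → i ≤ j → s'.arr 11 i = s.arr 9 i) ?_ ?_ ?_ ?_
  · rintro j s' t hj ⟨h1, h2, h3, h4, h5⟩
    have f0 := h2 0 (by omega) n0 (by omega)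
    have f9 := h1 9 (by omega)
    simp [f0, hk, h4, f9]
    refine ⟨⟨by omega, by split_ifs <;> omega⟩, hj, ⟨by omega, by omega⟩, ?_, ?_, ?_, ?_⟩
    · intro b hb
      rw [if_neg hb, h1 b hb]
    · intro x hx hxl hx22
      rw [if_neg hx22, h2 x hx hxl hx22]
    · rw [if_neg (by omega), h3]
    · intro i hi hi'
      rcases Nat.lt_or_ge j i with h | h
      · obtain rfl : i = j + 1 := by omega
        simp
      · rw [Function.update_of_ne (by omega)]
        exact h5 i hi h
  · rintro s' ⟨h1, h2, h3, h4, h5⟩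
    have f0 := h2 0 (by omega) n0 (by omega)
    simp [f0, hk, h4]
    omega
  · refine ⟨by simp, ?_, ?_, by simp, fun i hi hi' => by omega⟩
    · intro x hx hxl hx22
      simp [hxl, hx22]
    · simp only [State.setReg_reg]
      rw [if_neg (by omega), if_pos trivial]
  rintro s₁ t₁ ⟨h1, h2, h3, h4, h5⟩ ht₁
  simp only [Expr.cost] at ht₁
  refine ⟨by omega, by omega, ?_⟩
  generalize hP : (k + 1) * (Nat.log 2 S.length + 1) = P at *
  have hI₀ : MCSInv k S E (s.arr 9) Zt a l s C [] ((s₁.setReg 20 1).setReg 21 1) := by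
    refine ⟨fun b _ _ hb _ _ => h1 b hb, fun x hx hxl => ?_, ?_, ?_, ⟨Zt, ?_, rfl⟩, ?_, ?_, ?_⟩
    · simp only [State.setReg_reg]
      rw [if_neg (by omega), if_neg (by omega), h2 x (by omega) hxl (by omega)]
    · exact hst.congr (by simpa using h2 40 (by omega) (by omega) (by omega))
        (h1 12 (by omega)) (h1 13 (by omega)) fun _ _ _ => rfl
    · simp only [State.setReg_arr, h1 9 (by omega)]
      refine ⟨fun i hi hik => by rw [h5 i hi hik],
        fun i hi hik => by rw [h5 i hi hik]; exact hfit i hi hik,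
        fun i hi hik p c q1 q2 => ?_, fun i hi hik p c q1 q2 => ?_⟩ <;>
      · rw [h5 i hi hik] at q2
        omega
    · simpa only [State.setReg_arr, h1 9 (by omega)] using hrun
    · simp only [State.setReg_reg]
      rw [if_neg (by omega), if_neg (by omega), h3]
      rfl
    · intro j hj
      simp at hj
    · intro i hi hik
      simp only [State.setReg_arr, h1 9 (by omega), nextPt_nil]
  have hsum' : unscanned k E (((s₁.setReg 20 1).setReg 21 1).arr 11) ≤ S.length + 1 := by
    refine le_trans (le_of_eq (Finset.sum_congr rfl fun i hi => ?_)) hsum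
    rw [Finset.mem_Icc] at hi
    rw [State.setReg_arr, State.setReg_arr, h5 i hi.1 hi.2]
  have hb₀ := mul_length_le_unscanned hI₀.scanned
  refine wp_loop (fun m s' t' => t' + m * (260 * P) ≤ t₁ + 4 +
      (4 * (S.length + 1) + k + 1) * (260 * P) ∧
    ((s'.reg 21 = 1 ∧ ∃ D O, MCSInv k S E (s.arr 9) Zt a l s D O s' ∧
      1 ≤ s'.reg 20 ∧ s'.reg 20 ≤ k + 1 ∧
      (∀ j, 1 ≤ j → j < s'.reg 20 → AtLimit S E D (s'.arr 11) j) ∧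
      m + 2 * (k * D.length) + s'.reg 20 = 4 * unscanned k E (s'.arr 11) + k + 2) ∨
    (s'.reg 21 = 0 ∧ MCSInv k S E (s.arr 9) Zt a l s [] Zt s'))) ?_
    (m := 4 * unscanned k E (((s₁.setReg 20 1).setReg 21 1).arr 11) + k + 1 -
      2 * (k * C.length)) ⟨?_, Or.inl ⟨by simp, C, [], hI₀, by simp, by simp, ?_, ?_⟩⟩
  · rintro m s' t' ⟨hm, ⟨h21, D, O, hI, hi1, hik, hlim, hpot⟩ | ⟨h21, hI⟩⟩
    · have hstep : ∀ m' t'', m' < m → t'' ≤ t' + 260 * P → t'' + m' * (260 * P) ≤ t₁ + 4 +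
          (4 * (S.length + 1) + k + 1) * (260 * P) := by
        intro m' t'' h h'
        have : (m' + 1) * (260 * P) ≤ m * (260 * P) := Nat.mul_le_mul_right _ h
        rw [Nat.add_mul, Nat.one_mul] at this
        omega
      refine ⟨trivial, fun _ => ?_, fun h => by simp [h21] at h⟩
      have f0 := hI.reg 0 (by omega) n0
      have f40 := hI.stack.depth
      simp only [wp_cond]
      simp only [Expr.Fits, Expr.val, Expr.cost, f0, hk, BinOp.apply_add, BinOp.apply_lt]
      refine ⟨⟨trivial, ⟨trivial, by omega, by omega⟩, by split_ifs <;> omega⟩, fun hv => ?_,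
        fun hv => ⟨⟨by omega, trivial, by split_ifs <;> omega⟩, fun hv' => ?_, fun hv' => ?_⟩⟩
      · have hik' : s'.reg 20 ≤ k := by
          by_contra h
          rw [if_neg (by omega)] at hv
          exact hv rfl
        refine wp.mono (wp_scanProg hT hW hk hkn hE hEn ha ha' hl hl' hI rfl hi1 hik' hlim) ?_
        rintro s'' t'' ⟨g1, g2, g3⟩
        rw [ePL] at g2
        rcases g3 with ⟨y, g3, g4, g5⟩ | ⟨g3, g4, g5, g6⟩ | ⟨g3, g4, g5, g6⟩
        · have hb := mul_length_le_unscanned g3.scanned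
          rw [g5, List.length_cons, Nat.mul_add, Nat.mul_one] at hb
          refine ⟨4 * unscanned k E (s'.arr 11) + k + 1 - 2 * (k * D.length + k), by omega,
            hstep _ _ (by omega) (by omega), Or.inl ⟨by omega, y :: D, O, g3, by omega, by omega,
            fun j hj hj' => by omega, ?_⟩⟩
          have e : k * (D.length + 1) = k * D.length + k := Nat.mul_succ _ _
          rw [g4, g5, List.length_cons, e]
          omega
        · have hb := mul_length_le_unscanned g3.scanned
          have hu := unscanned_update (E := E) hi1 hik' g5
          rw [g6] at hb
          refine ⟨m - 4, by omega, hstep _ _ (by omega) (by omega), Or.inl ⟨by omega, D, O, g3,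
            by omega, by omega, fun j hj hj' => ?_, ?_⟩⟩
          · rw [g4] at hj'
            have := hlim j hj hj'
            unfold AtLimit at this ⊢
            rwa [g6, Function.update_of_ne (by omega)]
          · rw [g4, g6]
            omega
        · have hb := mul_length_le_unscanned hI.scanned
          refine ⟨m - 1, by omega, hstep _ _ (by omega) (by omega), Or.inl ⟨by omega, D, O, g3,
            by omega, by omega, fun j hj hj' => ?_, ?_⟩⟩
          · rw [g5]
            rcases Nat.lt_or_ge j (s'.reg 20) with h | h
            · exact hlim j hj h
            · obtain rfl : j = s'.reg 20 := by omega
              exact g6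
          · rw [g4, g5]
            omega
      · have hik' : s'.reg 20 = k + 1 := by
          by_contra h
          rw [if_pos (by omega)] at hv
          omega
        rcases D with _ | ⟨w, D⟩
        · simp [f40] at hv'
        refine wp.mono (wp_popProg hW hk hk0 hkn hEn ha ha' hl hl' hZlen hI
          fun j hj hjk => hlim j hj (by omega)) ?_
        rintro s'' t'' ⟨g1, g2, g3, g4, g5⟩
        have hb := mul_length_le_unscanned g3.scanned
        have hu := unscanned_succ (E := E) (s := s'.arr 11) (s' := s''.arr 11) fun i hi hik =>
          ⟨g5 i hi hik, by have := hI.scanned.lt_end hi hik; omega⟩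
        rw [List.length_cons, Nat.mul_add, Nat.mul_one] at hpot
        exact ⟨m - k, by omega, hstep _ _ (by omega) (by omega), Or.inl ⟨by omega, D, _, g3,
          by omega, by omega, fun j hj hj' => by omega, by rw [g4]; omega⟩⟩
      · have hik' : s'.reg 20 = k + 1 := by
          by_contra h
          rw [if_pos (by omega)] at hv
          omega
        have hD : D = [] := by
          rw [← List.length_eq_zero_iff]
          by_contra h
          rw [if_pos (by omega)] at hv'
          omega
        subst hD
        have hlim' : ∀ j, 1 ≤ j → j ≤ k → AtLimit S E [] (s'.arr 11) j := fun j hj hjk =>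
          hlim j hj (by omega)
        simp only [wp_assign, Expr.Fits, Expr.val, Expr.cost]
        refine ⟨by omega, 0, by omega, hstep _ _ (by omega) (by omega), Or.inr ⟨by simp, ?_⟩⟩
        obtain ⟨i1, i2, i3, i4, ⟨Z, i5, i6⟩, i7, i8, i9⟩ := hI
        obtain rfl := i5.of_done (i4.candidate_eq_none hlim')
        rw [List.append_nil] at i6
        subst i6
        refine ⟨i1, fun x hx hxl => ?_, i3.congr (by simp) rfl rfl fun _ _ _ => rfl, i4,
          ⟨[], i5, by simp⟩, ?_, i8, i9⟩
        · rw [State.setReg_reg, if_neg (by omega), i2 x hx hxl]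
        · rw [State.setReg_reg, if_neg (by omega), i7]
    · refine ⟨trivial, fun h => absurd h21 h, fun _ => ⟨hI.arr, hI.reg, hI.len, hI.holds,
        hI.next, ?_⟩⟩
      simp only [Expr.cost]
      have e1 : (4 * (S.length + 1) + k + 1) * (260 * P) ≤ (10 * S.length) * (260 * P) :=
        Nat.mul_le_mul_right _ (by omega)
      have e2 : (10 * S.length) * (260 * P) = 2600 * (S.length * P) := by ring
      have e3 : S.length * (4000 * P) = 4000 * (S.length * P) := by ring
      have e4 : P ≤ S.length * P := Nat.le_mul_of_pos_left _ (by omega)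
      omega
  · have := Nat.mul_le_mul_right (260 * P) (show 4 * unscanned k E
      (((s₁.setReg 20 1).setReg 21 1).arr 11) + k + 1 - 2 * (k * C.length) ≤
      4 * (S.length + 1) + k + 1 by omega)
    omega
  · intro j hj hj'
    simp at hj'
    omega
  · simp only [State.setReg_reg, Nat.reduceEqDiff, if_false, if_true]
    omega

end

end WordRAM

namespace WordRAM
open KRep

/-- The positions of the current tuple are written to array `8`; the block of the tuple's `i`-th
position is everything before it. -/
def positionsProg : Program :=
  .assign 10 (.read 2 (.reg 1) *ₑ (.reg 2 +ₑ .lit 1)) ;;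
  .assign 9 (.lit 1) ;;
  .loop (.reg 9 <ₑ .reg 0 +ₑ .lit 1)
    (.write 8 (.reg 9) (.read 4 (.reg 10 +ₑ
        ((.reg 9 -ₑ .lit 1) *ₑ .reg 7 +ₑ .read 7 (.reg 9) +ₑ .lit 1))) ;;
      .write 9 (.reg 9) (.lit 0) ;;
      .write 10 (.reg 9) (.read 8 (.reg 9)) ;;
      .assign 9 (.reg 9 +ₑ .lit 1))

/-- The bounds of the right blocks are written to arrays `9` and `10`. -/
def rightProg : Program :=
  .assign 9 (.lit 1) ;;
  .loop (.reg 9 <ₑ .reg 0)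
    (.write 10 (.reg 9) (.read 13 (.reg 40 *ₑ (.reg 0 +ₑ .lit 1) +ₑ (.reg 9 +ₑ .lit 1))) ;;
      .write 9 (.reg 9) (.read 8 (.reg 9)) ;;
      .assign 9 (.reg 9 +ₑ .lit 1)) ;;
  .write 10 (.reg 0) (.reg 2 +ₑ .lit 1) ;;
  .write 9 (.reg 0) (.read 8 (.reg 0))

/-- The bounds of the left blocks are written to arrays `9` and `10`. -/
def leftProg : Program :=
  .assign 9 (.reg 0) ;;
  .loop (.lit 0 <ₑ .reg 9)
    (.write 9 (.reg 9) (.read 9 (.reg 9 -ₑ .lit 1)) ;;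
      .write 10 (.reg 9) (.read 8 (.reg 9)) ;;
      .assign 9 (.reg 9 -ₑ .lit 1)) ;;
  .write 9 (.lit 1) (.lit 0)

/-- The body of the main loop of the algorithm. -/
def stepProg : Program :=
  positionsProg ;;
  initProg 5 4 ;;
  .cond (.reg 42)
    (rightProg ;;
      initProg 6 5 ;;
      .cond (.reg 42) (mcsProg 6 5 ;; leftProg ;; initProg 5 4 ;; mcsProg 5 4) .skip)
    .skip

section
variable {W k σ r : ℕ} {S A B : List ℕ} {s : State} {t : ℕ}

theorem wp_positionsProg (hT : Tables S s) (hW : (S.length + 3) * (S.length + 3) ≤ W)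
    (hk : s.reg 0 = k) (hkn : k ≤ S.length) (hσ : s.reg 1 = σ) (hr : s.reg 7 = r)
    (hidx : ∀ i, 1 ≤ i → i ≤ k → (i - 1) * r + s.arr 7 i + 1 ≤ S.count σ) :
    wp W positionsProg (fun s' t' => (∀ b, b ≠ 8 → b ≠ 9 → b ≠ 10 → s'.arr b = s.arr b) ∧
      (∀ x, x ≠ 9 → x ≠ 10 → s'.reg x = s.reg x) ∧
      (∀ i, 1 ≤ i → i ≤ k → s'.arr 8 i = occFn S σ ((i - 1) * r + s.arr 7 i + 1) ∧ s'.arr 9 i = 0 ∧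
        s'.arr 10 i = s'.arr 8 i) ∧ t' ≤ t + (k + 1) * 60) s t := by
  have hlin := linear_lt hW
  have hf := hT.first σ
  have hcn : S.count σ ≤ S.length := List.count_le_length
  have hm0 := mul_add_lt (a := s.arr 2 σ) (b := S.length + 1) (c := 0) hW (by omega) (by omega)
    (by omega)
  unfold positionsProg
  simp only [wp_seq, wp_assign]
  simp only [Expr.Fits, Expr.val, Expr.cost, hσ, hT.len, BinOp.apply_add, BinOp.apply_mul]
  refine ⟨⟨trivial, ⟨trivial, by omega, by omega⟩, by omega⟩, by omega, ?_⟩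
  refine wp_for k 34 (fun j s' => (∀ b, b ≠ 8 → b ≠ 9 → b ≠ 10 → s'.arr b = s.arr b) ∧
    (∀ x, x ≠ 9 → x ≠ 10 → s'.reg x = s.reg x) ∧ s'.reg 9 = j + 1 ∧
    s'.reg 10 = s.arr 2 σ * (S.length + 1) ∧
    ∀ i, 1 ≤ i → i ≤ j → s'.arr 8 i = occFn S σ ((i - 1) * r + s.arr 7 i + 1) ∧ s'.arr 9 i = 0 ∧
        s'.arr 10 i = s'.arr 8 i) ?_ ?_ ?_ ?_
  · rintro j s' t hj ⟨h1, h2, h3, h4, h5⟩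
    have f0 := h2 0 (by omega) (by omega)
    have f7 := h2 7 (by omega) (by omega)
    have g4 := h1 4 (by omega) (by omega) (by omega)
    have g7 := h1 7 (by omega) (by omega) (by omega)
    have hj' := hidx (j + 1) (by omega) (by omega)
    rw [Nat.add_sub_cancel] at hj'
    have hm := mul_add_lt (a := s.arr 2 σ) (b := S.length + 1)
      (c := j * r + s.arr 7 (j + 1) + 1) hW (by omega) (by omega) (by omega)
    have ho := hT.occ σ (j * r + s.arr 7 (j + 1) + 1) hj'
    simp [f0, f7, h3, h4, hk, hr, g4, g7, ho]
    generalize hjr : j * r = jr at *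
    generalize s.arr 2 σ * (S.length + 1) = u at *
    refine ⟨⟨by omega, by split_ifs <;> omega⟩, hj, ⟨?_, by omega⟩, by omega, ⟨by omega, by omega⟩,
      ?_, ?_, ?_⟩
    · and_intros <;> omega
    · intro b hb8 hb9 hb10
      rw [if_neg hb10, if_neg hb9, if_neg hb8, h1 b hb8 hb9 hb10]
    · intro x hx9 hx10
      rw [if_neg hx9, h2 x hx9 hx10]
    · intro i hi hi'
      rcases Nat.lt_or_ge j i with h | h
      · obtain rfl : i = j + 1 := by omega
        simp [hjr]
      · have hne : i ≠ j + 1 := by omega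
        simp only [Function.update_of_ne hne]
        exact h5 i hi h
  · rintro s' ⟨h1, h2, h3, h4, h5⟩
    have f0 := h2 0 (by omega) (by omega)
    simp [f0, hk, h3]
    omega
  · refine ⟨by simp, fun x hx9 hx10 => by simp [hx9, hx10], by simp, by simp,
      fun i hi hi' => by omega⟩
  · rintro s' t' ⟨h1, h2, h3, h4, h5⟩ ht
    simp only [Expr.cost] at ht
    exact ⟨h1, h2, h5, by omega⟩

theorem wp_rightProg {p : ℕ → ℕ} (hlen : s.reg 2 = S.length)
    (hW : (S.length + 3) * (S.length + 3) ≤ W)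
    (hk : s.reg 0 = k) (hk0 : 0 < k) (hkn : k ≤ S.length) (hA : A.length ≤ S.length)
    (hp : ∀ i, 1 ≤ i → i ≤ k → s.arr 8 i = p i) (hst : Stack k S p A s) :
    wp W rightProg (fun s' t' => (∀ b, b ≠ 9 → b ≠ 10 → s'.arr b = s.arr b) ∧
      (∀ x, x ≠ 9 → s'.reg x = s.reg x) ∧
      (∀ i, 1 ≤ i → i ≤ k → s'.arr 9 i = p i ∧ s'.arr 10 i = blockEnd k S A p i) ∧
      t' ≤ t + (k + 1) * 60) s t := by
  have hlin := linear_lt hW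
  have hd := hst.depth
  unfold rightProg
  simp only [wp_seq, wp_assign]
  simp only [Expr.Fits, Expr.val, Expr.cost]
  refine ⟨by omega, ?_⟩
  refine wp_for (k - 1) 30 (fun j s' => (∀ b, b ≠ 9 → b ≠ 10 → s'.arr b = s.arr b) ∧
    (∀ x, x ≠ 9 → s'.reg x = s.reg x) ∧ s'.reg 9 = j + 1 ∧
    ∀ i, 1 ≤ i → i ≤ j → s'.arr 9 i = p i ∧ s'.arr 10 i = rightmost S A (p (i + 1))) ?_ ?_ ?_ ?_
  · rintro j s' t hj ⟨h1, h2, h3, h4⟩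
    have f0 := h2 0 (by omega)
    have f40 := h2 40 (by omega)
    have g8 := h1 8 (by omega) (by omega)
    have g13 := h1 13 (by omega) (by omega)
    have hm := mul_add_lt (a := A.length) (b := k + 1) (c := j + 1 + 1) hW (by omega) (by omega)
      (by omega)
    have hb := hst.bound A List.suffix_rfl (j + 1 + 1) (by omega) (by omega)
    simp [f0, f40, h3, hk, hd, g8, g13, hb, hp (j + 1) (by omega) (by omega)]
    generalize A.length * (k + 1) = u at *
    refine ⟨by split_ifs <;> omega, by omega, ?_, ⟨by omega, by omega⟩, ?_, ?_, ?_⟩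
    · and_intros <;> omega
    · intro b hb9 hb10
      rw [if_neg hb9, if_neg hb10, h1 b hb9 hb10]
    · intro x hx9
      rw [if_neg hx9, h2 x hx9]
    · intro i hi hi'
      rcases Nat.lt_or_ge j i with h | h
      · obtain rfl : i = j + 1 := by omega
        simp
      · have hne : i ≠ j + 1 := by omega
        simp only [Function.update_of_ne hne]
        exact h4 i hi h
  · rintro s' ⟨h1, h2, h3, h4⟩
    have f0 := h2 0 (by omega)
    have hk1 : k - 1 + 1 = k := by omega
    simp [f0, hk, h3, hk1]
    omega
  · refine ⟨by simp, fun x hx9 => by simp [hx9], by simp, fun i hi hi' => by omega⟩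
  · rintro s' t' ⟨h1, h2, h3, h4⟩ ht
    have f0 := h2 0 (by omega)
    have f2 := h2 2 (by omega)
    have g8 := h1 8 (by omega) (by omega)
    simp only [Expr.cost] at ht
    simp [f0, f2, hk, hlen, g8, hp k hk0 le_rfl]
    refine ⟨⟨by omega, by omega⟩, ?_, h2, ?_, by omega⟩
    · intro b hb9 hb10
      rw [if_neg hb9, if_neg hb10, h1 b hb9 hb10]
    · intro i hi hi'
      rcases eq_or_ne i k with rfl | hne
      · simp [blockEnd]
      · simp only [Function.update_of_ne hne]
        rw [blockEnd, if_neg hne]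
        exact h4 i hi (by omega)

theorem wp_leftProg (hk : s.reg 0 = k) (hk0 : 0 < k) (hW : k + 2 ≤ W) :
    wp W leftProg (fun s' t' => (∀ b, b ≠ 9 → b ≠ 10 → s'.arr b = s.arr b) ∧
      (∀ x, x ≠ 9 → s'.reg x = s.reg x) ∧
      (∀ i, 1 ≤ i → i ≤ k → s'.arr 9 i = (if i = 1 then 0 else s.arr 9 (i - 1)) ∧
        s'.arr 10 i = s.arr 8 i) ∧ t' ≤ t + (k + 1) * 60) s t := by
  unfold leftProg
  simp only [wp_seq, wp_assign]
  simp only [Expr.Fits, Expr.val, Expr.cost]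
  refine ⟨trivial, ?_⟩
  refine wp_for k 30 (fun j s' => (∀ b, b ≠ 9 → b ≠ 10 → s'.arr b = s.arr b) ∧
    (∀ x, x ≠ 9 → s'.reg x = s.reg x) ∧ s'.reg 9 = k - j ∧
    (∀ i, i ≤ k - j → s'.arr 9 i = s.arr 9 i) ∧
    ∀ i, k - j < i → i ≤ k → s'.arr 9 i = s.arr 9 (i - 1) ∧ s'.arr 10 i = s.arr 8 i) ?_ ?_ ?_ ?_
  · rintro j s' t hj ⟨h1, h2, h3, h4, h5⟩
    obtain ⟨m, hm⟩ : ∃ m, k - j = m + 1 := ⟨k - j - 1, by omega⟩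
    have hm' : k - (j + 1) = m := by omega
    rw [hm] at h3 h4 h5
    rw [hm']
    have g8 := h1 8 (by omega) (by omega)
    simp [h3, g8, h4 m (by omega)]
    refine ⟨by omega, by omega, ?_, ?_, ?_, ?_⟩
    · intro b hb9 hb10
      rw [if_neg hb10, if_neg hb9, h1 b hb9 hb10]
    · intro x hx9
      rw [if_neg hx9, h2 x hx9]
    · intro i hi
      rw [Function.update_of_ne (by omega), h4 i (by omega)]
    · intro i hi hi'
      rcases eq_or_ne i (m + 1) with rfl | hne
      · simp
      · simp only [Function.update_of_ne hne]
        exact h5 i (by omega) hi'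
  · rintro s' ⟨h1, h2, h3, h4, h5⟩
    simp [h3]
    omega
  · refine ⟨by simp, fun x hx9 => by simp [hx9], by simp [hk], by simp, fun i hi hi' => by omega⟩
  · rintro s' t' ⟨h1, h2, h3, h4, h5⟩ ht
    simp only [Expr.cost] at ht
    simp
    refine ⟨by omega, by omega, ?_, h2, ?_, by omega⟩
    · intro b hb9 hb10
      rw [if_neg hb9, h1 b hb9 hb10]
    · intro i hi hi'
      rcases eq_or_ne i 1 with rfl | hne
      · simpa using (h5 1 (by omega) hi').2
      · simp only [Function.update_of_ne hne, if_neg hne]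
        exact h5 i (by omega) hi'

theorem unscanned_le {E L : ℕ → ℕ} {N : ℕ} (h1 : ∀ i, 1 ≤ i → i < k → E i ≤ L (i + 1))
    (h2 : ∀ i, 1 ≤ i → i ≤ k → L i ≤ E i) (h3 : ∀ i, 1 ≤ i → i ≤ k → E i ≤ N) :
    unscanned k E L ≤ N := by
  rcases Nat.eq_zero_or_pos k with rfl | hk
  · simp [unscanned]
  have : ∀ j, 1 ≤ j → j ≤ k → unscanned j E L ≤ E j := by
    intro j hj
    induction j, hj using Nat.le_induction with
    | base => intro _; simp [unscanned]
    | succ j hj ih =>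
      intro hjk
      have h4 := ih (by omega)
      have h5 := h1 j hj hjk
      have h6 := h2 (j + 1) (by omega) hjk
      unfold unscanned at h4 ⊢
      rw [Finset.sum_Icc_succ_top (by omega)]
      omega
  exact (this k hk le_rfl).trans (h3 k hk le_rfl)

/-- The data of the main loop of the algorithm. -/
structure Ctx (k : ℕ) (S : List ℕ) (σ r : ℕ) (A B : List ℕ) (s : State) : Prop where
  tables : Tables S s
  reg_k : s.reg 0 = k
  reg_σ : s.reg 1 = σ
  reg_r : s.reg 7 = r
  lenA : s.reg 4 = A.length
  lenB : s.reg 5 = B.length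
  holdsA : Holds (s.arr 5) A
  holdsB : Holds (s.arr 6) B

theorem wp_stepProg {p : ℕ → ℕ} (hC : Ctx k S σ r A B s)
    (hW : (S.length + 3) * (S.length + 3) ≤ W) (hk0 : 0 < k) (hkn : k ≤ S.length)
    (hA : A.length ≤ S.length) (hB : B.length ≤ S.length)
    (hidx : ∀ i, 1 ≤ i → i ≤ k → (i - 1) * r + s.arr 7 i + 1 ≤ S.count σ)
    (hp : ∀ i, 1 ≤ i → i ≤ k → occFn S σ ((i - 1) * r + s.arr 7 i + 1) = p i) :
    wp W stepProg (fun s' t' => Ctx k S σ r (extendStep mcs k S σ (A, B) p).1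
      (extendStep mcs k S σ (A, B) p).2 s' ∧ s'.arr 7 = s.arr 7 ∧
      (∀ x < 20, x ≠ 4 → x ≠ 5 → x ≠ 9 → x ≠ 10 → s'.reg x = s.reg x) ∧
      t' ≤ t + S.length * ((k + 1) * (10000 * (Nat.log 2 S.length + 1)))) s t := by
  have hlin := linear_lt hW
  obtain ⟨hT, hk, hσ, hr, hlA, hlB, hAh, hBh⟩ := hC
  have hat : ∀ i, 1 ≤ i → i ≤ k → At S (p i) σ := fun i hi hik => by
    rw [← hp i hi hik]
    exact at_occFn (by omega) (hidx i hi hik)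
  have hPL : k + 1 ≤ (k + 1) * (Nat.log 2 S.length + 1) := Nat.le_mul_of_pos_right _ (by omega)
  have ePL : ∀ m c, m * ((k + 1) * (c * (Nat.log 2 S.length + 1))) =
    c * (m * ((k + 1) * (Nat.log 2 S.length + 1))) := fun m c => by ring
  have hn1 : (k + 1) * (Nat.log 2 S.length + 1) ≤
    S.length * ((k + 1) * (Nat.log 2 S.length + 1)) := Nat.le_mul_of_pos_left _ (by omega)
  have hlenle : ∀ m, m ≤ S.length → (m + 1) * ((k + 1) * (Nat.log 2 S.length + 1)) ≤
    2 * (S.length * ((k + 1) * (Nat.log 2 S.length + 1))) := fun m hm => by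
      rw [← Nat.mul_assoc 2]
      exact Nat.mul_le_mul_right _ (by omega)
  have hlA' := hlenle _ hA
  have hlB' := hlenle _ hB
  have hc : (Expr.reg 42).cost = 1 := rfl
  rw [ePL]
  unfold stepProg
  simp only [wp_seq]
  refine wp.mono (wp_positionsProg hT hW hk hkn hσ hr hidx) ?_
  rintro s₁ t₁ ⟨a1, a2, a3, a4⟩
  have hT₁ : Tables S s₁ := hT.congr (a2 2 (by omega) (by omega))
    (a1 0 (by omega) (by omega) (by omega)) (a1 2 (by omega) (by omega) (by omega))
    (a1 3 (by omega) (by omega) (by omega)) (a1 4 (by omega) (by omega) (by omega))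
  have p₁ : ∀ i, 1 ≤ i → i ≤ k → s₁.arr 8 i = p i := fun i hi hik => by
    rw [(a3 i hi hik).1, hp i hi hik]
  refine wp.mono (wp_initProg (C := A) hT₁ hW ((a2 0 (by omega) (by omega)).trans hk) hkn hA
    (by omega) (by omega) (by omega) ((a2 4 (by omega) (by omega)).trans hlA)
    (by rw [a1 5 (by omega) (by omega) (by omega)]; exact hAh)) ?_
  rintro s₂ t₂ ⟨b1, b2, b3, b4, b5⟩
  rw [ePL] at b5
  have hT₂ : Tables S s₂ := hT₁.congr (b2 2 (by omega)) (b1 0 (by omega) (by omega))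
    (b1 2 (by omega) (by omega)) (b1 3 (by omega) (by omega)) (b1 4 (by omega) (by omega))
  have r₂ : ∀ x < 20, x ≠ 9 → x ≠ 10 → s₂.reg x = s.reg x := fun x hx h9 h10 =>
    (b2 x (by omega)).trans (a2 x h9 h10)
  have c₂ : ∀ b, b ≠ 8 → b ≠ 9 → b ≠ 10 → b ≠ 12 → b ≠ 13 → s₂.arr b = s.arr b :=
    fun b h8 h9 h10 h12 h13 => (b1 b h12 h13).trans (a1 b h8 h9 h10)
  have e4 : s₂.reg 42 ≠ 0 ↔ ∀ i, 1 ≤ i → i ≤ k → 0 < rightmost S A (p i) := by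
    rw [b4]
    refine forall_congr' fun i => forall_congr' fun hi => forall_congr' fun hik => ?_
    rw [(a3 i hi hik).2.2, (a3 i hi hik).2.1, p₁ i hi hik]
  simp only [wp_cond]
  refine ⟨trivial, fun h42 => ?_, fun h42 => ?_⟩
  swap
  · have hns : ¬ IsSplitPoint k S σ A B p := fun h =>
      e4.2 ((isSplitPoint_iff_rightmost hat).1 h).1 h42
    rw [extendStep_of_not hns, wp_skip]
    refine ⟨⟨hT₂, (r₂ 0 (by omega) (by omega) (by omega)).trans hk,
      (r₂ 1 (by omega) (by omega) (by omega)).trans hσ,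
      (r₂ 7 (by omega) (by omega) (by omega)).trans hr,
      (r₂ 4 (by omega) (by omega) (by omega)).trans hlA,
      (r₂ 5 (by omega) (by omega) (by omega)).trans hlB, ?_, ?_⟩,
      c₂ 7 (by omega) (by omega) (by omega) (by omega) (by omega),
      fun x hx _ _ h9 h10 => r₂ x hx h9 h10, ?_⟩
    · rw [c₂ 5 (by omega) (by omega) (by omega) (by omega) (by omega)]; exact hAh
    · rw [c₂ 6 (by omega) (by omega) (by omega) (by omega) (by omega)]; exact hBh
    · simp only [Expr.cost]
      omega
  have hpos := e4.1 h42
  simp only [wp_seq]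
  refine wp.mono (wp_rightProg (S := S) (A := A) (k := k) (p := p) (hT₂.len) hW
    ((r₂ 0 (by omega) (by omega) (by omega)).trans hk) hk0 hkn hA
    (fun i hi hik => by rw [b1 8 (by omega) (by omega), p₁ i hi hik])
    (b3.congr rfl rfl rfl fun i hi hik => by rw [(a3 i hi hik).2.2, p₁ i hi hik])) ?_
  rintro s₃ t₃ ⟨d1, d2, d3, d4⟩
  have hT₃ : Tables S s₃ := hT₂.congr (d2 2 (by omega)) (d1 0 (by omega) (by omega))
    (d1 2 (by omega) (by omega)) (d1 3 (by omega) (by omega)) (d1 4 (by omega) (by omega))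
  have r₃ : ∀ x < 20, x ≠ 9 → x ≠ 10 → s₃.reg x = s.reg x := fun x hx h9 h10 =>
    (d2 x h9).trans (r₂ x hx h9 h10)
  have c₃ : ∀ b, b ≠ 8 → b ≠ 9 → b ≠ 10 → b ≠ 12 → b ≠ 13 → s₃.arr b = s.arr b :=
    fun b h8 h9 h10 h12 h13 => (d1 b h9 h10).trans (c₂ b h8 h9 h10 h12 h13)
  refine wp.mono (wp_initProg (C := B) hT₃ hW
    ((r₃ 0 (by omega) (by omega) (by omega)).trans hk) hkn hB
    (by omega) (by omega) (by omega) ((r₃ 5 (by omega) (by omega) (by omega)).trans hlB)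
    (by rw [c₃ 6 (by omega) (by omega) (by omega) (by omega) (by omega)]; exact hBh)) ?_
  rintro s₄ t₄ ⟨f1, f2, f3, f4, f5⟩
  rw [ePL] at f5
  have hT₄ : Tables S s₄ := hT₃.congr (f2 2 (by omega)) (f1 0 (by omega) (by omega))
    (f1 2 (by omega) (by omega)) (f1 3 (by omega) (by omega)) (f1 4 (by omega) (by omega))
  have r₄ : ∀ x < 20, x ≠ 9 → x ≠ 10 → s₄.reg x = s.reg x := fun x hx h9 h10 =>
    (f2 x (by omega)).trans (r₃ x hx h9 h10)
  have c₄ : ∀ b, b ≠ 8 → b ≠ 9 → b ≠ 10 → b ≠ 12 → b ≠ 13 → s₄.arr b = s.arr b :=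
    fun b h8 h9 h10 h12 h13 => (f1 b h12 h13).trans (c₃ b h8 h9 h10 h12 h13)
  have g9 := f1 9 (by omega) (by omega)
  have g10 := f1 10 (by omega) (by omega)
  have f4' : s₄.reg 42 ≠ 0 ↔
      ∀ i, 1 ≤ i → i ≤ k → p i < rightmost S B (blockEnd k S A p i) := by
    rw [f4]
    refine forall_congr' fun i => forall_congr' fun hi => forall_congr' fun hik => ?_
    rw [(d3 i hi hik).1, (d3 i hi hik).2]
  simp only [wp_cond]
  refine ⟨trivial, fun h42 => ?_, fun h42 => ?_⟩
  swap
  · have hns : ¬ IsSplitPoint k S σ A B p := fun h =>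
      f4'.2 ((isSplitPoint_iff_rightmost hat).1 h).2 h42
    rw [extendStep_of_not hns, wp_skip]
    refine ⟨⟨hT₄, (r₄ 0 (by omega) (by omega) (by omega)).trans hk,
      (r₄ 1 (by omega) (by omega) (by omega)).trans hσ,
      (r₄ 7 (by omega) (by omega) (by omega)).trans hr,
      (r₄ 4 (by omega) (by omega) (by omega)).trans hlA,
      (r₄ 5 (by omega) (by omega) (by omega)).trans hlB, ?_, ?_⟩,
      c₄ 7 (by omega) (by omega) (by omega) (by omega) (by omega),
      fun x hx _ _ h9 h10 => r₄ x hx h9 h10, ?_⟩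
    · rw [c₄ 5 (by omega) (by omega) (by omega) (by omega) (by omega)]; exact hAh
    · rw [c₄ 6 (by omega) (by omega) (by omega) (by omega) (by omega)]; exact hBh
    · simp only [Expr.cost]
      omega
  have hfitB := f4'.1 h42
  have hsplit : IsSplitPoint k S σ A B p := (isSplitPoint_iff_rightmost hat).2 ⟨hpos, hfitB⟩
  rw [extendStep_of_isSplitPoint hsplit]
  dsimp only
  have hblocks : blocks k S (s₄.arr 9) (s₄.arr 10) = rightBlocks k S A p := by
    refine List.map_congr_left fun i hi => ?_
    rw [List.mem_range'_1] at hi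
    have hik : i ≤ k := by omega
    rw [g9, g10, (d3 i hi.1 hik).1, (d3 i hi.1 hik).2, blockEnd]
    split_ifs with h
    · rfl
    · rw [prevPt_eq_rightmost (hpos (i + 1) (by omega) (by omega))]
      rfl
  have hbe : ∀ i, 1 ≤ i → i ≤ k → blockEnd k S A p i ≤ S.length + 1 := by
    intro i hi hik
    unfold blockEnd
    split_ifs with h
    · exact le_rfl
    · have h1 := (hat (i + 1) (by omega) (by omega)).le_length
      have h2 : rightmost S A (p (i + 1)) ≤ p (i + 1) := rightmost_le
      omega
  have hfitB' : ∀ i, 1 ≤ i → i ≤ k → s₄.arr 9 i < rightmost S B (s₄.arr 10 i) := by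
    intro i hi hik
    rw [g9, g10, (d3 i hi hik).1, (d3 i hi hik).2]
    exact hfitB i hi hik
  obtain ⟨hBmcs, hBsub⟩ := isMCSProcedure_mcs _ B
    (rightBlocks_ne_nil (S := S) (A := A) (p := p) hk0)
    (hsplit.sublist_rightBlocks (List.Sublist.refl _))
  have hsplit' := hsplit.of_rightBlocks hBmcs.1
  generalize hB₁ : mcs (rightBlocks k S A p) B = B₁ at *
  simp only [wp_seq]
  refine wp.mono (wp_mcsProg (Zt := B₁) (C := B) hT₄ hW
    ((r₄ 0 (by omega) (by omega) (by omega)).trans hk) hk0 hkn ?_ (by omega) (by omega)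
    (by omega) (by omega) (f3.congr rfl rfl rfl fun i _ _ => by rw [g10]) hfitB' ?_
    (by rw [hblocks, hB₁])) ?_
  · intro i hi hik
    rw [g10, (d3 i hi hik).2]
    exact hbe i hi hik
  · refine unscanned_le (fun i hi hik => ?_) (fun i hi hik => ?_) (fun i hi hik => ?_)
    · rw [g9, g10, (d3 i hi hik.le).2, (d3 (i + 1) (by omega) hik).1, blockEnd, if_neg hik.ne]
      exact rightmost_le
    · exact ((hfitB' i hi hik).trans_le rightmost_le).le
    · rw [g10, (d3 i hi hik).2]
      exact hbe i hi hik
  rintro s₅ t₅ ⟨i1, i2, i3, i4, i5, i6⟩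
  rw [ePL] at i6
  have hT₅ : Tables S s₅ := hT₄.congr (i2 2 (by omega) (by omega))
    (i1 0 (by omega) (by omega) (by omega) (by omega) (by omega))
    (i1 2 (by omega) (by omega) (by omega) (by omega) (by omega))
    (i1 3 (by omega) (by omega) (by omega) (by omega) (by omega))
    (i1 4 (by omega) (by omega) (by omega) (by omega) (by omega))
  have r₅ : ∀ x < 20, x ≠ 5 → x ≠ 9 → x ≠ 10 → s₅.reg x = s.reg x := fun x hx h5 h9 h10 =>
    (i2 x hx h5).trans (r₄ x hx h9 h10)
  refine wp.mono (wp_leftProg (k := k)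
    ((r₅ 0 (by omega) (by omega) (by omega) (by omega)).trans hk) hk0 (by omega)) ?_
  rintro s₆ t₆ ⟨j1, j2, j3, j4⟩
  have hT₆ : Tables S s₆ := hT₅.congr (j2 2 (by omega)) (j1 0 (by omega) (by omega))
    (j1 2 (by omega) (by omega)) (j1 3 (by omega) (by omega)) (j1 4 (by omega) (by omega))
  have r₆ : ∀ x < 20, x ≠ 5 → x ≠ 9 → x ≠ 10 → s₆.reg x = s.reg x := fun x hx h5 h9 h10 =>
    (j2 x h9).trans (r₅ x hx h5 h9 h10)
  have hA₆ : s₆.arr 5 = s.arr 5 := by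
    rw [j1 5 (by omega) (by omega), i1 5 (by omega) (by omega) (by omega) (by omega) (by omega),
      c₄ 5 (by omega) (by omega) (by omega) (by omega) (by omega)]
  refine wp.mono (wp_initProg (C := A) hT₆ hW
    ((r₆ 0 (by omega) (by omega) (by omega) (by omega)).trans hk) hkn hA
    (by omega) (by omega) (by omega)
    ((r₆ 4 (by omega) (by omega) (by omega) (by omega)).trans hlA)
    (by rw [hA₆]; exact hAh)) ?_
  rintro s₇ t₇ ⟨k1, k2, k3, -, k5⟩
  rw [ePL] at k5
  have hT₇ : Tables S s₇ := hT₆.congr (k2 2 (by omega)) (k1 0 (by omega) (by omega))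
    (k1 2 (by omega) (by omega)) (k1 3 (by omega) (by omega)) (k1 4 (by omega) (by omega))
  have r₇ : ∀ x < 20, x ≠ 5 → x ≠ 9 → x ≠ 10 → s₇.reg x = s.reg x := fun x hx h5 h9 h10 =>
    (k2 x (by omega)).trans (r₆ x hx h5 h9 h10)
  have hnext : ∀ i, 1 ≤ i → i ≤ k → nextPt S B₁ (p i) = some (s₅.arr 9 i) := fun i hi hik => by
    have := i5 i hi hik
    rwa [g9, (d3 i hi hik).1] at this
  have hL : ∀ i, 1 ≤ i → i ≤ k → s₇.arr 9 i = leftEnd S B₁ p i := fun i hi hik => by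
    rw [k1 9 (by omega) (by omega), (j3 i hi hik).1, leftEnd]
    split_ifs with h
    · rfl
    · rw [hnext (i - 1) (by omega) (by omega)]
      rfl
  have hEp : ∀ i, 1 ≤ i → i ≤ k → s₇.arr 10 i = p i := fun i hi hik => by
    rw [k1 10 (by omega) (by omega), (j3 i hi hik).2,
      i1 8 (by omega) (by omega) (by omega) (by omega) (by omega), f1 8 (by omega) (by omega),
      d1 8 (by omega) (by omega), b1 8 (by omega) (by omega), p₁ i hi hik]
  have hblocksL : blocks k S (s₇.arr 9) (s₇.arr 10) = leftBlocks k S B₁ p := by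
    refine List.map_congr_left fun i hi => ?_
    rw [List.mem_range'_1] at hi
    rw [hL i hi.1 (by omega), hEp i hi.1 (by omega)]
    rfl
  have hfitA : ∀ i, 1 ≤ i → i ≤ k → leftEnd S B₁ p i < rightmost S A (p i) := by
    intro i hi hik
    unfold leftEnd
    split_ifs with h
    · exact hpos i hi hik
    · rw [hnext (i - 1) (by omega) (by omega)]
      have e : i - 1 + 1 = i := by omega
      refine hsplit'.next_lt_prev (i - 1) (by omega) (by omega) _
        (hnext (i - 1) (by omega) (by omega)) _ ?_
      rw [e]
      exact prevPt_eq_rightmost (hpos i hi hik)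
  have hp_le : ∀ i, 1 ≤ i → i ≤ k → p i ≤ S.length + 1 := fun i hi hik => by
    have := (hat i hi hik).le_length
    omega
  refine wp.mono (wp_mcsProg (Zt := mcs (leftBlocks k S B₁ p) A) (C := A) hT₇ hW
    ((r₇ 0 (by omega) (by omega) (by omega) (by omega)).trans hk) hk0 hkn ?_ (by omega) (by omega)
    (by omega) (by omega)
    (k3.congr rfl rfl rfl fun i _ _ => by rw [k1 10 (by omega) (by omega)]) ?_ ?_
    (by rw [hblocksL])) ?_
  · intro i hi hik
    rw [hEp i hi hik]
    exact hp_le i hi hik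
  · intro i hi hik
    rw [hL i hi hik, hEp i hi hik]
    exact hfitA i hi hik
  · refine unscanned_le (fun i hi hik => ?_) (fun i hi hik => ?_) (fun i hi hik => ?_)
    · rw [hEp i hi hik.le, hL (i + 1) (by omega) hik, leftEnd, if_neg (by omega),
        Nat.add_sub_cancel, hnext i hi hik.le]
      exact (nextPt_eq_some_iff.1 (hnext i hi hik.le)).1
    · rw [hL i hi hik, hEp i hi hik]
      exact ((hfitA i hi hik).trans_le rightmost_le).le
    · rw [hEp i hi hik]
      exact hp_le i hi hik
  rintro s₈ t₈ ⟨l1, l2, l3, l4, -, l6⟩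
  rw [ePL] at l6
  have r₈ : ∀ x < 20, x ≠ 4 → x ≠ 5 → x ≠ 9 → x ≠ 10 → s₈.reg x = s.reg x :=
    fun x hx h4 h5 h9 h10 => (l2 x hx h4).trans (r₇ x hx h5 h9 h10)
  refine ⟨⟨?_, (r₈ 0 (by omega) (by omega) (by omega) (by omega) (by omega)).trans hk,
    (r₈ 1 (by omega) (by omega) (by omega) (by omega) (by omega)).trans hσ,
    (r₈ 7 (by omega) (by omega) (by omega) (by omega) (by omega)).trans hr, l3, ?_, l4, ?_⟩,
    ?_, r₈, ?_⟩
  · exact hT₇.congr (l2 2 (by omega) (by omega))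
      (l1 0 (by omega) (by omega) (by omega) (by omega) (by omega))
      (l1 2 (by omega) (by omega) (by omega) (by omega) (by omega))
      (l1 3 (by omega) (by omega) (by omega) (by omega) (by omega))
      (l1 4 (by omega) (by omega) (by omega) (by omega) (by omega))
  · rw [l2 5 (by omega) (by omega), k2 5 (by omega), j2 5 (by omega), i3]
  · rw [l1 6 (by omega) (by omega) (by omega) (by omega) (by omega), k1 6 (by omega) (by omega),
      j1 6 (by omega) (by omega)]
    exact i4
  · rw [l1 7 (by omega) (by omega) (by omega) (by omega) (by omega), k1 7 (by omega) (by omega),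
      j1 7 (by omega) (by omega), i1 7 (by omega) (by omega) (by omega) (by omega) (by omega),
      c₄ 7 (by omega) (by omega) (by omega) (by omega) (by omega)]
  · simp only [Expr.cost] at i6
    omega

end

end WordRAM

namespace KRep

theorem IsKRep.sublist_of_pos {α : Type*} {k : ℕ} {S X : List α} (h : IsKRep k S X) (hk : 0 < k) :
    X.Sublist S := by
  obtain ⟨k, rfl⟩ : ∃ m, k = m + 1 := ⟨k - 1, by omega⟩
  rw [IsKRep, List.replicate_succ, List.flatten_cons] at h
  exact (List.sublist_append_left _ _).trans h

theorem sum_of_mem_possibleDivisions {h d : ℕ} {sol : List ℕ} (hs : sol ∈ possibleDivisions h d) :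
    sol.sum = h := by
  induction d generalizing h sol with
  | zero => simp [possibleDivisions] at hs; simp [hs]
  | succ d ih =>
    simp only [possibleDivisions, List.mem_flatMap, List.mem_range, List.mem_map] at hs
    obtain ⟨i, hi, a, ha, rfl⟩ := hs
    rw [List.sum_cons, ih ha]
    omega

theorem sum_take_le_of_mem_possibleDivisions {h d : ℕ} {sol : List ℕ}
    (hs : sol ∈ possibleDivisions h d) (t : ℕ) : (sol.take t).sum ≤ h := by
  rw [← sum_of_mem_possibleDivisions hs]
  conv_rhs => rw [← List.take_append_drop t sol, List.sum_append]
  omega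

theorem length_possibleDivisions (h d : ℕ) : (possibleDivisions h d).length = (h + d).choose d := by
  induction d generalizing h with
  | zero => simp [possibleDivisions]
  | succ d ih =>
    simp only [possibleDivisions, List.length_flatMap, List.length_map, ih]
    induction h with
    | zero => simp
    | succ h ih' =>
      rw [List.range_succ_eq_map, List.map_cons, List.map_map, List.sum_cons]
      simp only [Function.comp_def, Nat.succ_eq_add_one, Nat.add_sub_add_right, Nat.sub_zero, ih']
      have e : h + 1 + (d + 1) = (h + 1 + d) + 1 := by omega
      have e' : h + (d + 1) = h + 1 + d := by omega
      rw [e, e', Nat.choose_succ_succ]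

theorem possibleDivisions_ne_nil (h d : ℕ) : possibleDivisions h d ≠ [] := by
  rw [← List.length_pos_iff, length_possibleDivisions]
  exact Nat.choose_pos (by omega)

/-- The division `b` follows the division `a` of `h` into `d + 1` parts in lexicographic order. -/
def NextDivision (h d : ℕ) (a b : List ℕ) : Prop :=
  ∃ t, 1 ≤ t ∧ t ≤ d ∧ (a.take t).sum < h ∧ (∀ u, t < u → u ≤ d → (a.take u).sum = h) ∧
    (∀ u < t, (b.take u).sum = (a.take u).sum) ∧
    ∀ u, t ≤ u → u ≤ d → (b.take u).sum = (a.take t).sum + 1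

theorem sum_take_head_possibleDivisions {h d : ℕ} : ∀ a ∈ (possibleDivisions h d).head?,
    ∀ t ≤ d, (a.take t).sum = 0 := by
  induction d generalizing h with
  | zero => intro a _ t ht; obtain rfl : t = 0 := by omega
            simp
  | succ d ih =>
    intro a ha t ht
    obtain ⟨b, l, hb⟩ := List.exists_cons_of_ne_nil (possibleDivisions_ne_nil h d)
    have hb' : b ∈ (possibleDivisions h d).head? := by simp [hb]
    simp only [possibleDivisions, List.range_succ_eq_map, List.flatMap_cons, Nat.sub_zero, hb,
      List.map_cons, List.cons_append, List.head?_cons, Option.mem_def, Option.some.injEq] at ha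
    subst ha
    rcases t with _ | t
    · simp
    · simpa using ih b hb' t (by omega)

theorem sum_take_getLast_possibleDivisions {h d : ℕ} : ∀ a ∈ (possibleDivisions h d).getLast?,
    ∀ t, 1 ≤ t → t ≤ d → (a.take t).sum = h := by
  rcases d with _ | d
  · intro a _ t h1 h2; omega
  · intro a ha t h1 h2
    have hne : (possibleDivisions 0 d).map (fun sol => h :: sol) ≠ [] := by
      simp [possibleDivisions_ne_nil]
    simp only [possibleDivisions, List.range_succ, List.flatMap_append, List.flatMap_cons,
      List.flatMap_nil, List.append_nil, Nat.sub_self, List.getLast?_append_of_ne_nil _ hne,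
      List.getLast?_map, Option.mem_def, Option.map_eq_some_iff] at ha
    obtain ⟨b, hb, rfl⟩ := ha
    obtain ⟨t, rfl⟩ : ∃ u, t = u + 1 := ⟨t - 1, by omega⟩
    have := sum_take_le_of_mem_possibleDivisions (List.mem_of_getLast? hb) t
    simp only [List.take_succ_cons, List.sum_cons]
    omega

theorem isChain_possibleDivisions (h d : ℕ) :
    (possibleDivisions h d).IsChain (NextDivision h d) := by
  induction d generalizing h with
  | zero => simp [possibleDivisions]
  | succ d ih =>
    rw [possibleDivisions, List.flatMap_def, List.isChain_flatten
      (by simp [possibleDivisions_ne_nil])]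
    constructor
    · simp only [List.mem_map, List.mem_range, forall_exists_index, and_imp]
      rintro _ i hi rfl
      rw [List.isChain_map]
      refine (ih (h - i)).imp ?_
      rintro a b ⟨t, h1, h2, h3, h4, h5, h6⟩
      refine ⟨t + 1, by omega, by omega, by simp; omega, ?_, ?_, ?_⟩
      · intro u hu hu'
        obtain ⟨u, rfl⟩ : ∃ v, u = v + 1 := ⟨u - 1, by omega⟩
        simp only [List.take_succ_cons, List.sum_cons, h4 u (by omega) (by omega)]
        omega
      · intro u hu
        rcases u with _ | u
        · simp
        · simp [h5 u (by omega)]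
      · intro u hu hu'
        obtain ⟨u, rfl⟩ : ∃ v, u = v + 1 := ⟨u - 1, by omega⟩
        simp only [List.take_succ_cons, List.sum_cons, h6 u (by omega) (by omega)]
        omega
    · rw [List.isChain_map, List.isChain_iff_getElem]
      intro i hi a ha b hb
      simp only [List.length_range, List.getElem_range, List.getLast?_map, List.head?_map,
        Option.mem_def, Option.map_eq_some_iff] at hi ha hb
      obtain ⟨a, ha, rfl⟩ := ha
      obtain ⟨b, hb, rfl⟩ := hb
      refine ⟨1, le_rfl, by omega, by simp; omega, ?_, ?_, ?_⟩
      · intro u hu hu'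
        obtain ⟨u, rfl⟩ : ∃ v, u = v + 1 := ⟨u - 1, by omega⟩
        simp only [List.take_succ_cons, List.sum_cons,
          sum_take_getLast_possibleDivisions a ha u (by omega) (by omega)]
        omega
      · intro u hu
        obtain rfl : u = 0 := by omega
        simp
      · intro u hu hu'
        obtain ⟨u, rfl⟩ : ∃ v, u = v + 1 := ⟨u - 1, by omega⟩
        simp [sum_take_head_possibleDivisions b hb u (by omega)]

end KRep

namespace WordRAM
open KRep

/-- Array `7` holds the prefix sums of a division of register `6`; it is replaced by the
lexicographically next one. Register `8` is set to `0` if there is none. -/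
def successorProg : Program :=
  .assign 9 (.reg 0) ;;
  .loop ((.lit 0 <ₑ .reg 9) *ₑ (.read 7 (.reg 9) =ₑ .reg 6)) (.assign 9 (.reg 9 -ₑ .lit 1)) ;;
  .cond (.reg 9)
    (.assign 10 (.read 7 (.reg 9) +ₑ .lit 1) ;;
      .loop (.reg 9 <ₑ .reg 0 +ₑ .lit 1)
        (.write 7 (.reg 9) (.reg 10) ;; .assign 9 (.reg 9 +ₑ .lit 1)))
    (.assign 8 (.lit 0))

theorem wp_successorProg {W k R t₀ : ℕ} {s : State} {t : ℕ} (hk : s.reg 0 = k) (hR : s.reg 6 = R)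
    (hkW : k + 2 ≤ W) (hRW : R < W) (h₀ : t₀ ≤ k) (hlast : ∀ u, t₀ < u → u ≤ k → s.arr 7 u = R)
    (hlt : 0 < t₀ → s.arr 7 t₀ < R) :
    wp W successorProg (fun s' t' => (∀ b, b ≠ 7 → s'.arr b = s.arr b) ∧
      (∀ x, x ≠ 8 → x ≠ 9 → x ≠ 10 → s'.reg x = s.reg x) ∧
      (t₀ = 0 → s'.reg 8 = 0) ∧ (0 < t₀ → s'.reg 8 = s.reg 8) ∧
      (0 < t₀ → ∀ u ≤ k, s'.arr 7 u = if t₀ ≤ u then s.arr 7 t₀ + 1 else s.arr 7 u) ∧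
      t' ≤ t + (k + 1) * 60) s t := by
  unfold successorProg
  simp only [wp_seq, wp_assign]
  simp only [Expr.Fits, Expr.val, Expr.cost]
  refine ⟨trivial, ?_⟩
  refine wp_for (k - t₀) 4 (fun j s' => s'.arr = s.arr ∧ (∀ x, x ≠ 9 → s'.reg x = s.reg x) ∧
    s'.reg 9 = k - j) ?_ ?_ ?_ ?_
  · rintro j s' t hj ⟨h1, h2, h3⟩
    have f6 := h2 6 (by omega)
    have hl := hlast (k - j) (by omega) (by omega)
    have h4 : 0 < k - j := by omega
    simp [h1, h3, f6, hl, hR]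
    refine ⟨by split_ifs <;> omega, by omega, by omega, fun x hx => ?_, by omega⟩
    rw [if_neg hx, h2 x hx]
  · rintro s' ⟨h1, h2, h3⟩
    have f6 := h2 6 (by omega)
    have h4 : k - (k - t₀) = t₀ := by omega
    rw [h4] at h3
    simp [h1, h3, f6, hR]
    refine ⟨by split_ifs <;> omega, fun h => by_contra fun h' => (hlt (Nat.pos_of_ne_zero h')).ne h⟩
  · exact ⟨rfl, fun x hx => by simp [hx], by simp [hk]⟩
  · rintro s' t' ⟨h1, h2, h3⟩ ht
    have h4 : k - (k - t₀) = t₀ := by omega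
    rw [h4] at h3
    simp only [Expr.cost] at ht
    simp only [wp_cond, Expr.Fits, Expr.val, Expr.cost, h3]
    refine ⟨trivial, fun h => ?_, fun h => ?_⟩
    swap
    · simp [h]
      refine ⟨by omega, by simp [h1], ?_, by omega⟩
      intro x hx hx' _
      rw [if_neg hx, h2 x hx']
    · have h' : 0 < t₀ := by omega
      have hlt' := hlt h'
      simp only [wp_seq, wp_assign]
      simp only [Expr.Fits, Expr.val, Expr.cost, h1, h3, BinOp.apply_add]
      refine ⟨⟨trivial, by omega, by omega⟩, ?_⟩
      refine wp_for (k + 1 - t₀) 10 (fun j s' => (∀ b, b ≠ 7 → s'.arr b = s.arr b) ∧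
        (∀ x, x ≠ 9 → x ≠ 10 → s'.reg x = s.reg x) ∧ s'.reg 9 = t₀ + j ∧
        s'.reg 10 = s.arr 7 t₀ + 1 ∧
        ∀ u ≤ k, s'.arr 7 u = if t₀ ≤ u ∧ u < t₀ + j then s.arr 7 t₀ + 1 else s.arr 7 u) ?_ ?_ ?_ ?_
      · rintro j s₁ t hj ⟨a1, a2, a3, a4, a5⟩
        have f0 := a2 0 (by omega) (by omega)
        simp [f0, a3, a4, hk]
        refine ⟨⟨by omega, by split_ifs <;> omega⟩, by omega, ?_⟩
        refine ⟨by omega, fun b hb => by rw [if_neg hb, a1 b hb],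
          fun x hx hx' => by rw [if_neg hx, a2 x hx hx'], by omega, fun u hu => ?_⟩
        rcases eq_or_ne u (t₀ + j) with rfl | hne
        · simp
        · rw [Function.update_of_ne hne, a5 u hu]
          exact if_congr (by omega) rfl rfl
      · rintro s₁ ⟨a1, a2, a3, a4, a5⟩
        have f0 := a2 0 (by omega) (by omega)
        have : ¬ t₀ + (k + 1 - t₀) < k + 1 := by omega
        simp [f0, a3, hk, this]
        omega
      · refine ⟨by simp [h1], fun x hx hx' => by simp [hx, hx', h2], by simp [h3], by simp,
          fun u hu => ?_⟩
        simp [h1]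
      · rintro s₁ t₁ ⟨a1, a2, a3, a4, a5⟩ ht₁
        simp only [Expr.cost] at ht₁
        refine ⟨a1, fun x _ hx hx' => a2 x hx hx', fun h => by omega,
          fun _ => a2 8 (by omega) (by omega), fun _ u hu => ?_, by omega⟩
        rw [a5 u hu]
        exact if_congr (by omega) rfl rfl

/-- The main loop of the algorithm. -/
def mainProg : Program := .loop (.reg 8) (stepProg ;; successorProg)

/-- The tuple of the occurrences of `σ` that belongs to a division. -/
def startTuple (S : List ℕ) (σ r : ℕ) (sol : List ℕ) (t : ℕ) : ℕ :=
  (occurrences S σ).getD ((t - 1) * r + (sol.take t).sum) 0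

theorem wp_mainProg {W k σ r R : ℕ} {S A B : List ℕ} {s : State} {t : ℕ}
    (hC : Ctx k S σ r A B s) (hX : IsKRep k S (A ++ σ :: B))
    (hW : (S.length + 3) * (S.length + 3) ≤ W) (hk0 : 0 < k) (hkn : k ≤ S.length) (hr0 : 0 < r)
    (hkr : k * r ≤ S.count σ) (hR : R = S.count σ - k * r) (h6 : s.reg 6 = R) (h8 : s.reg 8 = 1)
    (h7 : ∀ i, 1 ≤ i → i ≤ k → s.arr 7 i = 0) :
    wp W mainProg (fun s' t' => Ctx k S σ r
      ((potentialStarts r k (occurrences S σ)).foldl (extendStep mcs k S σ) (A, B)).1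
      ((potentialStarts r k (occurrences S σ)).foldl (extendStep mcs k S σ) (A, B)).2 s' ∧
      t' ≤ t + (R + k).choose k * (S.length * ((k + 1) * (10000 * (Nat.log 2 S.length + 1))) +
        (k + 1) * 100) + 2) s t := by
  have hlin := linear_lt hW
  have hcn : S.count σ ≤ S.length := List.count_le_length
  have hstarts : potentialStarts r k (occurrences S σ) =
      (possibleDivisions R k).map (startTuple S σ r) := by
    rw [potentialStarts, length_occurrences, ← hR]
    rfl
  rw [hstarts, ← length_possibleDivisions]
  set D := possibleDivisions R k with hD
  have hDpos : 0 < D.length := List.length_pos_iff.2 (possibleDivisions_ne_nil R k)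
  refine wp_for D.length (S.length * ((k + 1) * (10000 * (Nat.log 2 S.length + 1))) +
        (k + 1) * 60) (fun j s' => Ctx k S σ r
      (((D.take j).map (startTuple S σ r)).foldl (extendStep mcs k S σ) (A, B)).1
      (((D.take j).map (startTuple S σ r)).foldl (extendStep mcs k S σ) (A, B)).2 s' ∧
      s'.reg 6 = R ∧ (∀ hj : j < D.length, s'.reg 8 = 1 ∧
        ∀ i, 1 ≤ i → i ≤ k → s'.arr 7 i = (D[j].take i).sum) ∧
      (j = D.length → s'.reg 8 = 0)) ?_ ?_ ?_ ?_
  · rintro j s' t hj ⟨a1, a2, a3, a4⟩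
    obtain ⟨a5, a6⟩ := a3 hj
    have hmem : D[j] ∈ possibleDivisions R k := List.getElem_mem hj
    simp only [wp_seq]
    refine ⟨trivial, by simp [a5], ?_⟩
    obtain ⟨-, -, hrep, -⟩ := foldl_extendStep_spec (S := S) (σ := σ) isMCSProcedure_mcs hk0
      ((D.take j).map (startTuple S σ r)) (A, B)
    have hsub := (hrep hX).sublist_of_pos hk0
    rw [List.take_add_one, List.getElem?_eq_getElem hj, Option.toList_some, List.map_append,
      List.foldl_append, List.map_singleton, List.foldl_cons, List.foldl_nil]
    set AB := ((D.take j).map (startTuple S σ r)).foldl (extendStep mcs k S σ) (A, B)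
    have hl := hsub.length_le
    rw [List.length_append, List.length_cons] at hl
    have hidx : ∀ i, 1 ≤ i → i ≤ k → (i - 1) * r + s'.arr 7 i + 1 ≤ S.count σ := by
      intro i hi hik
      have h1 := sum_take_le_of_mem_possibleDivisions hmem i
      rw [a6 i hi hik]
      obtain ⟨m, rfl⟩ : ∃ m, i = m + 1 := ⟨i - 1, by omega⟩
      have h2 : (m + 1) * r ≤ k * r := Nat.mul_le_mul_right _ hik
      rw [Nat.add_mul] at h2
      simp only [Nat.add_sub_cancel]
      omega
    refine wp.mono (wp_stepProg (p := startTuple S σ r D[j]) a1 hW hk0 hkn (by omega) (by omega)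
      hidx fun i hi hik => ?_) ?_
    · rw [a6 i hi hik]
      rfl
    rintro s₁ t₁ ⟨b1, b2, b3, b4⟩
    have b6 := (b3 6 (by omega) (by omega) (by omega) (by omega) (by omega)).trans a2
    have b8 := (b3 8 (by omega) (by omega) (by omega) (by omega) (by omega)).trans a5
    have main : ∀ t₀ ≤ k, (∀ u, t₀ < u → u ≤ k → s₁.arr 7 u = R) →
        (0 < t₀ → s₁.arr 7 t₀ < R) →
        ((t₀ = 0 ∧ j + 1 = D.length) ∨ (0 < t₀ ∧ ∃ h : j + 1 < D.length, ∀ u, 1 ≤ u → u ≤ k →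
          (D[j + 1].take u).sum = if t₀ ≤ u then s₁.arr 7 t₀ + 1 else s₁.arr 7 u)) →
        wp W successorProg (fun s'' t'' => (Ctx k S σ r
          (extendStep mcs k S σ AB (startTuple S σ r D[j])).1
          (extendStep mcs k S σ AB (startTuple S σ r D[j])).2 s'' ∧ s''.reg 6 = R ∧
          (∀ hj : j + 1 < D.length, s''.reg 8 = 1 ∧
            ∀ i, 1 ≤ i → i ≤ k → s''.arr 7 i = (D[j + 1].take i).sum) ∧
          (j + 1 = D.length → s''.reg 8 = 0)) ∧
          t'' ≤ t + (S.length * ((k + 1) * (10000 * (Nat.log 2 S.length + 1))) + (k + 1) * 60))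
          s₁ t₁ := by
      intro t₀ h₀ hlast hlt hcase
      refine wp.mono (wp_successorProg b1.reg_k b6 (by omega) (by omega) h₀ hlast hlt) ?_
      rintro s₂ t₂ ⟨c1, c2, c3, c4, c5, c6⟩
      refine ⟨⟨⟨b1.tables.congr (c2 2 (by omega) (by omega) (by omega)) (c1 0 (by omega))
        (c1 2 (by omega)) (c1 3 (by omega)) (c1 4 (by omega)),
        (c2 0 (by omega) (by omega) (by omega)).trans b1.reg_k,
        (c2 1 (by omega) (by omega) (by omega)).trans b1.reg_σ,
        (c2 7 (by omega) (by omega) (by omega)).trans b1.reg_r,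
        (c2 4 (by omega) (by omega) (by omega)).trans b1.lenA,
        (c2 5 (by omega) (by omega) (by omega)).trans b1.lenB,
        by rw [c1 5 (by omega)]; exact b1.holdsA, by rw [c1 6 (by omega)]; exact b1.holdsB⟩,
        (c2 6 (by omega) (by omega) (by omega)).trans b6, ?_, ?_⟩, by omega⟩
      · intro hj'
        rcases hcase with ⟨-, h⟩ | ⟨h0, _, h⟩
        · omega
        · refine ⟨(c4 h0).trans b8, fun i hi hik => ?_⟩
          rw [h i hi hik, c5 h0 i hik]
      · intro hj'
        rcases hcase with ⟨h, -⟩ | ⟨h0, h, -⟩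
        · exact c3 h
        · omega
    rw [← b2] at a6
    rcases Nat.lt_or_ge (j + 1) D.length with hj' | hj'
    · obtain ⟨t₀, h1, h2, h3, h4, h5, h6⟩ :=
        List.isChain_iff_getElem.1 (isChain_possibleDivisions R k) j hj'
      refine main t₀ h2 (fun u hu huk => ?_) (fun _ => ?_) (Or.inr ⟨h1, hj', fun u hu huk => ?_⟩)
      · rw [a6 u (by omega) huk]
        exact h4 u hu huk
      · rw [a6 t₀ h1 h2]
        exact h3
      · rw [a6 t₀ h1 h2]
        split_ifs with h
        · exact h6 u h huk
        · rw [a6 u hu huk]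
          exact h5 u (by omega)
    · have hlast : D[j] ∈ (possibleDivisions R k).getLast? := by
        rw [Option.mem_def, ← hD, List.getLast?_eq_getElem?, List.getElem?_eq_some_iff]
        have : D.length - 1 = j := by omega
        simp only [this]
        exact ⟨hj, trivial⟩
      refine main 0 (by omega) (fun u hu huk => ?_) (by omega) (Or.inl ⟨rfl, by omega⟩)
      rw [a6 u hu huk]
      exact sum_take_getLast_possibleDivisions _ hlast u hu huk
  · rintro s' ⟨-, -, -, a4⟩
    exact ⟨trivial, a4 rfl⟩
  · refine ⟨by simpa using hC, h6, fun hj => ⟨h8, fun i hi hik => ?_⟩, by omega⟩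
    rw [h7 i hi hik, sum_take_head_possibleDivisions (h := R) D[0] ?_ i hik]
    rw [List.head?_eq_getElem?, Option.mem_def, ← hD, List.getElem?_eq_getElem hj]
  · rintro s' t' ⟨a1, -, -, -⟩ ht
    rw [List.take_length] at a1
    refine ⟨a1, ?_⟩
    simp only [Expr.cost] at ht
    have : D.length * (S.length * ((k + 1) * (10000 * (Nat.log 2 S.length + 1))) +
        (k + 1) * 60 + 1 + 1) ≤ D.length * (S.length * ((k + 1) *
        (10000 * (Nat.log 2 S.length + 1))) + (k + 1) * 100) :=
      Nat.mul_le_mul_left _ (by omega)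
    omega

end WordRAM

namespace KRep

theorem occFn_eq {α : Type*} [DecidableEq α] {S : List α} {y : α} {p : ℕ} (h : At S p y) :
    occFn S y ((S.take (p - 1)).count y + 1) = p := by
  have := getElem?_occurrences h
  rw [occFn, List.getD_cons_succ, List.getD_eq_getElem?_getD, this, Option.getD_some]

end KRep

namespace WordRAM
open KRep

/-- The arrays `f`, `c` and `o` are the tables of the first `j` letters of `S`. -/
structure PartialTables (S : List ℕ) (j : ℕ) (f c o : ℕ → ℕ) : Prop where
  count : ∀ y, c y = (S.take j).count y
  first : ∀ y ∈ S.take j, At S (f y) y ∧ f y ≤ j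
  first_eq_zero : ∀ y, y ∉ S.take j → f y = 0
  occ_zero : ∀ a, o (a * (S.length + 1)) = 0
  occ : ∀ y i, 1 ≤ i → i ≤ (S.take j).count y → o (f y * (S.length + 1) + i) = occFn S y i

theorem PartialTables.zero {S : List ℕ} : PartialTables S 0 (fun _ => 0) (fun _ => 0)
    (fun _ => 0) where
  count := by simp
  first := by simp
  first_eq_zero := by simp
  occ_zero := by simp
  occ := by simp; omega

theorem mul_add_inj {N a b i j : ℕ} (hi : i < N) (hj : j < N) (h : a * N + i = b * N + j) :
    a = b ∧ i = j := by
  have hab : a = b := by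
    rcases lt_trichotomy a b with h' | h' | h'
    · have := Nat.mul_le_mul_right N (Nat.succ_le_of_lt h')
      rw [Nat.succ_mul] at this
      omega
    · exact h'
    · have := Nat.mul_le_mul_right N (Nat.succ_le_of_lt h')
      rw [Nat.succ_mul] at this
      omega
  subst hab
  exact ⟨rfl, by omega⟩

theorem PartialTables.succ {S : List ℕ} {j : ℕ} {f c o : ℕ → ℕ} (h : PartialTables S j f c o)
    {y v : ℕ} (hy : At S (j + 1) y) (hv : v = if f y = 0 then j + 1 else f y) :
    PartialTables S (j + 1) (Function.update f y v) (Function.update c y (c y + 1))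
      (Function.update o (v * (S.length + 1) + (c y + 1)) (j + 1)) := by
  obtain ⟨h1, h2, h3, h4, h5⟩ := h
  have hlen := hy.le_length
  have ht : S.take (j + 1) = S.take j ++ [y] := by
    have := hy.2
    rw [Nat.add_sub_cancel] at this
    rw [List.take_add_one, this, Option.toList_some]
  have hcy : (S.take (j + 1)).count y = (S.take j).count y + 1 := by
    rw [ht, List.count_append, List.count_singleton_self]
  have hcz : ∀ z, z ≠ y → (S.take (j + 1)).count z = (S.take j).count z := fun z hz => by
    rw [ht, List.count_append, List.count_singleton, if_neg (by simpa using hz.symm), Nat.add_zero]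
  have hcle : ∀ z, (S.take (j + 1)).count z ≤ S.length := fun z =>
    List.count_le_length.trans (by simp)
  have hvAt : At S v y ∧ v ≤ j + 1 := by
    rw [hv]
    split_ifs with hf
    · exact ⟨hy, le_rfl⟩
    · have : y ∈ S.take j := by_contra fun h => hf (h3 y h)
      exact ⟨(h2 y this).1, by have := (h2 y this).2; omega⟩
  have hcy' := hcle y
  constructor
  · intro z
    rcases eq_or_ne z y with rfl | hz
    · rw [Function.update_self, h1, hcy]
    · rw [Function.update_of_ne hz, h1, hcz z hz]
  · intro z hz
    rcases eq_or_ne z y with rfl | hzy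
    · rw [Function.update_self]
      exact hvAt
    · rw [Function.update_of_ne hzy]
      rw [ht, List.mem_append, List.mem_singleton] at hz
      have := h2 z (hz.resolve_right hzy)
      exact ⟨this.1, by omega⟩
  · intro z hz
    rw [ht, List.mem_append, List.mem_singleton, not_or] at hz
    rw [Function.update_of_ne hz.2, h3 z hz.1]
  · intro a
    rw [Function.update_of_ne, h4]
    intro e
    have := (mul_add_inj (N := S.length + 1) (a := a) (b := v) (i := 0) (j := c y + 1)
      (by omega) (by rw [h1]; omega) e).2
    omega
  · intro z i hi hi'
    have hiz := hcle z
    rcases eq_or_ne z y with rfl | hz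
    · rw [Function.update_self]
      rcases eq_or_ne i (c z + 1) with rfl | hne
      · rw [Function.update_self, h1]
        exact (occFn_eq hy).symm
      · rw [Function.update_of_ne (by omega)]
        rw [h1] at hne
        have hmem : z ∈ S.take j := List.count_pos_iff.1 (by omega)
        have := (h2 z hmem).1.pos
        rw [if_neg (by omega)] at hv
        rw [hv, h5 z i hi (by omega)]
    · rw [Function.update_of_ne hz]
      rw [hcz z hz] at hi' hiz
      rw [Function.update_of_ne, h5 z i hi hi']
      intro e
      have hmem : z ∈ S.take j := List.count_pos_iff.1 (by omega)
      have e' := (mul_add_inj (N := S.length + 1) (a := f z) (b := v) (i := i) (j := c y + 1)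
        (by omega) (by rw [h1]; omega) e).1
      have hz' := (h2 z hmem).1
      rw [e'] at hz'
      exact hz (hz'.unique hvAt.1)

/-- The tables of the positions of the letters of the string in array `0` are built. -/
def tablesProg : Program :=
  .assign 9 (.lit 1) ;;
  .loop (.reg 9 <ₑ .reg 2 +ₑ .lit 1)
    (.assign 10 (.read 0 (.reg 9 -ₑ .lit 1)) ;;
      .write 2 (.reg 10) (.read 2 (.reg 10) +ₑ (.read 2 (.reg 10) =ₑ .lit 0) *ₑ .reg 9) ;;
      .write 3 (.reg 10) (.read 3 (.reg 10) +ₑ .lit 1) ;;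
      .write 4 (.read 2 (.reg 10) *ₑ (.reg 2 +ₑ .lit 1) +ₑ .read 3 (.reg 10)) (.reg 9) ;;
      .assign 9 (.reg 9 +ₑ .lit 1))

theorem wp_tablesProg {W : ℕ} {S : List ℕ} {s : State} {t : ℕ} (h2 : s.reg 2 = S.length)
    (h0 : ∀ i, s.arr 0 i = S.getD i 0) (hs2 : s.arr 2 = fun _ => 0) (hs3 : s.arr 3 = fun _ => 0)
    (hs4 : s.arr 4 = fun _ => 0) (hW : (S.length + 3) * (S.length + 3) ≤ W) :
    wp W tablesProg (fun s' t' => Tables S s' ∧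
      (∀ b, b ≠ 2 → b ≠ 3 → b ≠ 4 → s'.arr b = s.arr b) ∧
      (∀ x, x ≠ 9 → x ≠ 10 → s'.reg x = s.reg x) ∧ t' ≤ t + (S.length + 1) * 60) s t := by
  have hlin := linear_lt hW
  have hletter : ∀ p c, At S p c → s.arr 0 (p - 1) = c := fun p c h => by
    rw [h0, List.getD_eq_getElem?_getD, h.2, Option.getD_some]
  unfold tablesProg
  simp only [wp_seq, wp_assign]
  simp only [Expr.Fits, Expr.val, Expr.cost]
  refine ⟨by omega, ?_⟩
  refine wp_for S.length 45 (fun j s' => PartialTables S j (s'.arr 2) (s'.arr 3) (s'.arr 4) ∧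
    (∀ b, b ≠ 2 → b ≠ 3 → b ≠ 4 → s'.arr b = s.arr b) ∧
    (∀ x, x ≠ 9 → x ≠ 10 → s'.reg x = s.reg x) ∧ s'.reg 9 = j + 1) ?_ ?_ ?_ ?_
  · rintro j s' t hj ⟨a1, a2, a3, a4⟩
    obtain ⟨y, hy⟩ := exists_at (S := S) (p := j + 1) (by omega) (by omega)
    have g0 := a2 0 (by omega) (by omega) (by omega)
    have f2 := a3 2 (by omega) (by omega)
    have hly := hletter _ _ hy
    rw [Nat.add_sub_cancel] at hly
    have hf : s'.arr 2 y ≤ j := by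
      by_cases h : y ∈ S.take j
      · exact (a1.first y h).2
      · rw [a1.first_eq_zero y h]; omega
    have hc : s'.arr 3 y ≤ j := by
      rw [a1.count]
      exact List.count_le_length.trans (by simp)
    have key : s'.arr 2 y + (if s'.arr 2 y = 0 then 1 else 0) * (j + 1) =
        if s'.arr 2 y = 0 then j + 1 else s'.arr 2 y := by
      split_ifs with h <;> simp [h]
    have hle : (if s'.arr 2 y = 0 then j + 1 else s'.arr 2 y) ≤ j + 1 := by split_ifs <;> omega
    have hstep := a1.succ hy rfl
    simp only [wp_seq, wp_assign, wp_write]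
    simp only [Expr.Fits, Expr.val, Expr.cost, State.setReg_reg, State.setReg_arr,
      State.setArr_reg, State.setArr_arr, BinOp.apply_add, BinOp.apply_sub, BinOp.apply_mul,
      BinOp.apply_lt, BinOp.apply_eq, a4, f2, h2, g0, hly, Nat.add_sub_cancel, key, if_true,
      Function.update_self, Nat.reduceEqDiff, if_false]
    generalize (if s'.arr 2 y = 0 then j + 1 else s'.arr 2 y) = v at *
    have hm := mul_add_lt (a := v) (b := S.length + 1) (c := s'.arr 3 y + 1) hW (by omega)
      (by omega) (by omega)
    have hi : (if s'.arr 2 y = 0 then 1 else 0) * (j + 1) < W := by split_ifs <;> omega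
    refine ⟨⟨trivial, ⟨trivial, by omega, by omega⟩, by split_ifs <;> omega⟩,
      by split_ifs <;> omega, ⟨trivial, by omega, by omega⟩, trivial,
      ⟨trivial, ⟨⟨trivial, by omega, by split_ifs <;> omega⟩, trivial, hi⟩, by omega⟩, trivial,
      ⟨trivial, by omega, by omega⟩,
      ⟨⟨trivial, ⟨trivial, by omega, by omega⟩, by omega⟩, trivial, hm⟩, trivial,
      ⟨trivial, by omega, by omega⟩, ⟨hstep, fun b hb2 hb3 hb4 => ?_, fun x hx9 hx10 => ?_,
      trivial⟩, by omega⟩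
    · rw [if_neg hb4, if_neg hb3, if_neg hb2, a2 b hb2 hb3 hb4]
    · rw [if_neg hx9, if_neg hx10, a3 x hx9 hx10]
  · rintro s' ⟨a1, a2, a3, a4⟩
    have f2 := a3 2 (by omega) (by omega)
    simp [a4, f2, h2]
    omega
  · refine ⟨?_, ?_, ?_, ?_⟩
    · simp only [State.setReg_arr, hs2, hs3, hs4]
      exact .zero
    · simp
    · intro x h9 h10; simp [h9]
    · simp
  · rintro s' t' ⟨a1, a2, a3, a4⟩ ht
    simp only [Expr.cost] at ht
    refine ⟨⟨(a3 2 (by omega) (by omega)).trans h2, ?_, fun y => ?_, fun y => ?_, fun y j hj => ?_⟩,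
      a2, a3, by omega⟩
    · rw [a2 0 (by omega) (by omega) (by omega)]
      exact hletter
    · by_cases h : y ∈ S.take S.length
      · exact (a1.first y h).2
      · rw [a1.first_eq_zero y h]; omega
    · rw [a1.count, List.take_length]
    · rcases Nat.eq_zero_or_pos j with rfl | h
      · exact a1.occ_zero _
      · exact a1.occ y j h (by rwa [List.take_length])

/-- The string in array `1` is split at the first occurrence of the letter in register `1`. -/
def splitProg : Program :=
  .assign 9 (.lit 0) ;;
  .loop (.lit 1 -ₑ (.read 1 (.reg 9) =ₑ .reg 1))
    (.write 5 (.reg 9) (.read 1 (.reg 9)) ;; .assign 9 (.reg 9 +ₑ .lit 1)) ;;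
  .assign 4 (.reg 9) ;;
  .assign 7 (.lit 1) ;;
  .assign 9 (.lit 0) ;;
  .assign 5 (.reg 3 -ₑ .reg 4 -ₑ .lit 1) ;;
  .loop (.reg 9 <ₑ .reg 5)
    (.write 6 (.reg 9) (.read 1 (.reg 4 +ₑ .lit 1 +ₑ .reg 9)) ;;
      .assign 7 (.reg 7 +ₑ (.read 6 (.reg 9) =ₑ .reg 1)) ;;
      .assign 9 (.reg 9 +ₑ .lit 1)) ;;
  .assign 6 (.read 3 (.reg 1) -ₑ .reg 0 *ₑ .reg 7) ;;
  .assign 8 (.lit 1)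

theorem wp_splitProg {W k σ : ℕ} {S A B : List ℕ} {s : State} {t : ℕ} (hT : Tables S s)
    (h0 : s.reg 0 = k) (h1 : s.reg 1 = σ) (h3 : s.reg 3 = (A ++ σ :: B).length)
    (hX : ∀ i, s.arr 1 i = (A ++ σ :: B).getD i 0) (hA : σ ∉ A)
    (hW : (S.length + 3) * (S.length + 3) ≤ W) (hk : k ≤ S.length)
    (hlen : (A ++ σ :: B).length ≤ S.length) :
    wp W splitProg (fun s' t' => Ctx k S σ ((A ++ σ :: B).count σ) A B s' ∧ s'.reg 8 = 1 ∧
      s'.reg 6 = S.count σ - k * (A ++ σ :: B).count σ ∧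
      (∀ b, b ≠ 5 → b ≠ 6 → s'.arr b = s.arr b) ∧ t' ≤ t + S.length * 120) s t := by
  have hlin := linear_lt hW
  have hcX : (A ++ σ :: B).count σ = B.count σ + 1 := by
    rw [List.count_append, List.count_eq_zero_of_not_mem hA, List.count_cons_self]
    omega
  have hXA : ∀ i (h : i < A.length), s.arr 1 i = A[i] := fun i h => by
    rw [hX, List.getD_append _ _ _ _ h, List.getD_eq_getElem _ _ h]
  have hXσ : s.arr 1 A.length = σ := by
    rw [hX, List.getD_append_right _ _ _ _ le_rfl, Nat.sub_self, List.getD_cons_zero]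
  have hXB : ∀ i (h : i < B.length), s.arr 1 (A.length + 1 + i) = B[i] := fun i h => by
    rw [hX, List.getD_append_right _ _ _ _ (by omega)]
    have : A.length + 1 + i - A.length = i + 1 := by omega
    rw [this, List.getD_cons_succ, List.getD_eq_getElem _ _ h]
  rw [List.length_append, List.length_cons] at h3 hlen
  rw [hcX]
  have hBc : B.count σ ≤ B.length := List.count_le_length
  have hmul : k * (B.count σ + 1) < W :=
    mul_add_lt (n := S.length) (a := k) (b := B.count σ + 1) (c := 0) hW (by omega) (by omega)
      (by omega)
  have hcS : S.count σ ≤ S.length := List.count_le_length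
  unfold splitProg
  simp only [wp_seq, wp_assign]
  simp only [Expr.Fits, Expr.val, Expr.cost]
  refine ⟨by omega, ?_⟩
  refine wp_for A.length 20 (fun j s' => (∀ b, b ≠ 5 → s'.arr b = s.arr b) ∧
    (∀ x, x ≠ 9 → s'.reg x = s.reg x) ∧ s'.reg 9 = j ∧ ∀ i < j, s'.arr 5 i = s.arr 1 i) ?_ ?_ ?_ ?_
  · rintro j s' t hj ⟨a1, a2, a3, a4⟩
    have g1 := a1 1 (by omega)
    have f1 := a2 1 (by omega)
    have hne : A[j] ≠ σ := fun h => hA (h ▸ List.getElem_mem hj)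
    simp [a3, g1, f1, h1, hXA j hj, hne]
    refine ⟨by omega, by omega, fun b hb => by rw [if_neg hb, a1 b hb],
      fun x hx => by rw [if_neg hx, a2 x hx], fun i hi => ?_⟩
    rcases eq_or_ne i j with rfl | hij
    · rw [Function.update_self, hXA i hj]
    · rw [Function.update_of_ne hij, a4 i (by omega)]
  · rintro s' ⟨a1, a2, a3, a4⟩
    have g1 := a1 1 (by omega)
    have f1 := a2 1 (by omega)
    simp [a3, g1, f1, h1, hXσ]
    omega
  · refine ⟨by simp, fun x hx => by simp [hx], by simp, by omega⟩
  rintro s₁ t₁ ⟨a1, a2, a3, a4⟩ ht₁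
  simp only [Expr.cost] at ht₁
  have g1 := a1 1 (by omega)
  have f3 := a2 3 (by omega)
  have hBl : A.length + (B.length + 1) - A.length - 1 = B.length := by omega
  simp [a3, f3, h3]
  refine ⟨by omega, by omega, by omega, ?_⟩
  refine wp_for B.length 32 (fun j s' => (∀ b, b ≠ 6 → s'.arr b = s₁.arr b) ∧
    (∀ x, x ≠ 4 → x ≠ 5 → x ≠ 7 → x ≠ 9 → s'.reg x = s₁.reg x) ∧ s'.reg 9 = j ∧
    s'.reg 4 = A.length ∧ s'.reg 5 = B.length ∧ s'.reg 7 = (B.take j).count σ + 1 ∧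
    ∀ i (h : i < B.length), i < j → s'.arr 6 i = B[i]) ?_ ?_ ?_ ?_
  · rintro j s' t hj ⟨b1, b2, b3, b4, b5, b6, b7⟩
    have k1 := b1 1 (by omega)
    have l1 := b2 1 (by omega) (by omega) (by omega) (by omega)
    have f1 := a2 1 (by omega)
    have hc : (B.take (j + 1)).count σ = (B.take j).count σ + if B[j] = σ then 1 else 0 := by
      rw [List.take_add_one, List.getElem?_eq_getElem hj, Option.toList_some, List.count_append,
        List.count_singleton]
      simp
    have hcj : (B.take j).count σ ≤ j := List.count_le_length.trans (by simp)
    simp [b3, b4, b5, b6, k1, l1, g1, f1, h1, hXB j hj, hj, hc]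
    split_ifs with hj' <;>
    refine ⟨by omega, ⟨⟨by omega, by omega⟩, by omega⟩, ⟨by omega, by omega⟩,
      ⟨by omega, by omega⟩, fun b hb => by rw [if_neg hb, b1 b hb],
      fun x hx hx' hx'' hx''' => by rw [if_neg hx''', if_neg hx'', b2 x hx hx' hx'' hx'''],
      by omega, fun i hi hi' => ?_⟩
    all_goals
      rcases eq_or_ne i j with rfl | hij
      · rw [Function.update_self]
      · rw [Function.update_of_ne hij, b7 i hi (by omega)]
  · rintro s' ⟨b1, b2, b3, b4, b5, b6, b7⟩
    simp [b3, b5]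
    omega
  · refine ⟨by simp, fun x hx hx' hx'' hx''' => by simp [hx, hx', hx'', hx'''], by simp, by simp,
      by simp, by simp, by omega⟩
  · rintro s₂ t₂ ⟨b1, b2, b3, b4, b5, b6, b7⟩ ht₂
    simp only [Expr.cost] at ht₂
    have l0 := (b2 0 (by omega) (by omega) (by omega) (by omega)).trans (a2 0 (by omega))
    have l1 := (b2 1 (by omega) (by omega) (by omega) (by omega)).trans (a2 1 (by omega))
    have l2 := (b2 2 (by omega) (by omega) (by omega) (by omega)).trans (a2 2 (by omega))
    have k3 := (b1 3 (by omega)).trans (a1 3 (by omega))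
    rw [List.take_length] at b6
    simp [l0, l1, k3, h0, h1, b6, hT.count]
    refine ⟨⟨hmul, by omega⟩, by omega, ?_,
      fun b h5 h6 => (b1 b h6).trans (a1 b h5), by omega⟩
    refine ⟨hT.congr ?_ ?_ ?_ ?_ ?_, ?_, ?_, ?_, ?_, ?_, ?_, ?_⟩
    · simpa using l2
    · simpa using (b1 0 (by omega)).trans (a1 0 (by omega))
    · simpa using (b1 2 (by omega)).trans (a1 2 (by omega))
    · simpa using k3
    · simpa using (b1 4 (by omega)).trans (a1 4 (by omega))
    · simpa [h0] using l0
    · simpa [h1] using l1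
    · simpa using b6
    · simpa using b4
    · simpa using b5
    · intro j hj
      simpa [b1, a4 j hj] using hXA j hj
    · intro j hj
      simpa using b7 j hj hj

/-- The output string is written to array `0`. -/
def outputProg : Program :=
  .assign 9 (.lit 0) ;;
  .loop (.reg 9 <ₑ .reg 4)
    (.write 0 (.reg 9) (.read 5 (.reg 9)) ;; .assign 9 (.reg 9 +ₑ .lit 1)) ;;
  .write 0 (.reg 4) (.reg 1) ;;
  .assign 9 (.lit 0) ;;
  .loop (.reg 9 <ₑ .reg 5)
    (.write 0 (.reg 4 +ₑ .lit 1 +ₑ .reg 9) (.read 6 (.reg 9)) ;; .assign 9 (.reg 9 +ₑ .lit 1)) ;;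
  .assign 0 (.reg 4 +ₑ .lit 1 +ₑ .reg 5)

theorem output_eq {s : State} {L : List ℕ} (h : s.reg 0 = L.length)
    (h' : ∀ i (h : i < L.length), s.arr 0 i = L[i]) : output s = L := by
  refine List.ext_getElem (by simp [output, h]) fun i h1 h2 => ?_
  simp [output, h' i h2]

theorem wp_outputProg {W k σ r n : ℕ} {S A B : List ℕ} {s : State} {t : ℕ}
    (hC : Ctx k S σ r A B s) (hn : (A ++ σ :: B).length ≤ n) (hW : 6 * n + 9 ≤ W) :
    wp W outputProg (fun s' t' => output s' = A ++ σ :: B ∧ t' ≤ t + n * 120) s t := by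
  rw [List.length_append, List.length_cons] at hn
  obtain ⟨-, -, h1, -, h4, h5, hA, hB⟩ := hC
  unfold outputProg
  simp only [wp_seq, wp_assign]
  simp only [Expr.Fits, Expr.val, Expr.cost]
  refine ⟨by omega, ?_⟩
  refine wp_for A.length 20 (fun j s' => (∀ b, b ≠ 0 → s'.arr b = s.arr b) ∧
    (∀ x, x ≠ 9 → s'.reg x = s.reg x) ∧ s'.reg 9 = j ∧
    ∀ i (h : i < A.length), i < j → s'.arr 0 i = A[i]) ?_ ?_ ?_ ?_
  · rintro j s' t hj ⟨a1, a2, a3, a4⟩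
    have g5 := a1 5 (by omega)
    have f4 := a2 4 (by omega)
    simp [a3, g5, f4, h4, hA j hj, hj]
    refine ⟨by omega, by omega, fun b hb => by rw [if_neg hb, a1 b hb],
      fun x hx => by rw [if_neg hx, a2 x hx], fun i hi hi' => ?_⟩
    rcases eq_or_ne i j with rfl | hij
    · rw [Function.update_self]
    · rw [Function.update_of_ne hij, a4 i hi (by omega)]
  · rintro s' ⟨a1, a2, a3, a4⟩
    have f4 := a2 4 (by omega)
    simp [a3, f4, h4]
    omega
  · refine ⟨by simp, fun x hx => by simp [hx], by simp, by omega⟩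
  rintro s₁ t₁ ⟨a1, a2, a3, a4⟩ ht₁
  simp only [Expr.cost] at ht₁
  have f4 := a2 4 (by omega)
  have f1 := a2 1 (by omega)
  simp [f1, f4, h1, h4]
  refine ⟨by omega, ?_⟩
  refine wp_for B.length 20 (fun j s' => (∀ b, b ≠ 0 → s'.arr b = s.arr b) ∧
    (∀ x, x ≠ 9 → s'.reg x = s.reg x) ∧ s'.reg 9 = j ∧
    ∀ i (h : i < (A ++ σ :: B).length), i < A.length + 1 + j → s'.arr 0 i = (A ++ σ :: B)[i])
    ?_ ?_ ?_ ?_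
  · rintro j s' t hj ⟨b1, b2, b3, b4⟩
    have g6 := b1 6 (by omega)
    have f4 := b2 4 (by omega)
    have f5 := b2 5 (by omega)
    simp [b3, g6, f4, f5, h4, h5, hB j hj, hj]
    refine ⟨by omega, ⟨⟨by omega, by omega⟩, by omega⟩, ⟨by omega, by omega⟩,
      fun b hb => by rw [if_neg hb, b1 b hb], fun x hx => by rw [if_neg hx, b2 x hx],
      fun i hi hi' => ?_⟩
    rcases eq_or_ne i (A.length + 1 + j) with rfl | hij
    · rw [Function.update_self, List.getElem_append_right (by omega)]
      have e : A.length + 1 + j - A.length = j + 1 := by omega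
      simp [e]
    · rw [Function.update_of_ne hij, b4 i (by simpa using hi) (by omega)]
  · rintro s' ⟨a1, a2, a3, a4⟩
    have f5 := a2 5 (by omega)
    simp [a3, f5, h5]
    omega
  · refine ⟨fun b hb => by simp [hb, a1], fun x hx => by simp [hx, a2], by simp,
      fun i hi hi' => ?_⟩
    rcases eq_or_ne i A.length with rfl | hij
    · simp
    · have hi'' : i < A.length := by omega
      rw [List.getElem_append_left hi'']
      simpa [hij] using a4 i hi'' hi''
  · rintro s' t' ⟨b1, b2, b3, b4⟩ ht'
    have f4 := b2 4 (by omega)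
    have f5 := b2 5 (by omega)
    simp only [Expr.cost] at ht'
    simp [f4, f5, h4, h5]
    refine ⟨by omega, output_eq ?_ ?_, by omega⟩
    · simp; omega
    · intro i hi
      have := b4 i hi (by simp at hi; omega)
      simpa using this

end WordRAM

namespace KRep

theorem IsKRep.mul_count_le {α : Type*} [DecidableEq α] {k : ℕ} {S X : List α} (h : IsKRep k S X)
    (σ : α) : k * X.count σ ≤ S.count σ := by
  have := List.Sublist.count_le σ h
  simpa [List.count_flatten] using this

end KRep

namespace WordRAM
open KRep

/-- A word RAM program for the algorithm. -/
def extendProg : Program := tablesProg ;; splitProg ;; mainProg ;; outputProg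

theorem wp_extendProg {W k σ : ℕ} {S X : List ℕ} (hk : 0 < k) (hX : IsKRep k S X) (hσ : σ ∈ X)
    (hW : (S.length + 3) * (S.length + 3) ≤ W) :
    wp W extendProg (fun s t => output s = extendKRepSubseq mcs k S X σ ∧
      t ≤ 21000 * ((S.count σ - k * X.count σ + k).choose k * k * S.length *
        (Nat.log 2 S.length + 1))) (inputState k S X σ) 0 := by
  have hlin := linear_lt hW
  obtain ⟨hsplit, hnot⟩ := split_at_first hσ
  have hr : 0 < X.count σ := List.count_pos_iff.2 hσ
  have hkr := hX.mul_count_le σ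
  have hkn : k ≤ S.length :=
    (Nat.le_mul_of_pos_right k hr).trans (hkr.trans List.count_le_length)
  have hlX := (hX.sublist_of_pos hk).length_le
  have hC : 0 < (S.count σ - k * X.count σ + k).choose k := Nat.choose_pos (by omega)
  unfold extendKRepSubseq
  set A := X.takeWhile fun a => decide (a ≠ σ)
  set B := (X.dropWhile fun a => decide (a ≠ σ)).tail
  unfold extendProg
  simp only [wp_seq]
  refine wp.mono (wp_tablesProg (S := S) rfl (fun i => rfl) rfl rfl rfl hW) ?_
  rintro s₁ t₁ ⟨a1, a2, a3, a4⟩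
  refine wp.mono (wp_splitProg (A := A) (B := B) (σ := σ) (k := k) a1 (a3 0 (by omega) (by omega))
    (a3 1 (by omega) (by omega)) ?_ ?_ hnot hW hkn (by rwa [hsplit])) ?_
  · rw [hsplit, a3 3 (by omega) (by omega)]
    rfl
  · intro i
    rw [hsplit, a2 1 (by omega) (by omega) (by omega)]
    rfl
  rintro s₂ t₂ ⟨b1, b2, b3, b4, b5⟩
  rw [hsplit] at b1 b3
  refine wp.mono (wp_mainProg b1 (by rwa [hsplit]) hW hk hkn hr hkr rfl b3 b2 fun i _ _ => ?_) ?_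
  · rw [b4 7 (by omega) (by omega), a2 7 (by omega) (by omega) (by omega)]
    rfl
  rintro s₃ t₃ ⟨c1, c2⟩
  obtain ⟨-, -, hrep, -⟩ := foldl_extendStep_spec (S := S) (σ := σ) isMCSProcedure_mcs hk
    (potentialStarts (X.count σ) k (occurrences S σ)) (A, B)
  refine wp.mono (wp_outputProg c1
    ((hrep (by rwa [hsplit])).sublist_of_pos hk).length_le hlin) ?_
  rintro s₄ t₄ ⟨d1, d2⟩
  refine ⟨d1, ?_⟩
  set C := (S.count σ - k * X.count σ + k).choose k
  set L := Nat.log 2 S.length + 1 with hL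
  have e1 : S.length ≤ C * k * S.length * L := by
    calc S.length = 1 * 1 * S.length * 1 := by ring
      _ ≤ C * k * S.length * L := by gcongr <;> omega
  have e2 : C * k ≤ C * k * S.length * L := by
    calc C * k = C * k * 1 * 1 := by ring
      _ ≤ C * k * S.length * L := by gcongr <;> omega
  have e3 : C * (S.length * ((k + 1) * (10000 * L)) + (k + 1) * 100) ≤
      20000 * (C * k * S.length * L) + 200 * (C * k) := by
    calc C * (S.length * ((k + 1) * (10000 * L)) + (k + 1) * 100)
        ≤ C * (S.length * ((k + k) * (10000 * L)) + (k + k) * 100) := by gcongr <;> omega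
      _ = _ := by ring
  omega

theorem log_two_le {n : ℕ} (hn : 1 ≤ n) : (Nat.log 2 n + 1 : ℝ) ≤ 4 * Real.log (n + 1) := by
  have h1 : (2 : ℝ) ^ (Nat.log 2 n + 1) ≤ ((n : ℝ) + 1) ^ 2 := by
    have : 2 ^ (Nat.log 2 n + 1) ≤ (n + 1) ^ 2 := by
      have := Nat.pow_log_le_self 2 (x := n) (by omega)
      rw [pow_succ]
      nlinarith
    exact_mod_cast this
  have h2 := Real.log_le_log (by positivity) h1
  rw [Real.log_pow, Real.log_pow] at h2
  have h3 := Real.log_two_gt_d9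
  push_cast at h2
  nlinarith [(Nat.cast_nonneg (Nat.log 2 n) : (0 : ℝ) ≤ _)]

theorem exists_exec_extendProg {W k σ c : ℕ} {S X : List ℕ} (hk : 0 < k) (hX : IsKRep k S X)
    (hσ : σ ∈ X) (hc : 84000 ≤ c) (hW : (S.length + 1) ^ c ≤ W) :
    ∃ (s : State) (t : ℕ), Exec W extendProg (inputState k S X σ) s t ∧
      output s = extendKRepSubseq mcs k S X σ ∧
      (t : ℝ) ≤ c * ((S.count σ - k * X.count σ + k).choose k : ℝ) * k * S.length *
        Real.log (S.length + 1) := by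
  have hn : 1 ≤ S.length :=
    (List.length_pos_of_mem hσ).trans_le (hX.sublist_of_pos hk).length_le
  have hW' : (S.length + 3) * (S.length + 3) ≤ W := by
    have h1 : S.length + 3 ≤ (S.length + 1) ^ 2 := by nlinarith
    calc (S.length + 3) * (S.length + 3) ≤ (S.length + 1) ^ 2 * (S.length + 1) ^ 2 :=
          Nat.mul_le_mul h1 h1
      _ = (S.length + 1) ^ 4 := by ring
      _ ≤ (S.length + 1) ^ c := Nat.pow_le_pow_right (by omega) (by omega)
      _ ≤ W := hW
  obtain ⟨s, t, h1, h2, h3⟩ := wp_extendProg hk hX hσ hW'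
  refine ⟨s, t, h1, h2, ?_⟩
  rw [Nat.zero_add] at h3
  generalize (S.count σ - k * X.count σ + k).choose k = C at *
  have h4 : (t : ℝ) ≤ 21000 * (C * k * S.length * (Nat.log 2 S.length + 1)) := by
    exact_mod_cast h3
  have h5 := log_two_le hn
  have h6 : (84000 : ℝ) ≤ c := by exact_mod_cast hc
  have h7 : 0 ≤ Real.log ((S.length : ℝ) + 1) := Real.log_nonneg (by simp)
  calc (t : ℝ) ≤ 21000 * (C * k * S.length * (Nat.log 2 S.length + 1)) := h4
    _ ≤ 21000 * (C * k * S.length * (4 * Real.log (S.length + 1))) := by gcongr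
    _ = 84000 * C * k * S.length * Real.log (S.length + 1) := by ring
    _ ≤ c * C * k * S.length * Real.log (S.length + 1) := by gcongr

end WordRAM

theorem mainTheorem1 :
    (∀ (α : Type*) [DecidableEq α] (M : List (List α) → List α → List α),
      KRep.IsMCSProcedure M →
      ∀ (k : ℕ) (S X : List α) (σ : α), 0 < k → KRep.IsKRep k S X → σ ∈ X →
        KRep.IsMaxKRep k S (KRep.extendKRepSubseq M k S X σ) ∧
        X.Sublist (KRep.extendKRepSubseq M k S X σ)) ∧
    (∃ M : List (List ℕ) → List ℕ → List ℕ, KRep.IsMCSProcedure M ∧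
      ∃ (P : WordRAM.Program) (c : ℕ),
        ∀ (k : ℕ) (S X : List ℕ) (σ W : ℕ), 0 < k → KRep.IsKRep k S X → σ ∈ X →
          (∀ a ∈ S, a < W) → (S.length + 1) ^ c ≤ W →
          ∃ (s : WordRAM.State) (t : ℕ),
            WordRAM.Exec W P (WordRAM.inputState k S X σ) s t ∧
            WordRAM.output s = KRep.extendKRepSubseq M k S X σ ∧
            (t : ℝ) ≤ c * ((S.count σ - k * X.count σ + k).choose k : ℝ) *
              k * S.length * Real.log (S.length + 1)) :=
  ⟨fun _ _ _ hM _ _ _ _ hk hX hσ => KRep.extendKRepSubseq_isMaxKRep hM hk hX hσ,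
    KRep.mcs, KRep.isMCSProcedure_mcs, WordRAM.extendProg, 84000,
    fun _ _ _ _ _ hk hX hσ _ hW => WordRAM.exists_exec_extendProg hk hX hσ le_rfl hW⟩
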